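/- An instance consists of finite sets $\mathcal P$ of patients and $\mathcal C$ of categories, quotas $q_c\in\mathbb N$, and sets $B_c\subseteq E_c\subseteq\mathcal P$ of beneficiary and eligible patients for each $c\in\mathcal C$. A matching $\mu$ assigns to each patient at most one category, such that at most $q_c$ patients are assigned to $c$ and all of them lie in $E_c$. Let $E(\mu)$ be the set of pairs $(p,c)$ with $p$ assigned to $c$, and $B(\mu)$ the set of those with $p\in B_c$. A matching $\mu$ is dominated by $\mu'$ if $|E(\mu')|\ge|E(\mu)|$ and $|B(\mu')|\ge|B(\mu)|$ with at least one strict inequality; the non-domination frontier is $F=\{(|E(\mu)|,|B(\mu)|):\mu\text{ is not dominated by any matching}\}$. Let $n=\max(|\mathcal P|,\sum_{c}q_c)$ and assume $n\ge 1$. The Repeated Hungarian Algorithm (RHA) is the following. First loop: for $k=1,\dots,n$, find with the Hungarian algorithm a matching $\mu$ that maximizes $|E(\mu)\setminus B(\mu)|+\left(1+\frac1k+\frac1{n^2}\right)|B(\mu)|$, and append $(e,b)=(|E(\mu)|,|B(\mu)|)$ to the list of kinks unless it equals the last kink found. Let $(e_1,b_1),\dots,(e_m,b_m)$ be the kinks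 found. Second loop: for $k=1,\dots,m-1$ and $j=1,\dots,e_{k+1}-e_k-1$, add the point $\left(e_{k+1}-j,\; b_{k+1}+j\,\frac{b_k-b_{k+1}}{e_{k+1}-e_k}\right)$ of the segment between consecutive kinks. The output consists of the kinks and the points added. **Theorem 3 (Property of RHA).** 1. (Completeness) Whichever maximum-weight matchings are selected in the first loop, the set of points that RHA outputs is the entire non-domination frontier $F$. 2. (Computational complexity) RHA runs in $O(n^4)$ time when all quotas are positive, and in $O(n^4+z)$ time in general, where $z$ is the number of categories with quota $0$. Precisely: the RHA program, with the $n\times n$ Hungarian algorithm (shortest augmenting paths, dummy vertices with zero-weight edges) as its subroutine, on a random access machine that takes one step for each arithmetic operation or comparison of numbers, memory access, assignment, output instruction and branch, halts on every instance after at most $K(n^4+z)$ steps with an absolute constant $K$, and its output is that of RHA for some selection of maximum-weight matchings, hence is $F$. -/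

import Mathlib

namespace RHA

/-! ### Instances, matchings, the non-domination frontier -/

/-- An instance: patients `Fin numP`, categories `Fin numC`, quotas, eligible sets and
beneficiary sets, every beneficiary of a category being eligible for it. -/
structure Instance where
  numP : ℕ
  numC : ℕ
  quota : Fin numC → ℕ
  elig : Fin numC → Finset (Fin numP)
  bene : Fin numC → Finset (Fin numP)
  bene_subset : ∀ c, bene c ⊆ elig c

/-- The total number of seats. -/
def Instance.seats (I : Instance) : ℕ := ∑ c, I.quota c

/-- `n`, the maximum of the number of patients and the number of seats. -/
def Instance.n (I : Instance) : ℕ := max I.numP I.seats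

/-- An eligible matching. `assign p = none` means that `p` is unmatched. -/
structure Matching (I : Instance) where
  assign : Fin I.numP → Option (Fin I.numC)
  quota_le : ∀ c, (Finset.univ.filter fun p => assign p = some c).card ≤ I.quota c
  eligible : ∀ p c, assign p = some c → p ∈ I.elig c

/-- The set `E(μ)` of eligible matches. -/
def Matching.E {I : Instance} (μ : Matching I) : Finset (Fin I.numP × Fin I.numC) :=
  Finset.univ.filter fun x => μ.assign x.1 = some x.2 ∧ x.1 ∈ I.elig x.2

/-- The set `B(μ)` of beneficiary matches. -/
def Matching.B {I : Instance} (μ : Matching I) : Finset (Fin I.numP × Fin I.numC) :=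
  Finset.univ.filter fun x => μ.assign x.1 = some x.2 ∧ x.1 ∈ I.bene x.2

/-- The point `(|E(μ)|, |B(μ)|)`. -/
def Matching.point {I : Instance} (μ : Matching I) : ℕ × ℕ := (μ.E.card, μ.B.card)

/-- `μ` is dominated by `μ'`. -/
def Matching.DominatedBy {I : Instance} (μ μ' : Matching I) : Prop :=
  μ.E.card ≤ μ'.E.card ∧ μ.B.card ≤ μ'.B.card ∧
    (μ.E.card < μ'.E.card ∨ μ.B.card < μ'.B.card)

/-- No matching dominates `μ`. -/
def Matching.NonDominated {I : Instance} (μ : Matching I) : Prop :=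
  ∀ μ' : Matching I, ¬ μ.DominatedBy μ'

/-- The non-domination frontier. -/
def Instance.frontier (I : Instance) : Set (ℕ × ℕ) :=
  {x | ∃ μ : Matching I, μ.NonDominated ∧ μ.point = x}

/-- The frontier as a set of points of `ℚ × ℚ`. -/
def Instance.frontierQ (I : Instance) : Set (ℚ × ℚ) :=
  (fun x : ℕ × ℕ => ((x.1 : ℚ), (x.2 : ℚ))) '' I.frontier

/-! ### The Repeated Hungarian Algorithm, with maximum-weight matchings as given -/

/-- The weight of a beneficiary match in iteration `k`. -/
def Instance.wBene (I : Instance) (k : ℕ) : ℚ := 1 + 1 / (k : ℚ) + 1 / (I.n : ℚ) ^ 2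

/-- The weight of a matching in iteration `k`; eligible non-beneficiary matches have weight `1`. -/
def Matching.weight {I : Instance} (k : ℕ) (μ : Matching I) : ℚ :=
  1 * ((μ.E \ μ.B).card : ℚ) + I.wBene k * (μ.B.card : ℚ)

/-- `μ` is a maximum-weight matching in iteration `k`. -/
def Matching.IsMaxWeight {I : Instance} (k : ℕ) (μ : Matching I) : Prop :=
  ∀ μ' : Matching I, μ'.weight k ≤ μ.weight k

/-- Append the point `x` unless it is the last point found. -/
def addKink (L : List (ℕ × ℕ)) (x : ℕ × ℕ) : List (ℕ × ℕ) :=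
  if L.getLast? = some x then L else L ++ [x]

/-- The kinks found by the first loop when the iterations produce the points `pts`. -/
def kinks (pts : List (ℕ × ℕ)) : List (ℕ × ℕ) := pts.foldl addKink []

/-- The intermediate points between two consecutive kinks: for `j = 1, …, e' - e - 1` the point
`(e' - j, b' + j (b - b') / (e' - e))` of the segment from `(e, b)` to `(e', b')`. -/
def interpolate (x x' : ℕ × ℕ) : List (ℚ × ℚ) :=
  (List.range' 1 (x'.1 - x.1 - 1)).map fun j =>
    ((x'.1 : ℚ) - j, (x'.2 : ℚ) + j * ((x.2 : ℚ) - x'.2) / ((x'.1 : ℚ) - x.1))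

/-- The output of the algorithm when iteration `k` of the first loop selects the matching `μ k`:
first the kinks, then the intermediate points of every two consecutive kinks. -/
def Instance.output (I : Instance) (μ : ℕ → Matching I) : List (ℚ × ℚ) :=
  let K := kinks ((List.range' 1 I.n).map fun k => (μ k).point)
  K.map (fun x => ((x.1 : ℚ), (x.2 : ℚ))) ++
    (K.zip K.tail).flatMap fun y => interpolate y.1 y.2

/-! ### A random access machine with a step count

Programs are built from assignments, branching and loops. They work on natural-number and
rational variables and arrays (all arrays have two indices), and on an output tape. Every
arithmetic operation, comparison, variable or array access, constant, assignment, output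
instruction, branch and loop test takes one step. -/

/-- Natural-number variables. -/
inductive NVar where
  | numP | numC | numS | n | m | k | i | j | c | s | i0 | j0 | j1 | e | b
  deriving DecidableEq

/-- Rational variables. -/
inductive QVar where
  | wElig | wBene | cur | delta
  deriving DecidableEq

/-- Arrays of natural numbers. -/
inductive NArr where
  | quota | elig | bene | seat | used | mate | way | kinkE | kinkB
  deriving DecidableEq

/-- Arrays of rational numbers. -/
inductive QArr where
  | w | u | v | slack
  deriving DecidableEq

/-- The memory of the machine, and its output. -/
structure State where
  nv : NVar → ℕ
  qv : QVar → ℚ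
  na : NArr → ℕ → ℕ → ℕ
  qa : QArr → ℕ → ℕ → ℚ
  out : List (ℚ × ℚ)

/-- Natural-number expressions. -/
inductive NExp where
  | lit (x : ℕ)
  | var (x : NVar)
  | get (a : NArr) (i j : NExp)
  | add (x y : NExp)
  | sub (x y : NExp)

/-- The value of an expression (subtraction is truncated). -/
def NExp.eval (σ : State) : NExp → ℕ
  | .lit x => x
  | .var x => σ.nv x
  | .get a i j => σ.na a (i.eval σ) (j.eval σ)
  | .add x y => x.eval σ + y.eval σ
  | .sub x y => x.eval σ - y.eval σ

/-- The number of steps taken to evaluate an expression. -/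
def NExp.cost : NExp → ℕ
  | .lit _ => 1
  | .var _ => 1
  | .get _ i j => 1 + i.cost + j.cost
  | .add x y => 1 + x.cost + y.cost
  | .sub x y => 1 + x.cost + y.cost

/-- Rational expressions. -/
inductive QExp where
  | ofNat (x : NExp)
  | var (x : QVar)
  | get (a : QArr) (i j : NExp)
  | add (x y : QExp)
  | sub (x y : QExp)
  | mul (x y : QExp)
  | div (x y : QExp)

/-- The value of an expression. -/
def QExp.eval (σ : State) : QExp → ℚ
  | .ofNat x => (x.eval σ : ℚ)
  | .var x => σ.qv x
  | .get a i j => σ.qa a (i.eval σ) (j.eval σ)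
  | .add x y => x.eval σ + y.eval σ
  | .sub x y => x.eval σ - y.eval σ
  | .mul x y => x.eval σ * y.eval σ
  | .div x y => x.eval σ / y.eval σ

/-- The number of steps taken to evaluate an expression. -/
def QExp.cost : QExp → ℕ
  | .ofNat x => 1 + x.cost
  | .var _ => 1
  | .get _ i j => 1 + i.cost + j.cost
  | .add x y => 1 + x.cost + y.cost
  | .sub x y => 1 + x.cost + y.cost
  | .mul x y => 1 + x.cost + y.cost
  | .div x y => 1 + x.cost + y.cost

/-- Conditions. -/
inductive BExp where
  | neq (x y : NExp)
  | nle (x y : NExp)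
  | nlt (x y : NExp)
  | qlt (x y : QExp)
  | not (c : BExp)
  | and (c d : BExp)
  | or (c d : BExp)

/-- The value of a condition (`neq` is equality of natural numbers). -/
def BExp.eval (σ : State) : BExp → Bool
  | .neq x y => decide (x.eval σ = y.eval σ)
  | .nle x y => decide (x.eval σ ≤ y.eval σ)
  | .nlt x y => decide (x.eval σ < y.eval σ)
  | .qlt x y => decide (x.eval σ < y.eval σ)
  | .not c => !c.eval σ
  | .and c d => c.eval σ && d.eval σ
  | .or c d => c.eval σ || d.eval σ

/-- The number of steps taken to evaluate a condition. -/
def BExp.cost : BExp → ℕ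
  | .neq x y => 1 + x.cost + y.cost
  | .nle x y => 1 + x.cost + y.cost
  | .nlt x y => 1 + x.cost + y.cost
  | .qlt x y => 1 + x.cost + y.cost
  | .not c => 1 + c.cost
  | .and c d => 1 + c.cost + d.cost
  | .or c d => 1 + c.cost + d.cost

/-- Programs. -/
inductive Stmt where
  | skip
  | setN (x : NVar) (v : NExp)
  | setQ (x : QVar) (v : QExp)
  | putN (a : NArr) (i j v : NExp)
  | putQ (a : QArr) (i j : NExp) (v : QExp)
  | emit (x y : QExp)
  | seq (s t : Stmt)
  | ite (c : BExp) (s t : Stmt)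
  | loop (c : BExp) (s : Stmt)

/-- The entry `(i, j)` of the array `a` is replaced by `v`. -/
def updateArr {A α : Type} [DecidableEq A] (f : A → ℕ → ℕ → α) (a : A) (i j : ℕ) (v : α) :
    A → ℕ → ℕ → α :=
  fun a' i' j' => if a' = a ∧ i' = i ∧ j' = j then v else f a' i' j'

/-- `Exec s σ t σ'`: the program `s`, started in the state `σ`, halts after exactly `t` steps
in the state `σ'`. -/
inductive Exec : Stmt → State → ℕ → State → Prop
  | skip (σ : State) : Exec .skip σ 1 σ
  | setN (σ : State) (x : NVar) (v : NExp) :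
      Exec (.setN x v) σ (1 + v.cost) { σ with nv := Function.update σ.nv x (v.eval σ) }
  | setQ (σ : State) (x : QVar) (v : QExp) :
      Exec (.setQ x v) σ (1 + v.cost) { σ with qv := Function.update σ.qv x (v.eval σ) }
  | putN (σ : State) (a : NArr) (i j v : NExp) :
      Exec (.putN a i j v) σ (1 + i.cost + j.cost + v.cost)
        { σ with na := updateArr σ.na a (i.eval σ) (j.eval σ) (v.eval σ) }
  | putQ (σ : State) (a : QArr) (i j : NExp) (v : QExp) :
      Exec (.putQ a i j v) σ (1 + i.cost + j.cost + v.cost)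
        { σ with qa := updateArr σ.qa a (i.eval σ) (j.eval σ) (v.eval σ) }
  | emit (σ : State) (x y : QExp) :
      Exec (.emit x y) σ (1 + x.cost + y.cost)
        { σ with out := σ.out ++ [(x.eval σ, y.eval σ)] }
  | seq {s₁ s₂ : Stmt} {σ σ₁ σ₂ : State} {t₁ t₂ : ℕ} (h₁ : Exec s₁ σ t₁ σ₁)
      (h₂ : Exec s₂ σ₁ t₂ σ₂) : Exec (.seq s₁ s₂) σ (t₁ + t₂) σ₂
  | ite_true {c : BExp} {s₁ s₂ : Stmt} {σ σ' : State} {t : ℕ} (hc : c.eval σ = true)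
      (h : Exec s₁ σ t σ') : Exec (.ite c s₁ s₂) σ (1 + c.cost + t) σ'
  | ite_false {c : BExp} {s₁ s₂ : Stmt} {σ σ' : State} {t : ℕ} (hc : c.eval σ = false)
      (h : Exec s₂ σ t σ') : Exec (.ite c s₁ s₂) σ (1 + c.cost + t) σ'
  | loop_true {c : BExp} {s : Stmt} {σ σ₁ σ₂ : State} {t₁ t₂ : ℕ} (hc : c.eval σ = true)
      (h₁ : Exec s σ t₁ σ₁) (h₂ : Exec (.loop c s) σ₁ t₂ σ₂) :
      Exec (.loop c s) σ (1 + c.cost + t₁ + t₂) σ₂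
  | loop_false {c : BExp} {s : Stmt} {σ : State} (hc : c.eval σ = false) :
      Exec (.loop c s) σ (1 + c.cost) σ

instance : Coe NVar NExp := ⟨NExp.var⟩
instance : Coe QVar QExp := ⟨QExp.var⟩

infixl:65 " +ₙ " => NExp.add
infixl:65 " -ₙ " => NExp.sub
infixl:65 " +ᵣ " => QExp.add
infixl:65 " -ᵣ " => QExp.sub
infixl:70 " *ᵣ " => QExp.mul
infixl:70 " /ᵣ " => QExp.div
infix:50 " =ₙ " => BExp.neq
infix:50 " ≤ₙ " => BExp.nle
infix:50 " <ₙ " => BExp.nlt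
infix:50 " <ᵣ " => BExp.qlt
infix:40 " ≔ₙ " => Stmt.setN
infix:40 " ≔ᵣ " => Stmt.setQ
infixr:30 " ;; " => Stmt.seq

/-- The constant `x`. -/
abbrev num (x : ℕ) : NExp := .lit x
/-- The rational constant `x`. -/
abbrev rat (x : ℕ) : QExp := .ofNat (.lit x)
/-- The value of a natural-number variable as a rational number. -/
abbrev toQ (x : NExp) : QExp := .ofNat x
/-- Read an array with one index. -/
abbrev getN (a : NArr) (i : NExp) : NExp := .get a i (.lit 0)
/-- Read an array with one index. -/
abbrev getQ (a : QArr) (i : NExp) : QExp := .get a i (.lit 0)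
/-- Write an array with one index. -/
abbrev putN1 (a : NArr) (i v : NExp) : Stmt := .putN a i (.lit 0) v
/-- Write an array with one index. -/
abbrev putQ1 (a : QArr) (i : NExp) (v : QExp) : Stmt := .putQ a i (.lit 0) v
/-- Branching without alternative. -/
abbrev ifThen (c : BExp) (s : Stmt) : Stmt := .ite c s .skip
/-- `for x = lo, …, hi do s`. -/
abbrev forTo (x : NVar) (lo hi : NExp) (s : Stmt) : Stmt :=
  x ≔ₙ lo ;; .loop (.var x ≤ₙ hi) (s ;; x ≔ₙ .var x +ₙ .lit 1)

/-! ### The program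

Patients are numbered `1, …, numP` and seats `1, …, numS` in the program (entry `i - 1` of the
input tables belongs to patient `i`); `seat j` is the category of the seat `j`. -/

/-- List the seats of all categories, and compute `n`. -/
def setupProg : Stmt :=
  NVar.numS ≔ₙ num 0 ;;
  NVar.c ≔ₙ num 0 ;;
  .loop (NVar.c <ₙ NVar.numC) (
    forTo .s (num 1) (getN .quota NVar.c) (
      NVar.numS ≔ₙ NVar.numS +ₙ num 1 ;;
      putN1 .seat NVar.numS NVar.c) ;;
    NVar.c ≔ₙ NVar.c +ₙ num 1) ;;
  .ite (NVar.numS ≤ₙ NVar.numP) (NVar.n ≔ₙ NVar.numP) (NVar.n ≔ₙ NVar.numS)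

/-- Assign the weights of iteration `k`: eligible pairs of a patient and a seat have weight
`wElig` or `wBene`; all other pairs, and those with a dummy vertex, have weight `0`. -/
def weightsProg : Stmt :=
  QVar.wElig ≔ᵣ rat 1 ;;
  QVar.wBene ≔ᵣ rat 1 +ᵣ rat 1 /ᵣ toQ NVar.k +ᵣ rat 1 /ᵣ (toQ NVar.n *ᵣ toQ NVar.n) ;;
  forTo .i (num 1) NVar.n (
    forTo .j (num 1) NVar.n (
      .putQ .w NVar.i NVar.j (rat 0) ;;
      ifThen (.and (NVar.i ≤ₙ NVar.numP) (NVar.j ≤ₙ NVar.numS)) (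
        .ite (.get .bene (NVar.i -ₙ num 1) (getN .seat NVar.j) =ₙ num 1)
          (.putQ .w NVar.i NVar.j QVar.wBene)
          (ifThen (.get .elig (NVar.i -ₙ num 1) (getN .seat NVar.j) =ₙ num 1)
            (.putQ .w NVar.i NVar.j QVar.wElig)))))

/-- One search step of the Hungarian algorithm: the column `j0` joins the alternating tree, the
slacks are updated, the dual variables are changed by the least slack `delta`, and the column
`j1` that attains it becomes the current one. -/
def searchProg : Stmt :=
  putN1 .used NVar.j0 (num 1) ;;
  NVar.i0 ≔ₙ getN .mate NVar.j0 ;;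
  NVar.j1 ≔ₙ num 0 ;;
  forTo .j (num 1) NVar.n (
    ifThen (getN .used NVar.j =ₙ num 0) (
      QVar.cur ≔ᵣ getQ .u NVar.i0 +ᵣ getQ .v NVar.j -ᵣ .get .w NVar.i0 NVar.j ;;
      ifThen (.or (NVar.j0 =ₙ num 0) (QVar.cur <ᵣ getQ .slack NVar.j)) (
        putQ1 .slack NVar.j QVar.cur ;;
        putN1 .way NVar.j NVar.j0) ;;
      ifThen (.or (NVar.j1 =ₙ num 0) (getQ .slack NVar.j <ᵣ QVar.delta)) (
        QVar.delta ≔ᵣ getQ .slack NVar.j ;;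
        NVar.j1 ≔ₙ NVar.j))) ;;
  forTo .j (num 0) NVar.n (
    .ite (getN .used NVar.j =ₙ num 1) (
      putQ1 .u (getN .mate NVar.j) (getQ .u (getN .mate NVar.j) -ᵣ QVar.delta) ;;
      putQ1 .v NVar.j (getQ .v NVar.j +ᵣ QVar.delta)) (
      putQ1 .slack NVar.j (getQ .slack NVar.j -ᵣ QVar.delta))) ;;
  NVar.j0 ≔ₙ NVar.j1

/-- The Hungarian algorithm for a maximum-weight perfect matching of the complete bipartite
graph on rows `1, …, n` and columns `1, …, n` with weights `w`. The dual variables are `u`, `v`;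
`mate j` is the row matched to column `j` (`0` if none), and column `0` is a root for the
search. The rows are matched one after the other along augmenting paths. -/
def hungarianProg : Stmt :=
  forTo .j (num 0) NVar.n (
    putQ1 .u NVar.j (rat 0) ;;
    putQ1 .v NVar.j (rat 0) ;;
    putN1 .mate NVar.j (num 0)) ;;
  forTo .i (num 1) NVar.n (
    putN1 .mate (num 0) NVar.i ;;
    NVar.j0 ≔ₙ num 0 ;;
    forTo .j (num 0) NVar.n (putN1 .used NVar.j (num 0)) ;;
    .loop (.not (getN .mate NVar.j0 =ₙ num 0)) searchProg ;;
    .loop (.not (NVar.j0 =ₙ num 0)) (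
      NVar.j1 ≔ₙ getN .way NVar.j0 ;;
      putN1 .mate NVar.j0 (getN .mate NVar.j1) ;;
      NVar.j0 ≔ₙ NVar.j1))

/-- Count the eligible matches `e` and the beneficiary matches `b` of the matching found. -/
def countProg : Stmt :=
  NVar.e ≔ₙ num 0 ;;
  NVar.b ≔ₙ num 0 ;;
  forTo .j (num 1) NVar.numS (
    NVar.i ≔ₙ getN .mate NVar.j ;;
    ifThen (NVar.i ≤ₙ NVar.numP) (
      ifThen (.get .elig (NVar.i -ₙ num 1) (getN .seat NVar.j) =ₙ num 1)
        (NVar.e ≔ₙ NVar.e +ₙ num 1) ;;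
      ifThen (.get .bene (NVar.i -ₙ num 1) (getN .seat NVar.j) =ₙ num 1)
        (NVar.b ≔ₙ NVar.b +ₙ num 1)))

/-- Record `(e, b)` as a new kink unless it is the last kink found; `m` counts the kinks. -/
def kinkProg : Stmt :=
  ifThen (.or (NVar.m =ₙ num 0)
      (.not (.and (NVar.e =ₙ getN .kinkE NVar.m) (NVar.b =ₙ getN .kinkB NVar.m)))) (
    NVar.m ≔ₙ NVar.m +ₙ num 1 ;;
    putN1 .kinkE NVar.m NVar.e ;;
    putN1 .kinkB NVar.m NVar.b ;;
    .emit (toQ NVar.e) (toQ NVar.b))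

/-- The first loop: the kinks. -/
def firstLoopProg : Stmt :=
  NVar.m ≔ₙ num 0 ;;
  forTo .k (num 1) NVar.n (weightsProg ;; hungarianProg ;; countProg ;; kinkProg)

/-- The second loop: the intermediate points, by linear interpolation. -/
def secondLoopProg : Stmt :=
  forTo .k (num 1) (NVar.m -ₙ num 1) (
    forTo .j (num 1) (getN .kinkE (NVar.k +ₙ num 1) -ₙ getN .kinkE NVar.k -ₙ num 1) (
      .emit (toQ (getN .kinkE (NVar.k +ₙ num 1)) -ᵣ toQ NVar.j)
        (toQ (getN .kinkB (NVar.k +ₙ num 1)) +ᵣ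
          toQ NVar.j *ᵣ (toQ (getN .kinkB NVar.k) -ᵣ toQ (getN .kinkB (NVar.k +ₙ num 1))) /ᵣ
            (toQ (getN .kinkE (NVar.k +ₙ num 1)) -ᵣ toQ (getN .kinkE NVar.k)))))

/-- The Repeated Hungarian Algorithm. -/
def rhaProg : Stmt := setupProg ;; firstLoopProg ;; secondLoopProg

/-- The initial state: the memory holds the numbers of patients and categories, the quotas
`quota c`, and the `0`-`1`-tables of the eligible and the beneficiary pairs `(p, c)`; everything
else is `0`, and the output is empty. -/
def Instance.init (I : Instance) : State where
  nv x := match x with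
    | .numP => I.numP
    | .numC => I.numC
    | _ => 0
  qv _ := 0
  na a i j := match a with
    | .quota => if h : i < I.numC ∧ j = 0 then I.quota ⟨i, h.1⟩ else 0
    | .elig => if h : i < I.numP ∧ j < I.numC then
        (if (⟨i, h.1⟩ : Fin I.numP) ∈ I.elig ⟨j, h.2⟩ then 1 else 0) else 0
    | .bene => if h : i < I.numP ∧ j < I.numC then
        (if (⟨i, h.1⟩ : Fin I.numP) ∈ I.bene ⟨j, h.2⟩ then 1 else 0) else 0
    | _ => 0
  qa _ _ _ := 0
  out := []

end RHA

/-!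
Let `f e` be the greatest number of beneficiaries in a matching with `e` matches, for `e` up to the
greatest number `ν` of matches (`Instance.Profile`).

**Completeness.** The function `f` is concave (`Instance.Profile.concave`): half the sum of a matching
with `e` and one with `e + 2` matches is a fractional matching of size `e + 1`, and by Birkhoff's
theorem an integral matching in its support has at least as many beneficiaries
(`Matching.exists_between`). So the frontier is the part of the graph of `f` to the right of the point
where `f` begins to decrease, and there the slopes of `f` are negative integers. In iteration `k`, with
`n ≥ ν`, a beneficiary is worth slightly more than `1 / k` but, as `k (k - 1) < n ^ 2`, less than
`1 / (k - 1)` of a match. Hence every maximum-weight matching lies at the unique `e` such that matches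
up to `e` cost less than `k` beneficiaries each, and later ones at least `k`
(`Instance.Profile.isKink`). Between the points of the iterations `k` and `k + 1` every match costs
exactly `k` beneficiaries, so the graph of `f` is a segment there, and linear interpolation yields
exactly its integral points (`output_eq_frontier`).

**Running time.** `Runs s σ T Q` says that the program `s` halts within `T` steps in a state with the
property `Q`. Its rules for composition and for loops, together with the fact that a program changes
only the variables it writes to (`Exec.keeps`), reduce each subprogram to the invariants of its loops.
For the Hungarian algorithm these say that the dual variables are feasible and are tight on the
matching and on the alternating tree (`Search`, `Search.step`), and that shifting the matching along
the path to the root preserves this (`Augment.step`). Each of the at most `n` rows needs at most `n + 1`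
search steps of linear time, so the algorithm is cubic (`hungarian_spec`). By weak duality the perfect
matching it finds has maximum weight among all permutations. Its eligible pairs form a matching of the
instance, which has maximum weight since every matching extends to a permutation
(`exists_isMaxWeight`). The first loop runs the Hungarian algorithm `n` times, which dominates
everything else except that listing the seats also passes through the categories with quota `0`
(`setup_spec`).
-/

namespace RHA

/-! ### Total correctness with time bounds -/

/-- The statement `s`, started in `σ`, halts after at most `T` steps in a state satisfying `Q`. -/
def Runs (s : Stmt) (σ : State) (T : ℕ) (Q : State → Prop) : Prop :=
  ∃ t σ', Exec s σ t σ' ∧ t ≤ T ∧ Q σ'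

/-- The parts of the memory, and the output tape. -/
inductive Loc where
  | nv (x : NVar)
  | qv (x : QVar)
  | na (a : NArr)
  | qa (a : QArr)
  | out

/-- The states `σ` and `σ'` agree on one part of the memory. -/
def Loc.Same (σ σ' : State) : Loc → Prop
  | .nv x => σ'.nv x = σ.nv x
  | .qv x => σ'.qv x = σ.qv x
  | .na a => σ'.na a = σ.na a
  | .qa a => σ'.qa a = σ.qa a
  | .out => σ'.out = σ.out

/-- Whether a write to the given part of the memory occurs in a program text. -/
def Stmt.writes : Stmt → Loc → Bool
  | .setN x _, .nv y => decide (x = y)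
  | .setQ x _, .qv y => decide (x = y)
  | .putN a _ _ _, .na b => decide (a = b)
  | .putQ a _ _ _, .qa b => decide (a = b)
  | .emit _ _, .out => true
  | .seq s t, l => s.writes l || t.writes l
  | .ite _ s t, l => s.writes l || t.writes l
  | .loop _ s, l => s.writes l
  | _, _ => false

/-- `σ'` agrees with `σ` on everything that `s` does not write to. -/
def Keeps (s : Stmt) (σ σ' : State) : Prop := ∀ l, s.writes l = false → l.Same σ σ'

theorem Loc.Same.refl (σ : State) (l : Loc) : l.Same σ σ := by cases l <;> rfl

theorem Loc.Same.trans {σ σ₁ σ₂ : State} {l : Loc} (h : l.Same σ σ₁) (h' : l.Same σ₁ σ₂) :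
    l.Same σ σ₂ := by
  cases l <;> exact Eq.trans h' h

theorem Keeps.nv {s : Stmt} {σ σ' : State} (h : Keeps s σ σ') (x : NVar)
    (hx : s.writes (.nv x) = false) : σ'.nv x = σ.nv x := h _ hx

theorem Keeps.qv {s : Stmt} {σ σ' : State} (h : Keeps s σ σ') (x : QVar)
    (hx : s.writes (.qv x) = false) : σ'.qv x = σ.qv x := h _ hx

theorem Keeps.na {s : Stmt} {σ σ' : State} (h : Keeps s σ σ') (a : NArr)
    (ha : s.writes (.na a) = false) : σ'.na a = σ.na a := h _ ha

theorem Keeps.qa {s : Stmt} {σ σ' : State} (h : Keeps s σ σ') (a : QArr)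
    (ha : s.writes (.qa a) = false) : σ'.qa a = σ.qa a := h _ ha

theorem Keeps.out {s : Stmt} {σ σ' : State} (h : Keeps s σ σ')
    (ho : s.writes .out = false) : σ'.out = σ.out := h _ ho

theorem Keeps.refl (s : Stmt) (σ : State) : Keeps s σ σ := fun l _ => Loc.Same.refl σ l

theorem Keeps.trans {s : Stmt} {σ σ₁ σ₂ : State} (h : Keeps s σ σ₁) (h' : Keeps s σ₁ σ₂) :
    Keeps s σ σ₂ := fun l hl => (h l hl).trans (h' l hl)

theorem Keeps.mono {s s' : Stmt} {σ σ' : State} (h : Keeps s σ σ')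
    (hs : ∀ l, s'.writes l = false → s.writes l = false) : Keeps s' σ σ' :=
  fun l hl => h l (hs l hl)

/-- An execution changes only what occurs on the left of an assignment in the program. -/
theorem Exec.keeps {s : Stmt} {σ σ' : State} {t : ℕ} (h : Exec s σ t σ') : Keeps s σ σ' := by
  induction h with
  | skip σ => exact Keeps.refl _ _
  | setN σ x v =>
    intro l hl
    cases l with
    | nv y =>
      have : ¬ x = y := by simpa [Stmt.writes] using hl
      simp [Loc.Same, Function.update_of_ne (Ne.symm this)]
    | _ => rfl
  | setQ σ x v =>
    intro l hl
    cases l with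
    | qv y =>
      have : ¬ x = y := by simpa [Stmt.writes] using hl
      simp [Loc.Same, Function.update_of_ne (Ne.symm this)]
    | _ => rfl
  | putN σ a i j v =>
    intro l hl
    cases l with
    | na b =>
      have : ¬ a = b := by simpa [Stmt.writes] using hl
      have : ¬ b = a := fun h => this h.symm
      funext i' j'
      simp [updateArr, this]
    | _ => rfl
  | putQ σ a i j v =>
    intro l hl
    cases l with
    | qa b =>
      have : ¬ a = b := by simpa [Stmt.writes] using hl
      have : ¬ b = a := fun h => this h.symm
      funext i' j'
      simp [updateArr, this]
    | _ => rfl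
  | emit σ x y =>
    intro l hl
    cases l with
    | out => simp [Stmt.writes] at hl
    | _ => rfl
  | seq _ _ ih₁ ih₂ =>
    exact (ih₁.mono (by simp +contextual [Stmt.writes])).trans
      (ih₂.mono (by simp +contextual [Stmt.writes]))
  | ite_true _ _ ih => exact ih.mono (by simp +contextual [Stmt.writes])
  | ite_false _ _ ih => exact ih.mono (by simp +contextual [Stmt.writes])
  | loop_true _ _ _ ih₁ ih₂ => exact (ih₁.mono (by simp [Stmt.writes])).trans ih₂
  | loop_false _ => exact Keeps.refl _ _

theorem Runs.mono {s : Stmt} {σ : State} {T T' : ℕ} {Q Q' : State → Prop} (h : Runs s σ T Q)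
    (hT : T ≤ T') (hQ : ∀ σ', Keeps s σ σ' → Q σ' → Q' σ') : Runs s σ T' Q' := by
  obtain ⟨t, σ', h, ht, hq⟩ := h
  exact ⟨t, σ', h, ht.trans hT, hQ _ h.keeps hq⟩

theorem Runs.seq {s₁ s₂ : Stmt} {σ : State} {T₁ T₂ T : ℕ} {R Q : State → Prop}
    (h₁ : Runs s₁ σ T₁ R) (h₂ : ∀ σ₁, Keeps s₁ σ σ₁ → R σ₁ → Runs s₂ σ₁ T₂ Q)
    (hT : T₁ + T₂ ≤ T) : Runs (s₁ ;; s₂) σ T Q := by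
  obtain ⟨t, σ₁, h, ht, hq⟩ := h₁
  obtain ⟨t', σ₂, h', ht', hq'⟩ := h₂ σ₁ h.keeps hq
  exact ⟨t + t', σ₂, .seq h h', by omega, hq'⟩

/-- A loop each of whose iterations is paid for by a decrease of the potential `Φ`. -/
theorem Runs.loop_potential {c : BExp} {s : Stmt} (Inv : State → Prop) (Φ : State → ℕ)
    (hstep : ∀ σ, Inv σ → c.eval σ = true →
      ∃ T, Runs s σ T (fun σ' => Inv σ' ∧ T + 1 + c.cost + Φ σ' ≤ Φ σ)) (N : ℕ) :
    ∀ σ, Inv σ → Φ σ ≤ N →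
      Runs (.loop c s) σ (N + 1 + c.cost) (fun σ' => Inv σ' ∧ c.eval σ' = false) := by
  induction N using Nat.strong_induction_on with
  | _ N ih =>
    intro σ hI hΦ
    cases hc : c.eval σ with
    | false => exact ⟨_, σ, .loop_false hc, by omega, hI, hc⟩
    | true =>
      obtain ⟨T, t, σ₁, h, ht, hI₁, hΦ₁⟩ := hstep σ hI hc
      obtain ⟨t', σ₂, h', ht', hq⟩ := ih (Φ σ₁) (by omega) σ₁ hI₁ le_rfl
      exact ⟨_, σ₂, .loop_true hc h h', by omega, hq⟩

/-- A loop whose test succeeds at most `N` times, since the measure `V` decreases. -/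
theorem Runs.loop {c : BExp} {s : Stmt} {T : ℕ} (Inv : State → Prop) (V : State → ℕ)
    (hstep : ∀ σ, Inv σ → c.eval σ = true →
      Runs s σ T (fun σ' => Inv σ' ∧ V σ' < V σ)) (N : ℕ)
    (σ : State) (hI : Inv σ) (hV : V σ ≤ N) :
    Runs (.loop c s) σ (N * (T + 1 + c.cost) + 1 + c.cost)
      (fun σ' => Inv σ' ∧ c.eval σ' = false) := by
  refine Runs.loop_potential Inv (fun σ => V σ * (T + 1 + c.cost)) (fun σ hI hc => ⟨T, ?_⟩) _ σ hI
    (Nat.mul_le_mul_right _ hV)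
  refine (hstep σ hI hc).mono le_rfl fun σ' _ ⟨hI', hV'⟩ => ⟨hI', ?_⟩
  have := Nat.mul_le_mul_right (T + 1 + c.cost) (Nat.succ_le_of_lt hV')
  rw [Nat.succ_mul] at this
  omega

/-- Rule for counting loops. The invariant `Inv j` holds whenever the loop variable `x` has been
set to `j`; it must not depend on `x` itself. -/
theorem Runs.forTo {x : NVar} {lo hi : NExp} {s : Stmt} {σ : State} {T T' L H : ℕ}
    {Q : State → Prop} (Inv : ℕ → State → Prop) (hL : lo.eval σ = L) (hLH : L ≤ H + 1)
    (hx : s.writes (.nv x) = false)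
    (hhi : ∀ σ', Keeps (RHA.forTo x lo hi s) σ σ' → hi.eval σ' = H)
    (hInv : ∀ j σ' v, Inv j σ' → Inv j { σ' with nv := Function.update σ'.nv x v })
    (h0 : Inv L σ)
    (hstep : ∀ j σ', L ≤ j → j ≤ H → σ'.nv x = j → Keeps (RHA.forTo x lo hi s) σ σ' → Inv j σ' →
      Runs s σ' T (fun σ'' => Inv (j + 1) σ''))
    (hT : (H + 1 - L) * (T + hi.cost + 7) + lo.cost + hi.cost + 4 ≤ T')
    (hQ : ∀ σ', Keeps (RHA.forTo x lo hi s) σ σ' → Inv (H + 1) σ' → Q σ') :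
    Runs (RHA.forTo x lo hi s) σ T' Q := by
  have key : ∀ d σ', σ'.nv x + d = H + 1 → L ≤ σ'.nv x → Keeps (RHA.forTo x lo hi s) σ σ' →
      Inv (σ'.nv x) σ' →
      Runs (.loop (.var x ≤ₙ hi) (s ;; x ≔ₙ .var x +ₙ .lit 1)) σ'
        (d * (T + hi.cost + 7) + hi.cost + 3) (fun σ'' => Inv (H + 1) σ'') := by
    intro d
    induction d with
    | zero =>
      intro σ' hd _ hK hI
      refine ⟨_, σ', .loop_false ?_, ?_, ?_⟩
      · simp only [BExp.eval, NExp.eval, hhi σ' hK]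
        simp; omega
      · simp only [BExp.cost, NExp.cost]; omega
      · have : σ'.nv x = H + 1 := by omega
        rwa [this] at hI
    | succ d ih =>
      intro σ' hd hL' hK hI
      obtain ⟨t, σ₁, h, ht, hI₁⟩ := hstep (σ'.nv x) σ' hL' (by omega) rfl hK hI
      have hx₁ : σ₁.nv x = σ'.nv x := h.keeps (.nv x) hx
      have e₂ := Exec.seq h (Exec.setN σ₁ x (.var x +ₙ .lit 1))
      have hK₂ := hK.trans (e₂.keeps.mono (s' := RHA.forTo x lo hi s) (by
        intro l hl
        simp only [Stmt.writes, Bool.or_eq_false_iff] at hl ⊢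
        exact hl.2))
      have hn : Function.update σ₁.nv x ((NExp.var x +ₙ .lit 1).eval σ₁) x = σ'.nv x + 1 := by
        simp [NExp.eval, hx₁]
      obtain ⟨t', σ₂, h', ht', hq⟩ := ih _ (by simp only [hn]; omega) (by simp only [hn]; omega) hK₂
        (by simp only [hn]; exact hInv _ _ _ hI₁)
      refine ⟨_, σ₂, .loop_true ?_ e₂ h', ?_, hq⟩
      · simp only [BExp.eval, NExp.eval, hhi σ' hK]
        simp; omega
      · simp only [BExp.cost, NExp.cost]
        rw [Nat.succ_mul]
        omega
  have e₀ := Exec.setN σ x lo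
  have hn : Function.update σ.nv x (lo.eval σ) x = L := by simp [hL]
  obtain ⟨t, σ₁, h, ht, hq⟩ := key (H + 1 - L) _ (by simp only [hn]; omega) (by simp only [hn]; rfl)
    (e₀.keeps.mono (by
        intro l hl
        rw [Stmt.writes, Bool.or_eq_false_iff] at hl
        exact hl.1)) (by simp only [hn]; exact hInv _ _ _ h0)
  have e := Exec.seq e₀ h
  exact ⟨_, σ₁, e, by omega, hQ _ e.keeps hq⟩

theorem BExp.neq_iff {σ : State} {x y : NExp} :
    (x =ₙ y).eval σ = true ↔ x.eval σ = y.eval σ := decide_eq_true_iff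

theorem BExp.nle_iff {σ : State} {x y : NExp} :
    (x ≤ₙ y).eval σ = true ↔ x.eval σ ≤ y.eval σ := decide_eq_true_iff

theorem BExp.not_iff {σ : State} {c : BExp} : c.not.eval σ = true ↔ ¬ c.eval σ = true := by
  simp [BExp.eval]

theorem BExp.and_iff {σ : State} {c d : BExp} :
    (c.and d).eval σ = true ↔ c.eval σ = true ∧ d.eval σ = true := Bool.and_eq_true_iff

theorem BExp.or_iff {σ : State} {c d : BExp} :
    (c.or d).eval σ = true ↔ c.eval σ = true ∨ d.eval σ = true := Bool.or_eq_true_iff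

/-- The final state of a program without loops. -/
def Stmt.run : Stmt → State → State
  | .skip, σ => σ
  | .setN x v, σ => { σ with nv := Function.update σ.nv x (v.eval σ) }
  | .setQ x v, σ => { σ with qv := Function.update σ.qv x (v.eval σ) }
  | .putN a i j v, σ => { σ with na := updateArr σ.na a (i.eval σ) (j.eval σ) (v.eval σ) }
  | .putQ a i j v, σ => { σ with qa := updateArr σ.qa a (i.eval σ) (j.eval σ) (v.eval σ) }
  | .emit x y, σ => { σ with out := σ.out ++ [(x.eval σ, y.eval σ)] }
  | .seq s t, σ => t.run (s.run σ)
  | .ite c s t, σ => if c.eval σ then s.run σ else t.run σ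
  | .loop _ _, σ => σ

/-- The program contains no loops. -/
def Stmt.loopFree : Stmt → Bool
  | .seq s t => s.loopFree && t.loopFree
  | .ite _ s t => s.loopFree && t.loopFree
  | .loop _ _ => false
  | _ => true

/-- An upper bound on the running time of a program without loops. -/
def Stmt.bound : Stmt → ℕ
  | .skip => 1
  | .setN _ v => 1 + v.cost
  | .setQ _ v => 1 + v.cost
  | .putN _ i j v => 1 + i.cost + j.cost + v.cost
  | .putQ _ i j v => 1 + i.cost + j.cost + v.cost
  | .emit x y => 1 + x.cost + y.cost
  | .seq s t => s.bound + t.bound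
  | .ite c s t => 1 + c.cost + (s.bound + t.bound)
  | .loop _ _ => 0

theorem Stmt.exec_run (s : Stmt) (h : s.loopFree = true) (σ : State) :
    ∃ t ≤ s.bound, Exec s σ t (s.run σ) := by
  induction s generalizing σ with
  | skip => exact ⟨_, le_rfl, .skip σ⟩
  | setN x v => exact ⟨_, le_rfl, .setN σ x v⟩
  | setQ x v => exact ⟨_, le_rfl, .setQ σ x v⟩
  | putN a i j v => exact ⟨_, le_rfl, .putN σ a i j v⟩
  | putQ a i j v => exact ⟨_, le_rfl, .putQ σ a i j v⟩
  | emit x y => exact ⟨_, le_rfl, .emit σ x y⟩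
  | seq s t ih₁ ih₂ =>
    rw [Stmt.loopFree, Bool.and_eq_true] at h
    obtain ⟨t₁, h₁, e₁⟩ := ih₁ h.1 σ
    obtain ⟨t₂, h₂, e₂⟩ := ih₂ h.2 (s.run σ)
    exact ⟨_, Nat.add_le_add h₁ h₂, .seq e₁ e₂⟩
  | ite c s t ih₁ ih₂ =>
    rw [Stmt.loopFree, Bool.and_eq_true] at h
    cases hc : c.eval σ with
    | true =>
      obtain ⟨t₁, h₁, e₁⟩ := ih₁ h.1 σ
      refine ⟨1 + c.cost + t₁, by simp only [Stmt.bound]; omega, ?_⟩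
      rw [Stmt.run, if_pos hc]
      exact Exec.ite_true hc e₁
    | false =>
      obtain ⟨t₁, h₁, e₁⟩ := ih₂ h.2 σ
      refine ⟨1 + c.cost + t₁, by simp only [Stmt.bound]; omega, ?_⟩
      rw [Stmt.run, if_neg (by simp [hc])]
      exact Exec.ite_false hc e₁
  | loop c s => simp [Stmt.loopFree] at h

theorem Runs.of_loopFree {s : Stmt} {σ : State} {T : ℕ} {Q : State → Prop}
    (hl : s.loopFree = true) (hT : s.bound ≤ T) (hQ : Q (s.run σ)) : Runs s σ T Q := by
  obtain ⟨t, ht, e⟩ := s.exec_run hl σ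
  exact ⟨t, _, e, ht.trans hT, hQ⟩

/-- A loop-free beginning of a program is executed symbolically. -/
theorem Runs.step {s₁ s₂ : Stmt} {σ : State} {T₂ T : ℕ} {Q : State → Prop}
    (hl : s₁.loopFree = true) (h₂ : Runs s₂ (s₁.run σ) T₂ Q) (hT : s₁.bound + T₂ ≤ T) :
    Runs (s₁ ;; s₂) σ T Q :=
  Runs.seq (R := fun σ₁ => σ₁ = s₁.run σ) (Runs.of_loopFree hl le_rfl rfl)
    (by rintro _ _ rfl; exact h₂) hT

/-! ### The alternating tree of the Hungarian algorithm -/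

/-- The columns `1, …, n` are matched by `mate` with the rows `1, …, r` (value `0`: unmatched),
every one of these rows occurring exactly once. -/
structure PartialMate (n r : ℕ) (mate : ℕ → ℕ) : Prop where
  le : ∀ j, 1 ≤ j → j ≤ n → mate j ≤ r
  inj : ∀ j j', 1 ≤ j → j ≤ n → 1 ≤ j' → j' ≤ n → mate j ≠ 0 → mate j = mate j' → j = j'
  surj : ∀ i, 1 ≤ i → i ≤ r → ∃ j, 1 ≤ j ∧ j ≤ n ∧ mate j = i

/-- The dual variables `u`, `v` are feasible on the rows `1, …, r`, and tight on the edges of the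
matching `mate`. -/
structure Dual (n r : ℕ) (w : ℕ → ℕ → ℚ) (u v : ℕ → ℚ) (mate : ℕ → ℕ) : Prop where
  feas : ∀ i j, 1 ≤ i → i ≤ r → 1 ≤ j → j ≤ n → w i j ≤ u i + v j
  tight : ∀ j, 1 ≤ j → j ≤ n → mate j ≠ 0 → u (mate j) + v j = w (mate j) j

/-- The set of columns of the alternating tree. -/
def usedSet (n : ℕ) (used : ℕ → ℕ) : Finset ℕ := (Finset.range (n + 1)).filter fun j => used j = 1

/-- The invariant of the search for an augmenting path from the row `r + 1`, which is the mate of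
the root column `0`. The columns with `used j = 1` form the tree, `j0` is the column about to join
it, `way` points to the parent of a column, and `d` (which the program does not compute) bounds
the depth. Before the first step, when `j0 = 0`, the row `r + 1` need not be feasible, and the
slacks are undefined. -/
structure Search (n r : ℕ) (w : ℕ → ℕ → ℚ) (u v slack : ℕ → ℚ) (mate used way d : ℕ → ℕ)
    (j0 : ℕ) : Prop where
  pm : PartialMate n r mate
  root : mate 0 = r + 1
  dual : Dual n r w u v mate
  used01 : ∀ j, j ≤ n → used j = 0 ∨ used j = 1
  j0_le : j0 ≤ n
  j0_unused : used j0 = 0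
  start : j0 = 0 → ∀ j, j ≤ n → used j = 0
  root_used : j0 ≠ 0 → used 0 = 1
  feas : j0 ≠ 0 → ∀ j, 1 ≤ j → j ≤ n → w (r + 1) j ≤ u (r + 1) + v j
  matched : ∀ j, j ≤ n → used j = 1 → mate j ≠ 0
  slack_eq : j0 ≠ 0 → ∀ j, 1 ≤ j → j ≤ n → used j = 0 → way j ≤ n ∧ used (way j) = 1 ∧
    slack j = u (mate (way j)) + v j - w (mate (way j)) j
  slack_le : j0 ≠ 0 → ∀ j, 1 ≤ j → j ≤ n → used j = 0 → ∀ t, t ≤ n → used t = 1 →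
    slack j ≤ u (mate t) + v j - w (mate t) j
  way_used : ∀ j, 1 ≤ j → j ≤ n → used j = 1 ∨ j = j0 → way j ≤ n ∧ used (way j) = 1
  way_tight : ∀ j, 1 ≤ j → j ≤ n → used j = 1 ∨ j = j0 →
    u (mate (way j)) + v j = w (mate (way j)) j
  depth : ∀ j, 1 ≤ j → j ≤ n → used j = 1 ∨ j = j0 → d (way j) < d j
  depth_lt : ∀ j, j ≤ n → used j = 1 → d j < (usedSet n used).card
  depth_le : d j0 ≤ (usedSet n used).card

/-- What the scan of the columns computes: the new slacks and parents, and a column `j1` outside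
the tree whose slack `δ` is least (`j1 = 0` if there is no such column). -/
structure Scan (n : ℕ) (w : ℕ → ℕ → ℚ) (u v slack slack' : ℕ → ℚ) (used way way' : ℕ → ℕ)
    (i0 j0 j1 : ℕ) (δ : ℚ) : Prop where
  slack_new : ∀ j, 1 ≤ j → j ≤ n → used j = 0 → slack' j =
    if j0 = 0 ∨ u i0 + v j - w i0 j < slack j then u i0 + v j - w i0 j else slack j
  way_new : ∀ j, 1 ≤ j → j ≤ n → used j = 0 → way' j =
    if j0 = 0 ∨ u i0 + v j - w i0 j < slack j then j0 else way j
  way_used : ∀ j, 1 ≤ j → j ≤ n → used j ≠ 0 → way' j = way j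
  least : (j1 = 0 ∧ ∀ j, 1 ≤ j → j ≤ n → used j ≠ 0) ∨
    (1 ≤ j1 ∧ j1 ≤ n ∧ used j1 = 0 ∧ δ = slack' j1 ∧
      ∀ j, 1 ≤ j → j ≤ n → used j = 0 → δ ≤ slack' j)

/-- The change of the dual variables and the slacks by `δ`, carried out for the columns below
`m`. -/
structure DualStep (m : ℕ) (u u' v v' slack slack' : ℕ → ℚ) (mate used : ℕ → ℕ) (δ : ℚ) :
    Prop where
  u_tree : ∀ j, j < m → used j = 1 → u' (mate j) = u (mate j) - δ
  u_rest : ∀ i, (∀ j, j < m → used j = 1 → mate j ≠ i) → u' i = u i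
  v_tree : ∀ j, j < m → used j = 1 → v' j = v j + δ
  v_rest : ∀ j, ¬ (j < m ∧ used j = 1) → v' j = v j
  slack_rest : ∀ j, j < m → used j ≠ 1 → slack' j = slack j - δ
  slack_later : ∀ j, m ≤ j → slack' j = slack j

theorem Scan.zero {w : ℕ → ℕ → ℚ} {u v slack : ℕ → ℚ} {used way : ℕ → ℕ} {i0 j0 : ℕ} {δ : ℚ} :
    Scan 0 w u v slack slack used way way i0 j0 0 δ :=
  ⟨by omega, by omega, by omega, .inl ⟨rfl, by omega⟩⟩

/-- One more column is scanned. -/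
theorem Scan.succ {m : ℕ} {w : ℕ → ℕ → ℚ} {u v slack slack₁ slack₂ : ℕ → ℚ}
    {used way way₁ way₂ : ℕ → ℕ} {i0 j0 j1 j2 : ℕ} {δ δ₂ c : ℚ}
    (h : Scan m w u v slack slack₁ used way way₁ i0 j0 j1 δ)
    (hl : slack₁ (m + 1) = slack (m + 1) ∧ way₁ (m + 1) = way (m + 1))
    (hc : c = u i0 + v (m + 1) - w i0 (m + 1))
    (hne : ∀ j, j ≠ m + 1 → slack₂ j = slack₁ j ∧ way₂ j = way₁ j)
    (hused : used (m + 1) ≠ 0 → way₂ (m + 1) = way₁ (m + 1) ∧ j2 = j1 ∧ δ₂ = δ)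
    (hs : used (m + 1) = 0 →
      slack₂ (m + 1) = (if j0 = 0 ∨ c < slack₁ (m + 1) then c else slack₁ (m + 1)) ∧
      way₂ (m + 1) = if j0 = 0 ∨ c < slack₁ (m + 1) then j0 else way₁ (m + 1))
    (hj : used (m + 1) = 0 → (j1 = 0 ∨ slack₂ (m + 1) < δ) → j2 = m + 1 ∧ δ₂ = slack₂ (m + 1))
    (hj' : used (m + 1) = 0 → ¬ (j1 = 0 ∨ slack₂ (m + 1) < δ) → j2 = j1 ∧ δ₂ = δ) :
    Scan (m + 1) w u v slack slack₂ used way way₂ i0 j0 j2 δ₂ := by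
  rw [hl.1, hl.2, hc] at hs
  refine ⟨?_, ?_, ?_, ?_⟩
  · intro j h1 h2 h3
    by_cases hjm : j = m + 1
    · subst hjm; exact (hs h3).1
    · rw [(hne j hjm).1]; exact h.slack_new j h1 (by omega) h3
  · intro j h1 h2 h3
    by_cases hjm : j = m + 1
    · subst hjm; exact (hs h3).2
    · rw [(hne j hjm).2]; exact h.way_new j h1 (by omega) h3
  · intro j h1 h2 h3
    by_cases hjm : j = m + 1
    · subst hjm; rw [(hused h3).1, hl.2]
    · rw [(hne j hjm).2]; exact h.way_used j h1 (by omega) h3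
  · by_cases h0 : used (m + 1) = 0
    · by_cases h1 : j1 = 0 ∨ slack₂ (m + 1) < δ
      · obtain ⟨rfl, h2⟩ := hj h0 h1
        refine .inr ⟨by omega, le_rfl, h0, h2, fun j h3 h4 h5 => ?_⟩
        rw [h2]
        by_cases hjm : j = m + 1
        · rw [hjm]
        · rcases h.least with ⟨-, h6⟩ | ⟨h7, -, -, -, h6⟩
          · exact absurd h5 (h6 j h3 (by omega))
          · rw [(hne j hjm).1]
            have := h6 j h3 (by omega) h5
            have := h1.resolve_left (by omega)
            linarith
      · obtain ⟨rfl, rfl⟩ := hj' h0 h1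
        push Not at h1
        obtain ⟨-, h2, h3, h4, h5⟩ := h.least.resolve_left fun h => h1.1 h.1
        refine .inr ⟨by omega, by omega, h3, by rwa [(hne j2 (by omega)).1], fun j h6 h7 h8 => ?_⟩
        by_cases hjm : j = m + 1
        · rw [hjm]; exact h1.2
        · rw [(hne j hjm).1]; exact h5 j h6 (by omega) h8
    · obtain ⟨-, rfl, rfl⟩ := hused h0
      rcases h.least with ⟨h1, h2⟩ | ⟨h1, h2, h3, h4, h5⟩
      · refine .inl ⟨h1, fun j h3 h4 => ?_⟩
        by_cases hjm : j = m + 1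
        · rwa [hjm]
        · exact h2 j h3 (by omega)
      · refine .inr ⟨h1, by omega, h3, by rwa [(hne j2 (by omega)).1], fun j h6 h7 h8 => ?_⟩
        have hjm : j ≠ m + 1 := by rintro rfl; exact h0 h8
        rw [(hne j hjm).1]; exact h5 j h6 (by omega) h8

theorem DualStep.zero {u v slack : ℕ → ℚ} {mate used : ℕ → ℕ} {δ : ℚ} :
    DualStep 0 u u v v slack slack mate used δ :=
  ⟨by omega, fun _ _ => rfl, by omega, fun _ _ => rfl, by omega, fun _ _ => rfl⟩

/-- A column of the tree is processed; its row occurs only once. -/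
theorem DualStep.succ_tree {m : ℕ} {u u₁ u₂ v v₁ v₂ slack slack₁ : ℕ → ℚ}
    {mate used : ℕ → ℕ} {δ : ℚ} (h : DualStep m u u₁ v v₁ slack slack₁ mate used δ)
    (hused : used m = 1) (hinj : ∀ j, j < m → used j = 1 → mate j ≠ mate m)
    (hu : ∀ i, u₂ i = if i = mate m then u₁ i - δ else u₁ i)
    (hv : ∀ j, v₂ j = if j = m then v₁ j + δ else v₁ j) :
    DualStep (m + 1) u u₂ v v₂ slack slack₁ mate used δ := by
  refine ⟨?_, ?_, ?_, ?_, ?_, ?_⟩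
  · intro j hj hju
    by_cases hjm : j = m
    · rw [hu, hjm, if_pos rfl, h.u_rest _ hinj]
    · rw [hu, if_neg (hinj j (by omega) hju), h.u_tree j (by omega) hju]
  · intro i hi
    rw [hu, if_neg (hi m (by omega) hused).symm, h.u_rest i fun j hj => hi j (by omega)]
  · intro j hj hju
    by_cases hjm : j = m
    · rw [hv, if_pos hjm, h.v_rest j (by omega)]
    · rw [hv, if_neg hjm, h.v_tree j (by omega) hju]
  · intro j hj
    have : j ≠ m := by rintro rfl; omega
    rw [hv, if_neg this, h.v_rest j (by omega)]
  · intro j hj hju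
    have : j ≠ m := by rintro rfl; omega
    exact h.slack_rest j (by omega) hju
  · exact fun j hj => h.slack_later j (by omega)

/-- A column outside the tree is processed. -/
theorem DualStep.succ_rest {m : ℕ} {u u₁ v v₁ slack slack₁ slack₂ : ℕ → ℚ}
    {mate used : ℕ → ℕ} {δ : ℚ} (h : DualStep m u u₁ v v₁ slack slack₁ mate used δ)
    (hused : used m ≠ 1) (hs : ∀ j, slack₂ j = if j = m then slack₁ j - δ else slack₁ j) :
    DualStep (m + 1) u u₁ v v₁ slack slack₂ mate used δ := by
  have hne : ∀ j, used j = 1 → j ≠ m := by rintro j hj rfl; exact hused hj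
  refine ⟨?_, ?_, ?_, ?_, ?_, ?_⟩
  · exact fun j hj hju => h.u_tree j (by have := hne j hju; omega) hju
  · exact fun i hi => h.u_rest i fun j hj => hi j (by omega)
  · exact fun j hj hju => h.v_tree j (by have := hne j hju; omega) hju
  · exact fun j hj => h.v_rest j fun hj' => hj ⟨by omega, hj'.2⟩
  · intro j hj hju
    by_cases hjm : j = m
    · rw [hs, if_pos hjm, h.slack_later j (by omega)]
    · rw [hs, if_neg hjm, h.slack_rest j (by omega) hju]
  · intro j hj
    rw [hs, if_neg (by omega), h.slack_later j (by omega)]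

theorem usedSet_card_le (n : ℕ) (used : ℕ → ℕ) : (usedSet n used).card ≤ n + 1 := by
  simpa [usedSet] using Finset.card_filter_le (Finset.range (n + 1)) fun j => used j = 1

theorem usedSet_card_insert {n j0 : ℕ} {used used' : ℕ → ℕ} (hj0 : j0 ≤ n) (h0 : used j0 = 0)
    (h : ∀ j, used' j = if j = j0 then 1 else used j) :
    (usedSet n used').card = (usedSet n used).card + 1 := by
  have : usedSet n used' = insert j0 (usedSet n used) := by
    ext j
    by_cases hj : j = j0 <;> simp [usedSet, h, hj]
    omega
  rw [this, Finset.card_insert_of_notMem (by simp [usedSet, h0])]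

/-- Fewer than `n` columns are matched, so the tree cannot contain all columns. -/
theorem PartialMate.exists_unmatched {n r : ℕ} {mate : ℕ → ℕ} (h : PartialMate n r mate)
    (hr : r < n) : ∃ j, 1 ≤ j ∧ j ≤ n ∧ mate j = 0 := by
  by_contra! hc
  obtain ⟨x, hx, y, hy, hxy, he⟩ := Finset.exists_ne_map_eq_of_card_lt_of_maps_to
    (s := Finset.Icc 1 n) (t := Finset.Icc 1 r) (f := mate) (by simpa using hr) (by
      intro j hj
      simp only [Finset.coe_Icc, Set.mem_Icc] at hj ⊢
      exact ⟨Nat.pos_of_ne_zero (hc j hj.1 hj.2), h.le j hj.1 hj.2⟩)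
  simp only [Finset.mem_Icc] at hx hy
  exact hxy (h.inj x y hx.1 hx.2 hy.1 hy.2 (hc x hx.1 hx.2) he)

/-- A step of the search preserves the invariant and enlarges the tree. -/
theorem Search.step {n r : ℕ} {w : ℕ → ℕ → ℚ} {u u' v v' slack slack' slack'' : ℕ → ℚ}
    {mate used used' way way' d : ℕ → ℕ} {j0 j1 : ℕ} {δ : ℚ} (hr : r < n)
    (h : Search n r w u v slack mate used way d j0) (hm : mate j0 ≠ 0)
    (hu : ∀ j, used' j = if j = j0 then 1 else used j)
    (hs : Scan n w u v slack slack' used' way way' (mate j0) j0 j1 δ)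
    (hd : DualStep (n + 1) u u' v v' slack' slack'' mate used' δ) :
    ∃ d', Search n r w u' v' slack'' mate used' way' d' j1 ∧
      (usedSet n used').card = (usedSet n used).card + 1 := by
  have hcard := usedSet_card_insert h.j0_le h.j0_unused hu
  have u_tree := fun j (hj : j ≤ n) => hd.u_tree j (Nat.lt_succ_of_le hj)
  have v_tree := fun j (hj : j ≤ n) => hd.v_tree j (Nat.lt_succ_of_le hj)
  have slack_rest := fun j (hj : j ≤ n) => hd.slack_rest j (Nat.lt_succ_of_le hj)
  have huj0 : used' j0 = 1 := by simp [hu]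
  have hmono : ∀ j, used j = 1 → used' j = 1 := fun j hj => by
    rw [hu]; split_ifs <;> simp [hj]
  have hcases : ∀ j, used' j = 1 → used j = 1 ∨ j = j0 := fun j hj => by
    rw [hu] at hj
    split_ifs at hj with hc
    · exact .inr hc
    · exact .inl hj
  have hused01 : ∀ j, j ≤ n → used' j = 0 ∨ used' j = 1 := fun j hj => by
    rw [hu]; split_ifs
    · exact .inr rfl
    · exact h.used01 j hj
  have hunused : ∀ j, used' j = 0 → used j = 0 ∧ j ≠ j0 := fun j hj => by
    rw [hu] at hj
    split_ifs at hj with hc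
    exact ⟨hj, hc⟩
  have hroot : used' 0 = 1 := by
    by_cases hj : j0 = 0
    · rw [hu, if_pos hj.symm]
    · exact hmono 0 (h.root_used hj)
  have hmatched : ∀ j, j ≤ n → used' j = 1 → mate j ≠ 0 := fun j hj hj' => by
    rcases hcases j hj' with hc | rfl
    · exact h.matched j hj hc
    · exact hm
  -- at the first step the tree has no column but the root
  have hstart : ∀ j, 1 ≤ j → j ≤ n → used' j = 1 → j0 ≠ 0 := fun j hj hjn hj' h0 => by
    rcases hcases j hj' with hc | rfl
    · simp [h.start h0 j hjn] at hc
    · omega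
  have hle : ∀ j, j ≤ n → mate j ≤ r + 1 := fun j hj => by
    rcases Nat.eq_zero_or_pos j with rfl | hp
    · exact h.root.le
    · exact (h.pm.le j hp hj).trans (Nat.le_succ r)
  have hfeas : j0 ≠ 0 → ∀ i j, 1 ≤ i → i ≤ r + 1 → 1 ≤ j → j ≤ n → w i j ≤ u i + v j := by
    intro h0 i j hi hi' hj hj'
    rcases Nat.lt_or_ge r i with hri | hri
    · obtain rfl : i = r + 1 := by omega
      exact h.feas h0 j hj hj'
    · exact h.dual.feas i j hi hri hj hj'
  -- the scan restores the meaning of the slacks for the enlarged tree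
  have hscan : ∀ j, 1 ≤ j → j ≤ n → used' j = 0 → way' j ≤ n ∧ used' (way' j) = 1 ∧
      slack' j = u (mate (way' j)) + v j - w (mate (way' j)) j ∧
      ∀ t, t ≤ n → used' t = 1 → slack' j ≤ u (mate t) + v j - w (mate t) j := by
    intro j hj hjn hj0
    rw [hs.slack_new j hj hjn hj0, hs.way_new j hj hjn hj0]
    obtain ⟨hjo, hne⟩ := hunused j hj0
    by_cases h0 : j0 = 0
    · rw [if_pos (.inl h0), if_pos (.inl h0)]
      refine ⟨h.j0_le, huj0, rfl, fun t ht ht' => ?_⟩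
      rcases hcases t ht' with hc | rfl
      · simp [h.start h0 t ht] at hc
      · exact le_rfl
    · obtain ⟨h1, h2, h3⟩ := h.slack_eq h0 j hj hjn hjo
      have h4 := h.slack_le h0 j hj hjn hjo
      by_cases hlt : u (mate j0) + v j - w (mate j0) j < slack j
      · rw [if_pos (.inr hlt), if_pos (.inr hlt)]
        refine ⟨h.j0_le, huj0, rfl, fun t ht ht' => ?_⟩
        rcases hcases t ht' with hc | rfl
        · exact hlt.le.trans (h4 t ht hc)
        · exact le_rfl
      · have hno : ¬ (j0 = 0 ∨ u (mate j0) + v j - w (mate j0) j < slack j) := by tauto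
        rw [if_neg hno, if_neg hno]
        refine ⟨h1, hmono _ h2, h3, fun t ht ht' => ?_⟩
        rcases hcases t ht' with hc | rfl
        · exact h4 t ht hc
        · exact not_lt.1 hlt
  obtain ⟨hj1, hj1n, hj1u, hδ, hmin⟩ := hs.least.resolve_left (by
    rintro ⟨-, hall⟩
    obtain ⟨j, hj, hjn, hj0⟩ := h.pm.exists_unmatched hr
    exact hmatched j hjn ((hused01 j hjn).resolve_left (hall j hj hjn)) hj0)
  have hδ0 : j0 ≠ 0 → 0 ≤ δ := by
    intro h0
    obtain ⟨h1, h2, h3, -⟩ := hscan j1 hj1 hj1n hj1u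
    have := hfeas h0 (mate (way' j1)) j1 (Nat.pos_of_ne_zero (hmatched _ h1 h2)) (hle _ h1)
      hj1 hj1n
    rw [hδ, h3]
    linarith
  have hne1 : ∀ j, used' j = 0 → ¬ (j < n + 1 ∧ used' j = 1) := fun j hj => by simp [hj]
  have hfeas' : ∀ i j, 1 ≤ i → i ≤ r + 1 → 1 ≤ j → j ≤ n → w i j ≤ u' i + v' j := by
    intro i j hi hir hj hjn
    by_cases ht : ∃ t, t ≤ n ∧ used' t = 1 ∧ mate t = i
    · obtain ⟨t, htn, htu, rfl⟩ := ht
      rw [u_tree t htn htu]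
      rcases hused01 j hjn with hj0 | hj1'
      · rw [hd.v_rest j (hne1 j hj0)]
        have := (hscan j hj hjn hj0).2.2.2 t htn htu
        have := hmin j hj hjn hj0
        linarith
      · rw [v_tree j hjn hj1']
        have := hfeas (hstart j hj hjn hj1') (mate t) j hi hir hj hjn
        linarith
    · push Not at ht
      rw [hd.u_rest i fun j hj => ht j (Nat.le_of_lt_succ hj)]
      have hir' : i ≤ r := by
        have := ht 0 (Nat.zero_le n) hroot
        rw [h.root] at this
        omega
      have := h.dual.feas i j hi hir' hj hjn
      rcases hused01 j hjn with hj0 | hj1'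
      · rwa [hd.v_rest j (hne1 j hj0)]
      · rw [v_tree j hjn hj1']
        linarith [hδ0 (hstart j hj hjn hj1')]
  refine ⟨Function.update d j1 (d (way' j1) + 1), ⟨h.pm, h.root, ⟨?_, ?_⟩, hused01, hj1n, hj1u,
    ?_, fun _ => hroot, ?_, hmatched, ?_, ?_, ?_, ?_, ?_, ?_, ?_⟩, hcard⟩
  · exact fun i j hi hir hj hjn => hfeas' i j hi (by omega) hj hjn
  · intro j hj hjn hj0
    have hold := h.dual.tight j hj hjn hj0
    rcases hused01 j hjn with hj0' | hj1'
    · rw [hd.v_rest j (hne1 j hj0'), hd.u_rest, hold]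
      intro t htn htu he
      replace htn := Nat.le_of_lt_succ htn
      rcases Nat.eq_zero_or_pos t with rfl | htp
      · rw [h.root] at he
        have := h.pm.le j hj hjn
        omega
      · obtain rfl := h.pm.inj t j htp htn hj hjn (hmatched t htn htu) he
        omega
    · rw [v_tree j hjn hj1', u_tree j hjn hj1']
      linarith
  · omega
  · exact fun _ j hj hjn => hfeas' (r + 1) j (by omega) le_rfl hj hjn
  · intro _ j hj hjn hj0
    obtain ⟨h1, h2, h3, -⟩ := hscan j hj hjn hj0
    refine ⟨h1, h2, ?_⟩
    rw [slack_rest j hjn (by omega), hd.v_rest j (hne1 j hj0), u_tree _ h1 h2, h3]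
    ring
  · intro _ j hj hjn hj0 t ht htu
    have := (hscan j hj hjn hj0).2.2.2 t ht htu
    rw [slack_rest j hjn (by omega), hd.v_rest j (hne1 j hj0), u_tree t ht htu]
    linarith
  · rintro j hj hjn (hju | rfl)
    · rw [hs.way_used j hj hjn (by omega)]
      obtain ⟨h1, h2⟩ := h.way_used j hj hjn (hcases j hju)
      exact ⟨h1, hmono _ h2⟩
    · obtain ⟨h1, h2, -⟩ := hscan j hj hjn hj1u
      exact ⟨h1, h2⟩
  · rintro j hj hjn (hju | rfl)
    · rw [hs.way_used j hj hjn (by omega)]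
      obtain ⟨h1, h2⟩ := h.way_used j hj hjn (hcases j hju)
      rw [u_tree _ h1 (hmono _ h2), v_tree j hjn hju]
      linarith [h.way_tight j hj hjn (hcases j hju)]
    · obtain ⟨h1, h2, h3, -⟩ := hscan j hj hjn hj1u
      rw [u_tree _ h1 h2, hd.v_rest j (hne1 j hj1u), hδ, h3]
      ring
  · rintro j hj hjn (hju | rfl)
    · have hjne : j ≠ j1 := by rintro rfl; omega
      rw [hs.way_used j hj hjn (by omega)]
      obtain ⟨-, h2⟩ := h.way_used j hj hjn (hcases j hju)
      have hwne : way j ≠ j1 := by intro he; have := hmono _ h2; rw [he] at this; omega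
      rw [Function.update_of_ne hjne, Function.update_of_ne hwne]
      exact h.depth j hj hjn (hcases j hju)
    · obtain ⟨-, h2, -⟩ := hscan j hj hjn hj1u
      have hwne : way' j ≠ j := by intro he; rw [he] at h2; omega
      rw [Function.update_self, Function.update_of_ne hwne]
      omega
  · intro j hjn hju
    have hjne : j ≠ j1 := by rintro rfl; omega
    rw [Function.update_of_ne hjne, hcard]
    rcases hcases j hju with hc | rfl
    · have := h.depth_lt j hjn hc; omega
    · have := h.depth_le; omega
  · obtain ⟨h1, h2, -⟩ := hscan j1 hj1 hj1n hj1u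
    rw [Function.update_self, hcard]
    rcases hcases _ h2 with hc | hc
    · have := h.depth_lt _ h1 hc; omega
    · rw [hc]; have := h.depth_le; omega

/-- The invariant of the augmentation along the path from the column `j0` to the root: the columns
other than the hole `j0`, including the root, are matched with the rows `1, …, r + 1`. `T` is the
set of columns of the tree. Tightness of the edges to the parents is claimed only for columns at most
as deep as `j0`, since the deeper columns of the path have been rematched. -/
structure Augment (n r : ℕ) (w : ℕ → ℕ → ℚ) (u v : ℕ → ℚ) (mate way d : ℕ → ℕ) (T : Set ℕ)
    (j0 : ℕ) : Prop where
  j0_le : j0 ≤ n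
  j0_mem : j0 ∈ T
  le : ∀ j, j ≤ n → j ≠ j0 → mate j ≤ r + 1
  inj : ∀ j j', j ≤ n → j ≠ j0 → j' ≤ n → j' ≠ j0 → mate j ≠ 0 → mate j = mate j' → j = j'
  surj : ∀ i, 1 ≤ i → i ≤ r + 1 → ∃ j, j ≤ n ∧ j ≠ j0 ∧ mate j = i
  feas : ∀ i j, 1 ≤ i → i ≤ r + 1 → 1 ≤ j → j ≤ n → w i j ≤ u i + v j
  tight : ∀ j, 1 ≤ j → j ≤ n → j ≠ j0 → mate j ≠ 0 → u (mate j) + v j = w (mate j) j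
  way_mem : ∀ j ∈ T, 1 ≤ j → j ≤ n → way j ≤ n ∧ way j ∈ T ∧ d (way j) < d j
  way_tight : ∀ j ∈ T, 1 ≤ j → j ≤ n → d j ≤ d j0 → u (mate (way j)) + v j = w (mate (way j)) j

/-- The hole moves to its parent, whose row it takes over. -/
theorem Augment.step {n r : ℕ} {w : ℕ → ℕ → ℚ} {u v : ℕ → ℚ} {mate mate' way d : ℕ → ℕ}
    {T : Set ℕ} {j0 : ℕ} (h : Augment n r w u v mate way d T j0) (h0 : j0 ≠ 0)
    (hm : ∀ j, mate' j = if j = j0 then mate (way j0) else mate j) :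
    Augment n r w u v mate' way d T (way j0) := by
  obtain ⟨h1, h2, h3⟩ := h.way_mem j0 h.j0_mem (by omega) h.j0_le
  have hne : way j0 ≠ j0 := by intro he; rw [he] at h3; omega
  refine ⟨h1, h2, ?_, ?_, ?_, h.feas, ?_, h.way_mem, ?_⟩
  · intro j hj hj'
    rw [hm]
    split_ifs with hc
    · exact h.le _ h1 hne
    · exact h.le j hj hc
  · intro j j' hj hjw hj' hjw' hz he
    rw [hm] at hz
    rw [hm, hm] at he
    split_ifs at hz he with hc hc' hc'
    · rw [hc, hc']
    · exact absurd (h.inj _ _ h1 hne hj' hc' hz he).symm hjw'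
    · exact absurd (h.inj _ _ hj hc h1 hne hz he) hjw
    · exact h.inj _ _ hj hc hj' hc' hz he
  · intro i hi hir
    obtain ⟨j, hj, hj', he⟩ := h.surj i hi hir
    by_cases hc : j = way j0
    · exact ⟨j0, h.j0_le, hne.symm, by rw [hm, if_pos rfl, ← hc, he]⟩
    · exact ⟨j, hj, hc, by rw [hm, if_neg hj', he]⟩
  · intro j hj hjn hjw hz
    rw [hm] at hz ⊢
    split_ifs at hz ⊢ with hc
    · rw [hc]
      exact h.way_tight j0 h.j0_mem (by omega) h.j0_le le_rfl
    · exact h.tight j hj hjn hc hz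
  · intro j hjT hj hjn hd
    obtain ⟨-, -, h4⟩ := h.way_mem j hjT hj hjn
    have : way j ≠ j0 := by intro he; rw [he] at h4; omega
    rw [hm, if_neg this]
    exact h.way_tight j hjT hj hjn (by omega)

/-- When the search has reached an unmatched column, the path can be augmented. -/
theorem Search.augment {n r : ℕ} {w : ℕ → ℕ → ℚ} {u v slack : ℕ → ℚ}
    {mate used way d : ℕ → ℕ} {j0 : ℕ} (h : Search n r w u v slack mate used way d j0)
    (hm : mate j0 = 0) :
    Augment n r w u v mate way d {j | used j = 1 ∨ j = j0} j0 := by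
  have h0 : j0 ≠ 0 := by
    rintro rfl
    rw [h.root] at hm
    omega
  have hroot : ∀ j, 1 ≤ j → j ≤ n → mate j ≠ mate 0 := fun j hj hjn he => by
    have := h.pm.le j hj hjn
    rw [he, h.root] at this
    omega
  refine ⟨h.j0_le, .inr rfl, ?_, ?_, ?_, ?_, ?_, ?_, ?_⟩
  · intro j hj _
    rcases Nat.eq_zero_or_pos j with rfl | hp
    · exact h.root.le
    · exact (h.pm.le j hp hj).trans (Nat.le_succ r)
  · intro j j' hj _ hj' _ hz he
    rcases Nat.eq_zero_or_pos j with rfl | hp <;> rcases Nat.eq_zero_or_pos j' with rfl | hp'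
    · rfl
    · exact absurd he.symm (hroot j' hp' hj')
    · exact absurd he (hroot j hp hj)
    · exact h.pm.inj j j' hp hj hp' hj' hz he
  · intro i hi hir
    rcases Nat.lt_or_ge r i with hri | hri
    · exact ⟨0, Nat.zero_le n, h0.symm, by rw [h.root]; omega⟩
    · obtain ⟨j, hj, hjn, he⟩ := h.pm.surj i hi hri
      exact ⟨j, hjn, by rintro rfl; omega, he⟩
  · intro i j hi hir hj hjn
    rcases Nat.lt_or_ge r i with hri | hri
    · obtain rfl : i = r + 1 := by omega
      exact h.feas h0 j hj hjn
    · exact h.dual.feas i j hi hri hj hjn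
  · exact fun j hj hjn _ hz => h.dual.tight j hj hjn hz
  · intro j hjT hj hjn
    obtain ⟨h1, h2⟩ := h.way_used j hj hjn hjT
    exact ⟨h1, .inl h2, h.depth j hj hjn hjT⟩
  · exact fun j hjT hj hjn _ => h.way_tight j hj hjn hjT

/-- When the hole has reached the root, one more row is matched. -/
theorem Augment.partialMate {n r : ℕ} {w : ℕ → ℕ → ℚ} {u v : ℕ → ℚ} {mate way d : ℕ → ℕ}
    {T : Set ℕ} (h : Augment n r w u v mate way d T 0) :
    PartialMate n (r + 1) mate ∧ Dual n (r + 1) w u v mate := by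
  refine ⟨⟨fun j hj hjn => h.le j hjn (by omega), fun j j' hj hjn hj' hjn' hz he =>
    h.inj j j' hjn (by omega) hjn' (by omega) hz he, fun i hi hir => ?_⟩, ⟨h.feas,
    fun j hj hjn hz => h.tight j hj hjn (by omega) hz⟩⟩
  obtain ⟨j, hjn, hj, he⟩ := h.surj i hi hir
  exact ⟨j, by omega, hjn, he⟩

/-- The beginning of the search: the tree is empty, and the root joins first. -/
theorem Search.init {n r : ℕ} {w : ℕ → ℕ → ℚ} {u v slack : ℕ → ℚ} {mate used way : ℕ → ℕ}
    (hp : PartialMate n r mate) (hd : Dual n r w u v mate) (h0 : mate 0 = r + 1)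
    (hu : ∀ j, j ≤ n → used j = 0) : Search n r w u v slack mate used way (fun _ => 0) 0 where
  pm := hp
  root := h0
  dual := hd
  used01 j hj := .inl (hu j hj)
  j0_le := Nat.zero_le n
  j0_unused := hu 0 (Nat.zero_le n)
  start _ := hu
  root_used h := absurd rfl h
  feas h := absurd rfl h
  matched j hj h := by simp [hu j hj] at h
  slack_eq h := absurd rfl h
  slack_le h := absurd rfl h
  way_used j hj hjn h := by
    rcases h with h | h
    · simp [hu j hjn] at h
    · omega
  way_tight j hj hjn h := by
    rcases h with h | h
    · simp [hu j hjn] at h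
    · omega
  depth j hj hjn h := by
    rcases h with h | h
    · simp [hu j hjn] at h
    · omega
  depth_lt j hj h := by simp [hu j hj] at h
  depth_le := Nat.zero_le _

/-! ### The Hungarian algorithm on the machine -/

/-- Scanning one column. -/
def scanBody : Stmt :=
  ifThen (getN .used NVar.j =ₙ num 0) (
    QVar.cur ≔ᵣ getQ .u NVar.i0 +ᵣ getQ .v NVar.j -ᵣ .get .w NVar.i0 NVar.j ;;
    ifThen (.or (NVar.j0 =ₙ num 0) (QVar.cur <ᵣ getQ .slack NVar.j)) (
      putQ1 .slack NVar.j QVar.cur ;;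
      putN1 .way NVar.j NVar.j0) ;;
    ifThen (.or (NVar.j1 =ₙ num 0) (getQ .slack NVar.j <ᵣ QVar.delta)) (
      QVar.delta ≔ᵣ getQ .slack NVar.j ;;
      NVar.j1 ≔ₙ NVar.j))

/-- Changing the dual variables for one column. -/
def dualBody : Stmt :=
  .ite (getN .used NVar.j =ₙ num 1) (
    putQ1 .u (getN .mate NVar.j) (getQ .u (getN .mate NVar.j) -ᵣ QVar.delta) ;;
    putQ1 .v NVar.j (getQ .v NVar.j +ᵣ QVar.delta)) (
    putQ1 .slack NVar.j (getQ .slack NVar.j -ᵣ QVar.delta))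

theorem scan_spec {σ : State} {n : ℕ} (hn : σ.nv .n = n) (hj1 : σ.nv .j1 = 0) :
    Runs (forTo .j (num 1) NVar.n scanBody) σ (100 * n + 10) (fun σ' =>
      Scan n (σ.qa .w) (fun j => σ.qa .u j 0) (fun j => σ.qa .v j 0) (fun j => σ.qa .slack j 0)
        (fun j => σ'.qa .slack j 0) (fun j => σ.na .used j 0) (fun j => σ.na .way j 0)
        (fun j => σ'.na .way j 0) (σ.nv .i0) (σ.nv .j0) (σ'.nv .j1) (σ'.qv .delta)) := by
  refine Runs.forTo (T := 80) (L := 1) (H := n) (fun m σ' =>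
    Scan (m - 1) (σ.qa .w) (fun j => σ.qa .u j 0) (fun j => σ.qa .v j 0)
        (fun j => σ.qa .slack j 0)
        (fun j => σ'.qa .slack j 0) (fun j => σ.na .used j 0) (fun j => σ.na .way j 0)
        (fun j => σ'.na .way j 0) (σ.nv .i0) (σ.nv .j0) (σ'.nv .j1) (σ'.qv .delta) ∧
      ∀ j, m ≤ j → σ'.qa .slack j 0 = σ.qa .slack j 0 ∧ σ'.na .way j 0 = σ.na .way j 0)
    rfl (by omega) rfl (fun σ' h => (h.nv .n rfl).trans hn) (fun _ _ _ h => h)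
    ⟨by rw [hj1]; exact Scan.zero, fun _ _ => ⟨rfl, rfl⟩⟩ ?_ ?_ (fun _ _ h => h.1)
  · intro j σ' hj hjn hx hK ⟨hI, hl⟩
    obtain ⟨m, rfl⟩ : ∃ m, j = m + 1 := ⟨j - 1, by omega⟩
    rw [Nat.add_sub_cancel] at hI
    have hu : σ'.na .used = σ.na .used := hK.na .used rfl
    have hi0 : σ'.nv .i0 = σ.nv .i0 := hK.nv .i0 rfl
    have hj0 : σ'.nv .j0 = σ.nv .j0 := hK.nv .j0 rfl
    have hqu : σ'.qa .u = σ.qa .u := hK.qa .u rfl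
    have hqv : σ'.qa .v = σ.qa .v := hK.qa .v rfl
    have hqw : σ'.qa .w = σ.qa .w := hK.qa .w rfl
    refine Runs.of_loopFree rfl (by decide) ⟨?_, ?_⟩
    · rw [Nat.add_sub_cancel]
      refine hI.succ (c := σ.qa .u (σ.nv .i0) 0 + σ.qa .v (m + 1) 0 - σ.qa .w (σ.nv .i0) (m + 1))
        (hl _ le_rfl) rfl ?_ ?_ ?_ ?_ ?_ <;>
      simp only [scanBody, Stmt.run, BExp.eval, NExp.eval, QExp.eval, hu, hi0, hj0, hqu, hqv,
        hqw, hx]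
      · intro j hjm
        split_ifs <;> simp [updateArr, hjm]
      · intro h
        simp [h]
      · intro h
        split_ifs <;> simp_all [updateArr]
        all_goals grind
      · intro h hb
        split_ifs at hb ⊢ <;> simp_all [updateArr]
        all_goals grind
      · intro h hb
        split_ifs at hb ⊢ <;> simp_all [updateArr]
    · intro j hj'
      have hjm : j ≠ m + 1 := by omega
      rw [← (hl j (by omega)).1, ← (hl j (by omega)).2]
      simp only [scanBody, Stmt.run, BExp.eval, NExp.eval, QExp.eval, hu, hi0, hj0, hqu, hqv,
        hqw, hx]
      split_ifs <;> simp [updateArr, hjm]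
  · simp only [NExp.cost]; omega

theorem dual_spec {σ : State} {n : ℕ} (hn : σ.nv .n = n)
    (hinj : ∀ j j', j ≤ n → j' ≤ n → σ.na .used j 0 = 1 → σ.na .used j' 0 = 1 →
      σ.na .mate j 0 = σ.na .mate j' 0 → j = j') :
    Runs (forTo .j (num 0) NVar.n dualBody) σ (100 * (n + 1) + 10) (fun σ' =>
      DualStep (n + 1) (fun j => σ.qa .u j 0) (fun j => σ'.qa .u j 0) (fun j => σ.qa .v j 0)
        (fun j => σ'.qa .v j 0) (fun j => σ.qa .slack j 0) (fun j => σ'.qa .slack j 0)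
        (fun j => σ.na .mate j 0) (fun j => σ.na .used j 0) (σ.qv .delta)) := by
  refine Runs.forTo (T := 80) (L := 0) (H := n) (fun m σ' =>
      DualStep m (fun j => σ.qa .u j 0) (fun j => σ'.qa .u j 0) (fun j => σ.qa .v j 0)
        (fun j => σ'.qa .v j 0) (fun j => σ.qa .slack j 0) (fun j => σ'.qa .slack j 0)
        (fun j => σ.na .mate j 0) (fun j => σ.na .used j 0) (σ.qv .delta))
    rfl (by omega) rfl (fun σ' h => (h.nv .n rfl).trans hn) (fun _ _ _ h => h)
    DualStep.zero ?_ ?_ (fun _ _ h => h)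
  · intro m σ' hj hjn hx hK hI
    have hu : σ'.na .used = σ.na .used := hK.na .used rfl
    have hm : σ'.na .mate = σ.na .mate := hK.na .mate rfl
    have hd : σ'.qv .delta = σ.qv .delta := hK.qv .delta rfl
    refine Runs.of_loopFree rfl (by decide) ?_
    by_cases h1 : σ.na .used m 0 = 1
    · simp only [dualBody, Stmt.run, BExp.eval, NExp.eval, QExp.eval, hu, hd, hm, hx, h1,
        decide_true, if_true]
      refine hI.succ_tree h1 (fun j hj hju he => ?_) (fun i => ?_) (fun j => ?_)
      · have := hinj j m (by omega) hjn hju h1 he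
        omega
      · by_cases hi : i = σ.na .mate m 0 <;> simp [updateArr, hi]
      · by_cases hi : j = m <;> simp [updateArr, hi]
    · simp only [dualBody, Stmt.run, BExp.eval, NExp.eval, QExp.eval, hu, hd, hm, hx, h1,
        decide_false]
      refine hI.succ_rest h1 fun j => ?_
      by_cases hi : j = m <;> simp [updateArr, hi]
  · simp only [NExp.cost]; omega

/-- The invariant of the search, for the arrays of the state `σ`. -/
def SearchAt (n r : ℕ) (d : ℕ → ℕ) (σ : State) : Prop :=
  Search n r (σ.qa .w) (fun j => σ.qa .u j 0) (fun j => σ.qa .v j 0) (fun j => σ.qa .slack j 0)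
    (fun j => σ.na .mate j 0) (fun j => σ.na .used j 0) (fun j => σ.na .way j 0) d (σ.nv .j0)

theorem search_spec {σ : State} {n r : ℕ} {d : ℕ → ℕ} (hr : r < n) (hn : σ.nv .n = n)
    (h : SearchAt n r d σ) (hm : σ.na .mate (σ.nv .j0) 0 ≠ 0) :
    Runs searchProg σ (300 * (n + 1)) (fun σ' => ∃ d', SearchAt n r d' σ' ∧
      (usedSet n fun j => σ'.na .used j 0).card =
        (usedSet n fun j => σ.na .used j 0).card + 1) := by
  have hinj : ∀ j j', j ≤ n → j' ≤ n → (if j = σ.nv .j0 then 1 else σ.na .used j 0) = 1 →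
      (if j' = σ.nv .j0 then 1 else σ.na .used j' 0) = 1 →
      σ.na .mate j 0 = σ.na .mate j' 0 → j = j' := by
    intro j j' hj hj' hu hu' he
    have hz : σ.na .mate j 0 ≠ 0 := by
      split_ifs at hu with hc
      · rwa [hc]
      · exact h.matched j hj hu
    have hroot := h.root
    rcases Nat.eq_zero_or_pos j with rfl | hp <;> rcases Nat.eq_zero_or_pos j' with rfl | hp'
    · rfl
    · have := h.pm.le j' hp' hj'
      beta_reduce at this hroot
      omega
    · have := h.pm.le j hp hj
      beta_reduce at this hroot
      omega
    · exact h.pm.inj j j' hp hj hp' hj' hz he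
  unfold searchProg
  refine Runs.step (T₂ := 300 * (n + 1) - 10) rfl (Runs.step (T₂ := 300 * (n + 1) - 20) rfl
    (Runs.step (T₂ := 300 * (n + 1) - 30) rfl ?_ ?_) ?_) ?_
  rotate_left
  · have : (NVar.j1 ≔ₙ num 0).bound = 2 := rfl
    omega
  · have : (NVar.i0 ≔ₙ getN .mate NVar.j0).bound = 4 := rfl
    omega
  · have : (putN1 .used NVar.j0 (num 1)).bound = 4 := rfl
    omega
  obtain ⟨σ₁, hσ₁⟩ : ∃ σ₁, σ₁ = (NVar.j1 ≔ₙ num 0).run ((NVar.i0 ≔ₙ getN .mate NVar.j0).run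
    ((putN1 .used NVar.j0 (num 1)).run σ)) := ⟨_, rfl⟩
  rw [← hσ₁]
  have hqa : σ₁.qa = σ.qa := by rw [hσ₁]; rfl
  have hmate : σ₁.na .mate = σ.na .mate := by
    rw [hσ₁]; funext i j; simp [Stmt.run, updateArr]
  have hway : σ₁.na .way = σ.na .way := by
    rw [hσ₁]; funext i j; simp [Stmt.run, updateArr]
  have hused : ∀ j, σ₁.na .used j 0 = if j = σ.nv .j0 then 1 else σ.na .used j 0 := by
    intro j; rw [hσ₁]; simp [Stmt.run, updateArr, NExp.eval]
  have hi0 : σ₁.nv .i0 = σ.na .mate (σ.nv .j0) 0 := by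
    rw [hσ₁]; simp [Stmt.run, updateArr, NExp.eval]
  have hj0 : σ₁.nv .j0 = σ.nv .j0 := by rw [hσ₁]; simp [Stmt.run]
  have hj1 : σ₁.nv .j1 = 0 := by rw [hσ₁]; simp [Stmt.run, NExp.eval]
  have hn₁ : σ₁.nv .n = n := by rw [hσ₁]; simp [Stmt.run, hn]
  clear hσ₁
  refine Runs.seq (scan_spec hn₁ hj1) (T₂ := 110 * (n + 1) + 20) ?_ (by omega)
  intro σ₂ hK₂ hscan
  refine Runs.seq (dual_spec (n := n) ((hK₂.nv .n rfl).trans hn₁) ?_) (T₂ := 10) ?_ (by omega)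
  · rw [hK₂.na .used rfl, hK₂.na .mate rfl, hmate]
    intro j j' hj hj' hu hu'
    rw [hused] at hu hu'
    exact hinj j j' hj hj' hu hu'
  intro σ₃ hK₃ hdual
  refine Runs.of_loopFree rfl (by decide) ?_
  rw [hK₂.na .used rfl, hK₂.na .mate rfl, hmate, hK₂.qa .u rfl, hK₂.qa .v rfl, hqa] at hdual
  rw [hqa, hi0, hway, hj0] at hscan
  obtain ⟨d', hd', hc⟩ := Search.step hr h hm hused hscan hdual
  refine ⟨d', ?_, ?_⟩
  · have e1 : σ₃.qa .w = σ.qa .w := by rw [hK₃.qa .w rfl, hK₂.qa .w rfl, hqa]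
    have e2 : σ₃.na .mate = σ.na .mate := by rw [hK₃.na .mate rfl, hK₂.na .mate rfl, hmate]
    have e3 : σ₃.na .used = σ₁.na .used := by rw [hK₃.na .used rfl, hK₂.na .used rfl]
    have e4 : σ₃.na .way = σ₂.na .way := hK₃.na .way rfl
    have e5 : σ₃.nv .j1 = σ₂.nv .j1 := hK₃.nv .j1 rfl
    simp only [SearchAt, Stmt.run, NExp.eval, Function.update_self, e1, e2, e3, e4, e5]
    exact hd'
  · have e3 : σ₃.na .used = σ₁.na .used := by rw [hK₃.na .used rfl, hK₂.na .used rfl]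
    simp only [Stmt.run, e3]
    exact hc

/-- Initializing the dual variables and the matching. -/
def initBody : Stmt :=
  putQ1 .u NVar.j (rat 0) ;;
  putQ1 .v NVar.j (rat 0) ;;
  putN1 .mate NVar.j (num 0)

/-- One step of the augmentation. -/
def augmentBody : Stmt :=
  NVar.j1 ≔ₙ getN .way NVar.j0 ;;
  putN1 .mate NVar.j0 (getN .mate NVar.j1) ;;
  NVar.j0 ≔ₙ NVar.j1

/-- Matching one more row. -/
def rowBody : Stmt :=
  putN1 .mate (num 0) NVar.i ;;
  NVar.j0 ≔ₙ num 0 ;;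
  forTo .j (num 0) NVar.n (putN1 .used NVar.j (num 0)) ;;
  .loop (.not (getN .mate NVar.j0 =ₙ num 0)) searchProg ;;
  .loop (.not (NVar.j0 =ₙ num 0)) augmentBody

/-- The matching of the first `r` rows in the state `σ`, and its dual variables. -/
def MatchedAt (n r : ℕ) (σ : State) : Prop :=
  PartialMate n r (fun j => σ.na .mate j 0) ∧
    Dual n r (σ.qa .w) (fun j => σ.qa .u j 0) (fun j => σ.qa .v j 0) (fun j => σ.na .mate j 0)

/-- The search ends, as the tree grows with every step and cannot contain all columns. -/
theorem searchLoop_spec {σ : State} {n r : ℕ} {d : ℕ → ℕ} (hr : r < n) (hn : σ.nv .n = n)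
    (h : SearchAt n r d σ) :
    Runs (.loop (.not (getN .mate NVar.j0 =ₙ num 0)) searchProg) σ (400 * (n + 1) ^ 2)
      (fun σ' => (∃ d', SearchAt n r d' σ') ∧ σ'.na .mate (σ'.nv .j0) 0 = 0) := by
  refine (Runs.loop (T := 300 * (n + 1)) (fun σ' => σ'.nv .n = n ∧ ∃ d', SearchAt n r d' σ')
    (fun σ' => n + 1 - (usedSet n fun j => σ'.na .used j 0).card) ?_ (n + 1) σ ⟨hn, d, h⟩
    (Nat.sub_le _ _)).mono ?_ ?_
  · rintro σ' ⟨hn', d', h'⟩ hc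
    simp only [BExp.eval, NExp.eval, Bool.not_eq_true'] at hc
    replace hc := of_decide_eq_false hc
    refine (search_spec hr hn' h' hc).mono le_rfl fun σ'' hK ⟨d'', h'', hcard⟩ =>
      ⟨⟨(hK.nv .n rfl).trans hn', d'', h''⟩, ?_⟩
    have := usedSet_card_le n fun j => σ''.na .used j 0
    omega
  · simp only [BExp.cost, NExp.cost]
    nlinarith
  · rintro σ' - ⟨⟨-, h'⟩, hc⟩
    simp only [BExp.eval, NExp.eval, Bool.not_eq_false'] at hc
    replace hc := of_decide_eq_true hc
    exact ⟨h', hc⟩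

/-- The augmentation ends, as the depth of the hole decreases. -/
theorem augmentLoop_spec {σ : State} {n r : ℕ} {d : ℕ → ℕ}
    (h : SearchAt n r d σ) (hm : σ.na .mate (σ.nv .j0) 0 = 0) :
    Runs (.loop (.not (NVar.j0 =ₙ num 0)) augmentBody) σ (40 * (n + 1) + 20)
      (MatchedAt n (r + 1)) := by
  refine (Runs.loop (T := 20) (fun σ' => Augment n r (σ'.qa .w) (fun j => σ'.qa .u j 0)
    (fun j => σ'.qa .v j 0) (fun j => σ'.na .mate j 0) (fun j => σ'.na .way j 0) d
    {j | σ.na .used j 0 = 1 ∨ j = σ.nv .j0} (σ'.nv .j0))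
    (fun σ' => d (σ'.nv .j0)) ?_ (n + 1) σ (h.augment hm)
    (h.depth_le.trans (usedSet_card_le n _))).mono ?_ ?_
  · intro σ' h' hc
    simp only [BExp.eval, NExp.eval, Bool.not_eq_true'] at hc
    replace hc := of_decide_eq_false hc
    refine Runs.of_loopFree rfl (by decide) ⟨?_, ?_⟩
    · have := h'.step hc (mate' := fun j => (augmentBody.run σ').na .mate j 0) fun j => by
        simp [augmentBody, Stmt.run, NExp.eval, updateArr]
      have e : (augmentBody.run σ').na .way = σ'.na .way := by
        funext i j
        simp [augmentBody, Stmt.run, NExp.eval, updateArr]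
      rw [e]
      exact this
    · have := (h'.way_mem _ h'.j0_mem (by omega) h'.j0_le).2.2
      simpa [augmentBody, Stmt.run, NExp.eval, updateArr] using this
  · simp only [BExp.cost, NExp.cost]
    omega
  · rintro σ' - ⟨h', hc⟩
    simp only [BExp.eval, NExp.eval, Bool.not_eq_false'] at hc
    replace hc := of_decide_eq_true hc
    rw [hc] at h'
    exact h'.partialMate

theorem row_spec {σ : State} {n r : ℕ} (hr : r < n) (hn : σ.nv .n = n) (hi : σ.nv .i = r + 1)
    (h : MatchedAt n r σ) : Runs rowBody σ (600 * (n + 1) ^ 2) (MatchedAt n (r + 1)) := by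
  unfold rowBody
  have hn2 : n + 1 ≤ (n + 1) ^ 2 := Nat.le_self_pow two_ne_zero _
  refine Runs.step (T₂ := 600 * (n + 1) ^ 2 - 10) rfl
    (Runs.step (T₂ := 600 * (n + 1) ^ 2 - 20) rfl ?_ ?_) ?_
  rotate_left
  · have : (NVar.j0 ≔ₙ num 0).bound = 2 := rfl
    omega
  · have : (putN1 .mate (num 0) NVar.i).bound = 4 := rfl
    omega
  obtain ⟨σ₁, hσ₁⟩ : ∃ σ₁, σ₁ = (NVar.j0 ≔ₙ num 0).run
    ((putN1 .mate (num 0) NVar.i).run σ) := ⟨_, rfl⟩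
  rw [← hσ₁]
  have hqa : σ₁.qa = σ.qa := by rw [hσ₁]; rfl
  have hmate : ∀ j, σ₁.na .mate j 0 = if j = 0 then r + 1 else σ.na .mate j 0 := by
    intro j; rw [hσ₁]; simp [Stmt.run, updateArr, NExp.eval, hi]
  have hj0 : σ₁.nv .j0 = 0 := by rw [hσ₁]; simp [Stmt.run, NExp.eval]
  have hn₁ : σ₁.nv .n = n := by rw [hσ₁]; simp [Stmt.run, hn]
  clear hσ₁
  refine Runs.seq (T₁ := 30 * (n + 1)) (R := fun σ₂ => ∀ j, j < n + 1 → σ₂.na .used j 0 = 0)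
    (T₂ := 560 * (n + 1) ^ 2 - 20) ?_ ?_ (by omega)
  · refine Runs.forTo (T := 10) (L := 0) (H := n) (fun m σ' => ∀ j, j < m → σ'.na .used j 0 = 0)
      rfl (by omega) rfl (fun σ' h => (h.nv .n rfl).trans hn₁) (fun _ _ _ h => h) (by omega) ?_ ?_
      (fun _ _ h => h)
    · intro m σ' _ _ hx _ hI
      refine Runs.of_loopFree rfl (by decide) fun j hj => ?_
      by_cases hjm : j = m
      · simp [Stmt.run, updateArr, NExp.eval, hx, hjm]
      · simpa [Stmt.run, updateArr, NExp.eval, hx, hjm] using hI j (by omega)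
    · simp only [NExp.cost]; omega
  intro σ₂ hK₂ hused
  have hS : SearchAt n r (fun _ => 0) σ₂ := by
    rw [SearchAt, hK₂.nv .j0 rfl, hK₂.na .mate rfl, hK₂.na .way rfl, hK₂.qa .w rfl,
      hK₂.qa .u rfl, hK₂.qa .v rfl, hqa, hj0]
    have hne : ∀ j, 1 ≤ j → σ₁.na .mate j 0 = σ.na .mate j 0 := fun j hj => by
      rw [hmate, if_neg (by omega)]
    refine Search.init ⟨?_, ?_, ?_⟩ ⟨h.2.feas, ?_⟩ (by rw [hmate, if_pos rfl])
      fun j hj => hused j (by omega)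
    · intro j hj hjn
      rw [hne j hj]; exact h.1.le j hj hjn
    · intro j j' hj hjn hj' hjn'
      rw [hne j hj, hne j' hj']; exact h.1.inj j j' hj hjn hj' hjn'
    · intro i hi hir
      obtain ⟨j, hj, hjn, he⟩ := h.1.surj i hi hir
      exact ⟨j, hj, hjn, by rw [hne j hj]; exact he⟩
    · intro j hj hjn
      rw [hne j hj]; exact h.2.tight j hj hjn
  refine Runs.seq (searchLoop_spec hr ((hK₂.nv .n rfl).trans hn₁) hS) (T₂ := 40 * (n + 1) + 20) ?_
    (by omega)
  rintro σ₃ - ⟨⟨d, hd⟩, hm⟩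
  exact augmentLoop_spec hd hm

/-- The Hungarian algorithm finds, in cubic time, a perfect matching that is tight for feasible dual
variables. -/
theorem hungarian_spec {σ : State} {n : ℕ} (hn : σ.nv .n = n) :
    Runs hungarianProg σ (800 * (n + 1) ^ 3) (MatchedAt n n) := by
  have hn2 : n + 1 ≤ (n + 1) ^ 2 := Nat.le_self_pow two_ne_zero _
  have hn3 : (n + 1) ^ 3 = (n + 1) ^ 2 * (n + 1) := pow_succ _ _
  refine Runs.seq (T₁ := 40 * (n + 1)) (T₂ := 700 * (n + 1) ^ 3) (s₁ := forTo .j (num 0) NVar.n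
    initBody) (s₂ := forTo .i (num 1) NVar.n rowBody)
    (R := fun σ₁ => ∀ j, j < n + 1 → σ₁.na .mate j 0 = 0) ?_ ?_ (by nlinarith)
  · refine Runs.forTo (T := 20) (L := 0) (H := n) (fun m σ' => ∀ j, j < m → σ'.na .mate j 0 = 0)
      rfl (by omega) rfl (fun σ' h => (h.nv .n rfl).trans hn) (fun _ _ _ h => h) (by omega) ?_ ?_
      (fun _ _ h => h)
    · intro m σ' _ _ hx _ hI
      refine Runs.of_loopFree rfl (by decide) fun j hj => ?_
      by_cases hjm : j = m
      · simp [initBody, Stmt.run, updateArr, NExp.eval, hx, hjm]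
      · simpa [initBody, Stmt.run, updateArr, NExp.eval, hx, hjm] using hI j (by omega)
    · simp only [NExp.cost]; omega
  · intro σ₁ hK hmate
    refine Runs.forTo (T := 600 * (n + 1) ^ 2) (L := 1) (H := n) (fun m σ' => MatchedAt n (m - 1) σ')
      rfl (by omega) rfl (fun σ' h => (h.nv .n rfl).trans (hK.nv .n rfl |>.trans hn))
      (fun _ _ _ h => h) ⟨⟨?_, ?_, by omega⟩, ⟨by omega, ?_⟩⟩ ?_ ?_ (fun _ _ h => h)
    · intro j hj hjn
      exact (hmate j (by omega)).le
    · intro j _ hj hjn _ _ hz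
      exact absurd (hmate j (by omega)) hz
    · intro j hj hjn hz
      exact absurd (hmate j (by omega)) hz
    · intro i σ' hi hin hx hK' hI
      obtain ⟨r, rfl⟩ : ∃ r, i = r + 1 := ⟨i - 1, by omega⟩
      refine row_spec (by omega) ((hK'.nv .n rfl).trans (hK.nv .n rfl |>.trans hn)) hx hI
    · simp only [NExp.cost]
      rw [hn3, Nat.add_sub_cancel]
      generalize (n + 1) ^ 2 = X at hn2
      nlinarith

/-! ### Concavity of the best number of beneficiaries -/

/-- Birkhoff's theorem, in the form of a maximum principle: a linear function is at least as large
on some bijection in the support of a doubly stochastic array `Y` as on `Y`. -/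
theorem exists_equiv_sum_le {ι κ : Type*} [Fintype ι] [Fintype κ] [DecidableEq ι] [DecidableEq κ]
    (hc : Fintype.card ι = Fintype.card κ) (Y C : ι → κ → ℚ) (h0 : ∀ i k, 0 ≤ Y i k)
    (hrow : ∀ i, ∑ k, Y i k = 1) (hcol : ∀ k, ∑ i, Y i k = 1) :
    ∃ σ : ι ≃ κ, (∀ i, Y i (σ i) ≠ 0) ∧ ∑ i, ∑ k, C i k * Y i k ≤ ∑ i, C i (σ i) := by
  let e : ι ≃ κ := Fintype.equivOfCardEq hc
  let M : Matrix ι ι ℚ := fun i j => Y i (e j)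
  have hM : M ∈ doublyStochastic ℚ ι := by
    rw [mem_doublyStochastic_iff_sum]
    refine ⟨fun i j => h0 _ _, fun i => ?_, fun j => hcol _⟩
    exact (Equiv.sum_comp e (Y i)).trans (hrow i)
  obtain ⟨w, hw0, hw1, hwM⟩ := exists_eq_sum_perm_of_mem_doublyStochastic hM
  have hent : ∀ i j, Y i (e j) = ∑ σ : Equiv.Perm ι, w σ * if σ i = j then 1 else 0 := by
    intro i j
    have := congrFun (congrFun hwM i) j
    rw [Matrix.sum_apply] at this
    rw [show Y i (e j) = M i j from rfl, ← this]
    refine Finset.sum_congr rfl fun σ _ => ?_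
    rw [Matrix.smul_apply, smul_eq_mul, Equiv.Perm.permMatrix, PEquiv.toMatrix_apply]
    simp [Equiv.toPEquiv_apply, eq_comm]
  have hsum : ∑ i, ∑ k, C i k * Y i k = ∑ σ : Equiv.Perm ι, w σ * ∑ i, C i (e (σ i)) := by
    have h1 : ∀ i, ∑ k, C i k * Y i k = ∑ σ : Equiv.Perm ι, w σ * C i (e (σ i)) := by
      intro i
      rw [← Equiv.sum_comp e]
      simp_rw [hent, Finset.mul_sum]
      rw [Finset.sum_comm]
      refine Finset.sum_congr rfl fun σ _ => ?_
      rw [Finset.sum_eq_single (σ i)]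
      · simp [mul_comm]
      · intro j _ hj
        simp [hj.symm]
      · simp
    simp_rw [h1, Finset.mul_sum]
    exact Finset.sum_comm
  obtain ⟨σ, hσ, hle⟩ : ∃ σ : Equiv.Perm ι, 0 < w σ ∧
      ∑ i, ∑ k, C i k * Y i k ≤ ∑ i, C i (e (σ i)) := by
    by_contra! hcon
    obtain ⟨τ, -, hτ⟩ : ∃ τ ∈ Finset.univ, 0 < w τ := by
      by_contra! h
      have : ∑ σ, w σ ≤ 0 := Finset.sum_nonpos h
      linarith
    have : ∑ σ : Equiv.Perm ι, w σ * ∑ i, C i (e (σ i)) <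
        ∑ σ : Equiv.Perm ι, w σ * ∑ i, ∑ k, C i k * Y i k := by
      refine Finset.sum_lt_sum (fun σ _ => ?_) ⟨τ, Finset.mem_univ _,
        mul_lt_mul_of_pos_left (hcon τ hτ) hτ⟩
      rcases (hw0 σ).eq_or_lt with h | h
      · simp [← h]
      · exact mul_le_mul_of_nonneg_left (hcon σ h).le h.le
    rw [← hsum, ← Finset.sum_mul, hw1, one_mul] at this
    exact lt_irrefl _ this
  refine ⟨σ.trans e, fun i => ?_, hle⟩
  have : w σ ≤ Y i (e (σ i)) := by
    rw [hent]
    refine le_trans (by simp) (Finset.single_le_sum (f := fun τ : Equiv.Perm ι =>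
      w τ * if τ i = σ i then 1 else 0) (fun τ _ => ?_) (Finset.mem_univ σ))
    exact mul_nonneg (hw0 τ) (by split_ifs <;> simp)
  exact (hσ.trans_le this).ne'

/-- Integrality of fractional matchings of integral size `r`: a fractional matching `x` between
`P` and `S` of total size `r` can be replaced by an integral one of size `r` in its support
without decreasing a linear function. The proof adds vertices which match the `|P| - r` elements
of `P` and the `|S| - r` elements of `S` that must stay unmatched. -/
theorem exists_matching_of_fractional {P S : Type*} [Fintype P] [Fintype S] [DecidableEq P]
    [DecidableEq S] (x b : P → S → ℚ) (r : ℕ) (hP : r < Fintype.card P) (hS : r < Fintype.card S)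
    (h0 : ∀ p s, 0 ≤ x p s) (hrow : ∀ p, ∑ s, x p s ≤ 1) (hcol : ∀ s, ∑ p, x p s ≤ 1)
    (hsum : ∑ p, ∑ s, x p s = r) :
    ∃ f : P → Option S, (∀ p p' s, f p = some s → f p' = some s → p = p') ∧
      (Finset.univ.filter fun p => (f p).isSome).card = r ∧ (∀ p s, f p = some s → x p s ≠ 0) ∧
      ∑ p, ∑ s, b p s * x p s ≤ ∑ p, (f p).elim 0 (b p) := by
  obtain ⟨a, ha⟩ : ∃ a, Fintype.card P = r + a := ⟨_, (Nat.add_sub_cancel' hP.le).symm⟩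
  obtain ⟨c, hc⟩ : ∃ c, Fintype.card S = r + c := ⟨_, (Nat.add_sub_cancel' hS.le).symm⟩
  have ha0 : (a : ℚ) ≠ 0 := by norm_cast; omega
  have hc0 : (c : ℚ) ≠ 0 := by norm_cast; omega
  let Y : P ⊕ Fin c → S ⊕ Fin a → ℚ := Sum.elim
    (fun p => Sum.elim (x p) fun _ => (1 - ∑ s, x p s) / a)
    (fun _ => Sum.elim (fun s => (1 - ∑ p, x p s) / c) fun _ => 0)
  let C : P ⊕ Fin c → S ⊕ Fin a → ℚ := Sum.elim (fun p => Sum.elim (b p) fun _ => 0) fun _ _ => 0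
  obtain ⟨σ, hσ, hle⟩ := exists_equiv_sum_le (by simp [ha, hc]; omega) Y C (by
    rintro (p | i) (s | j)
    · exact h0 p s
    · exact div_nonneg (by linarith [hrow p]) (Nat.cast_nonneg a)
    · exact div_nonneg (by linarith [hcol s]) (Nat.cast_nonneg c)
    · exact le_rfl) (by
    rintro (p | i)
    · simp [Y, mul_div_cancel₀ _ ha0]
    · simp only [Y, Fintype.sum_sum_type, Sum.elim_inr, Sum.elim_inl, ← Finset.sum_div,
        Finset.sum_sub_distrib, Finset.sum_const_zero, add_zero]
      rw [Finset.sum_comm, hsum]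
      simp [hc, hc0]) (by
    rintro (s | j)
    · simp [Y, mul_div_cancel₀ _ hc0]
    · simp only [Y, Fintype.sum_sum_type, Sum.elim_inr, Sum.elim_inl, ← Finset.sum_div,
        Finset.sum_sub_distrib, Finset.sum_const_zero, add_zero]
      rw [hsum]
      simp [ha, ha0])
  have hsome : ∀ p s, (σ (.inl p)).getLeft? = some s ↔ σ (.inl p) = .inl s := fun p s =>
    Sum.getLeft?_eq_some_iff
  refine ⟨fun p => (σ (.inl p)).getLeft?, ?_, ?_, ?_, ?_⟩
  · intro p p' s h h'
    rw [hsome] at h h'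
    exact Sum.inl_injective (σ.injective (h.trans h'.symm))
  · -- the new columns are matched with elements of `P`, hence with exactly `a` of them
    have h1 : (Finset.univ.filter fun p => ¬ (σ (.inl p)).getLeft?.isSome).card = a := by
      have hq : ∀ j : Fin a, ∃ p, σ (.inl p) = .inr j := by
        intro j
        rcases hs : σ.symm (.inr j) with p | i
        · exact ⟨p, by rw [← hs, Equiv.apply_symm_apply]⟩
        · have := hσ (.inr i)
          rw [← hs, Equiv.apply_symm_apply, hs] at this
          exact absurd rfl this
      choose q hq using hq
      have hinj : Function.Injective q := fun j j' h =>
        Sum.inr_injective ((hq j).symm.trans ((congrArg (fun p => σ (.inl p)) h).trans (hq j')))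
      have himg : (Finset.univ.filter fun p => ¬ (σ (.inl p)).getLeft?.isSome) =
          Finset.univ.image q := by
        ext p
        simp only [Finset.mem_filter, Finset.mem_univ, true_and, Finset.mem_image]
        refine ⟨fun h => ?_, ?_⟩
        · rcases hp : σ (.inl p) with s | j
          · simp [hp] at h
          · exact ⟨j, Sum.inl_injective (σ.injective ((hq j).trans hp.symm))⟩
        · rintro ⟨j, rfl⟩
          simp [hq]
      rw [himg, Finset.card_image_of_injective _ hinj, Finset.card_univ, Fintype.card_fin]
    have h2 := Finset.card_filter_add_card_filter_not (s := (Finset.univ : Finset P))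
      fun p => (σ (.inl p)).getLeft?.isSome
    rw [Finset.card_univ, h1, ha] at h2
    exact Nat.add_right_cancel h2
  · intro p s h
    rw [hsome] at h
    have := hσ (.inl p)
    rwa [h] at this
  · simp only [C, Fintype.sum_sum_type, Sum.elim_inl, Sum.elim_inr, zero_mul,
      Finset.sum_const_zero, add_zero] at hle
    refine hle.trans (le_of_eq (Finset.sum_congr rfl fun p _ => ?_))
    rcases hp : σ (.inl p) with s | j <;> simp [hp]

theorem Matching.card_E {I : Instance} (μ : Matching I) :
    μ.E.card = (Finset.univ.filter fun p => (μ.assign p).isSome).card := by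
  refine Finset.card_nbij Prod.fst ?_ ?_ ?_
  · rintro ⟨p, c⟩ h
    simp only [Matching.E, Finset.coe_filter, Finset.mem_univ, true_and, Set.mem_ofPred_eq] at h ⊢
    simp [h.1]
  · rintro ⟨p, c⟩ h ⟨p', c'⟩ h' he
    simp only [Matching.E, Finset.coe_filter, Finset.mem_univ, true_and, Set.mem_ofPred_eq] at h h' he
    subst he
    rw [h.1] at h'
    simpa using h'.1
  · intro p h
    simp only [Finset.coe_filter, Finset.mem_univ, true_and, Set.mem_ofPred_eq] at h
    obtain ⟨c, hc⟩ := Option.isSome_iff_exists.1 h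
    exact ⟨(p, c), by simp [Matching.E, hc, μ.eligible p c hc], rfl⟩

theorem Matching.card_B {I : Instance} (μ : Matching I) :
    μ.B.card = (Finset.univ.filter fun p => ∃ c, μ.assign p = some c ∧ p ∈ I.bene c).card := by
  refine Finset.card_nbij Prod.fst ?_ ?_ ?_
  · rintro ⟨p, c⟩ h
    simp only [Matching.B, Finset.coe_filter, Finset.mem_univ, true_and, Set.mem_ofPred_eq] at h ⊢
    exact ⟨c, h⟩
  · rintro ⟨p, c⟩ h ⟨p', c'⟩ h' he
    simp only [Matching.B, Finset.coe_filter, Finset.mem_univ, true_and, Set.mem_ofPred_eq] at h h' he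
    subst he
    rw [h.1] at h'
    simpa using h'.1
  · intro p h
    simp only [Finset.coe_filter, Finset.mem_univ, true_and, Set.mem_ofPred_eq] at h
    obtain ⟨c, hc⟩ := h
    exact ⟨(p, c), by simpa [Matching.B] using hc, rfl⟩

theorem Matching.B_subset_E {I : Instance} (μ : Matching I) : μ.B ⊆ μ.E := fun x hx => by
  simp only [Matching.B, Matching.E, Finset.mem_filter, Finset.mem_univ, true_and] at hx ⊢
  exact ⟨hx.1, I.bene_subset _ hx.2⟩

/-- The patients of a matching can be given distinct seats of their categories. -/
theorem Matching.exists_seats {I : Instance} {S : Type*} [Fintype S] [DecidableEq S]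
    {cat : S → Fin I.numC} (hcat : ∀ c, (Finset.univ.filter fun s => cat s = c).card = I.quota c)
    (μ : Matching I) : ∃ f : Fin I.numP → Option S, (∀ p, (f p).map cat = μ.assign p) ∧
      ∀ p p' s, f p = some s → f p' = some s → p = p' := by
  have hg : ∀ c, Nonempty ({p // μ.assign p = some c} ↪ {s // cat s = c}) := fun c => by
    refine Function.Embedding.nonempty_of_card_le ?_
    rw [Fintype.card_subtype, Fintype.card_subtype, hcat]
    exact μ.quota_le c
  let g c := (hg c).some
  have hf : ∀ p, ∃ o : Option S, o.map cat = μ.assign p ∧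
      ∀ s, o = some s → ∃ (c : _) (h : p ∈ {p | μ.assign p = some c}), s = (g c ⟨p, h⟩).1 :=
      fun p => by
    rcases h : μ.assign p with _ | c
    · exact ⟨none, rfl, by simp⟩
    · refine ⟨some (g c ⟨p, h⟩).1, by simp [(g c ⟨p, h⟩).2], fun s hs => ⟨c, h, ?_⟩⟩
      simpa using hs.symm
  choose f hfa hfg using hf
  refine ⟨f, hfa, fun p p' s h h' => ?_⟩
  obtain ⟨c, hc, rfl⟩ := hfg p s h
  obtain ⟨c', hc', he⟩ := hfg p' _ h'
  obtain rfl : c = c' := by rw [← (g c ⟨p, hc⟩).2, he, (g c' ⟨p', hc'⟩).2]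
  simpa using (g c).injective (Subtype.ext he)

/-- The matching which gives each patient the category of the seat `f p`. -/
def Matching.ofSeats {I : Instance} {S : Type*} [Fintype S] [DecidableEq S]
    {cat : S → Fin I.numC} (hcat : ∀ c, (Finset.univ.filter fun s => cat s = c).card = I.quota c)
    (f : Fin I.numP → Option S) (hf : ∀ p p' s, f p = some s → f p' = some s → p = p')
    (he : ∀ p s, f p = some s → p ∈ I.elig (cat s)) : Matching I where
  assign p := (f p).map cat
  quota_le c := by
    rw [← hcat c]
    rw [← Finset.card_map (Function.Embedding.some (α := S))]
    refine Finset.card_le_card_of_injOn f ?_ ?_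
    · intro p hp
      have hp' : (f p).map cat = some c := by simpa using hp
      obtain ⟨s, hs, hc⟩ := Option.map_eq_some_iff.1 hp'
      simp [hs, hc]
    · intro p hp p' _ h
      have hp' : (f p).map cat = some c := by simpa using hp
      obtain ⟨s, hs, -⟩ := Option.map_eq_some_iff.1 hp'
      exact hf p p' s hs (h.symm.trans hs)
  eligible p c h := by
    obtain ⟨s, hs, rfl⟩ := Option.map_eq_some_iff.1 h
    exact he p s hs

theorem Matching.sum_bene {I : Instance} {S : Type*} {cat : S → Fin I.numC} (μ : Matching I)
    {f : Fin I.numP → Option S} (hf : ∀ p, (f p).map cat = μ.assign p) :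
    ∑ p, (f p).elim (0 : ℚ) (fun s => if p ∈ I.bene (cat s) then 1 else 0) = μ.B.card := by
  rw [μ.card_B, Finset.natCast_card_filter]
  refine Finset.sum_congr rfl fun p _ => ?_
  rw [← hf p]
  cases f p <;> simp

theorem Matching.sum_matched {I : Instance} {S : Type*} {cat : S → Fin I.numC} (μ : Matching I)
    {f : Fin I.numP → Option S} (hf : ∀ p, (f p).map cat = μ.assign p) :
    ∑ p, (f p).elim (0 : ℚ) (fun _ => 1) = μ.E.card := by
  rw [μ.card_E, Finset.natCast_card_filter]
  refine Finset.sum_congr rfl fun p _ => ?_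
  rw [← hf p]
  cases f p <;> simp

/-- The best number of beneficiaries is concave in the number of matches: half the sum of two
matchings is a fractional matching. -/
theorem Matching.exists_between {I : Instance} {μ ν : Matching I} {e : ℕ} (hμ : μ.E.card = e)
    (hν : ν.E.card = e + 2) :
    ∃ ρ : Matching I, ρ.E.card = e + 1 ∧ μ.B.card + ν.B.card ≤ 2 * ρ.B.card := by
  let S := Σ c : Fin I.numC, Fin (I.quota c)
  have hcat : ∀ c, (Finset.univ.filter fun s : S => s.1 = c).card = I.quota c := by
    intro c
    rw [← Fintype.card_subtype, Fintype.card_congr (Equiv.sigmaSubtype c), Fintype.card_fin]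
  obtain ⟨f, hf, hfi⟩ := μ.exists_seats hcat
  obtain ⟨g, hg, hgi⟩ := ν.exists_seats hcat
  let ind (h : Fin I.numP → Option S) (p : Fin I.numP) (s : S) : ℚ := if h p = some s then 1 else 0
  have ind_row : ∀ (h : Fin I.numP → Option S) (b : S → ℚ) p,
      ∑ s, b s * ind h p s = (h p).elim 0 b := by
    intro h b p
    rcases hp : h p with _ | s
    · simp [ind, hp]
    · simp [ind, hp]
  have ind_col : ∀ h : Fin I.numP → Option S, (∀ p p' s, h p = some s → h p' = some s → p = p') →
      ∀ s, ∑ p, ind h p s ≤ 1 := by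
    intro h hi s
    simp only [ind]
    rw [← Finset.natCast_card_filter]
    norm_cast
    refine Finset.card_le_one.2 fun p hp p' hp' => ?_
    simp only [Finset.mem_filter, Finset.mem_univ, true_and] at hp hp'
    exact hi p p' s hp hp'
  have hP : e + 1 < Fintype.card (Fin I.numP) := by
    have := Finset.card_filter_le Finset.univ fun p => (ν.assign p).isSome
    rw [← ν.card_E, hν, Finset.card_univ] at this
    omega
  have hS : e + 1 < Fintype.card S := by
    rw [← Finset.card_univ, ← Finset.card_map Function.Embedding.some]
    refine lt_of_lt_of_le (b := ν.E.card) (by omega) ?_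
    rw [ν.card_E]
    refine Finset.card_le_card_of_injOn g ?_ ?_
    · intro p hp
      have hp' : (ν.assign p).isSome := by simpa using hp
      rw [← hg p, Option.isSome_map] at hp'
      obtain ⟨s, hs⟩ := Option.isSome_iff_exists.1 hp'
      simp [hs]
    · intro p hp p' _ h
      have hp' : (ν.assign p).isSome := by simpa using hp
      rw [← hg p, Option.isSome_map] at hp'
      obtain ⟨s, hs⟩ := Option.isSome_iff_exists.1 hp'
      exact hgi p p' s hs (h.symm.trans hs)
  have hx : ∀ (b : S → ℚ) p, ∑ s, b s * ((ind f p s + ind g p s) / 2) =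
      ((f p).elim 0 b + (g p).elim 0 b) / 2 := by
    intro b p
    rw [← ind_row f, ← ind_row g, ← Finset.sum_add_distrib, Finset.sum_div]
    exact Finset.sum_congr rfl fun s _ => by ring
  have hx1 : ∀ p, ∑ s, (ind f p s + ind g p s) / 2 =
      ((f p).elim 0 (fun _ => 1) + (g p).elim 0 (fun _ => 1)) / 2 := by
    intro p
    rw [← hx]
    simp
  obtain ⟨h, hi, hcard, hsupp, hle⟩ := exists_matching_of_fractional
    (fun p s => (ind f p s + ind g p s) / 2) (fun p s => if p ∈ I.bene s.1 then 1 else 0) (e + 1)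
    hP hS (fun p s => by simp only [ind]; split_ifs <;> norm_num)
    (fun p => by rw [hx1]; cases f p <;> cases g p <;> norm_num)
    (fun s => by
      rw [← Finset.sum_div, Finset.sum_add_distrib]
      linarith [ind_col f hfi s, ind_col g hgi s])
    (by
      simp_rw [hx1]
      rw [← Finset.sum_div, Finset.sum_add_distrib, μ.sum_matched hf, ν.sum_matched hg, hμ, hν]
      push_cast
      ring)
  have helig : ∀ p (s : S), h p = some s → p ∈ I.elig s.1 := by
    intro p s hs
    have := hsupp p s hs
    by_cases h1 : f p = some s
    · exact μ.eligible p _ (by rw [← hf p, h1]; rfl)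
    · by_cases h2 : g p = some s
      · exact ν.eligible p _ (by rw [← hg p, h2]; rfl)
      · simp [ind, h1, h2] at this
  refine ⟨Matching.ofSeats hcat h hi helig, ?_, ?_⟩
  · rw [Matching.card_E, ← hcard]
    simp [Matching.ofSeats]
  · simp_rw [hx] at hle
    rw [← Finset.sum_div, Finset.sum_add_distrib, μ.sum_bene hf, ν.sum_bene hg,
      (Matching.ofSeats hcat h hi helig).sum_bene (cat := Sigma.fst) (f := h) fun _ => rfl] at hle
    have : ((μ.B.card + ν.B.card : ℕ) : ℚ) ≤ (2 * (Matching.ofSeats hcat h hi helig).B.card : ℕ) := by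
      push_cast
      linarith
    exact_mod_cast this

/-! ### The frontier and the kinks -/

theorem Matching.card_E_le {I : Instance} (μ : Matching I) : μ.E.card ≤ I.n := by
  rw [μ.card_E]
  exact ((Finset.card_filter_le _ _).trans (by simp)).trans (le_max_left _ _)

theorem Matching.card_B_le {I : Instance} (μ : Matching I) : μ.B.card ≤ μ.E.card :=
  Finset.card_le_card μ.B_subset_E

/-- The matching in which nobody is matched. -/
def Matching.empty (I : Instance) : Matching I := ⟨fun _ => none, by simp, by simp⟩

theorem Matching.exists_card_E_eq {I : Instance} (μ : Matching I) {e : ℕ} (he : e ≤ μ.E.card) :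
    ∃ ρ : Matching I, ρ.E.card = e := by
  rw [μ.card_E] at he
  obtain ⟨T, hT, rfl⟩ := Finset.exists_subset_card_eq he
  refine ⟨⟨fun p => if p ∈ T then μ.assign p else none, fun c => ?_, fun p c h => ?_⟩, ?_⟩
  · refine (Finset.card_le_card fun p => ?_).trans (μ.quota_le c)
    simp only [Finset.mem_filter, Finset.mem_univ, true_and]
    split_ifs <;> simp
  · split_ifs at h
    exact μ.eligible p c h
  · rw [Matching.card_E]
    congr 1
    ext p
    simp only [Finset.mem_filter, Finset.mem_univ, true_and]
    split_ifs with h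
    · simpa [h] using hT h
    · simp [h]

/-- `ν` is the greatest number of matches, and `f e` is the greatest number of beneficiaries in a
matching with `e` matches. -/
structure Instance.Profile (I : Instance) (ν : ℕ) (f : ℕ → ℕ) : Prop where
  attained : ∀ e, e ≤ ν → ∃ μ : Matching I, μ.point = (e, f e)
  card_le : ∀ μ : Matching I, μ.E.card ≤ ν ∧ μ.B.card ≤ f μ.E.card

theorem Instance.exists_profile (I : Instance) : ∃ ν f, I.Profile ν f := by
  have hmax : ∀ (s : Set (Matching I)), s.Nonempty → ∀ g : Matching I → ℕ, (∀ μ, g μ ≤ I.n) →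
      ∃ μ ∈ s, ∀ μ' ∈ s, g μ' ≤ g μ := by
    intro s hs g hg
    obtain ⟨x, ⟨μ, hμ, rfl⟩, hx⟩ := BddAbove.exists_isGreatest_of_nonempty (X := ℕ) (S := g '' s)
      ⟨I.n, by rintro _ ⟨μ, -, rfl⟩; exact hg μ⟩ (hs.image g)
    exact ⟨μ, hμ, fun μ' h => hx ⟨μ', h, rfl⟩⟩
  obtain ⟨μ₀, -, h₀⟩ := hmax Set.univ ⟨.empty I, trivial⟩ (fun μ => μ.E.card) Matching.card_E_le
  have hf : ∀ e, ∃ b, e ≤ μ₀.E.card → (∃ μ : Matching I, μ.point = (e, b)) ∧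
      ∀ μ : Matching I, μ.E.card = e → μ.B.card ≤ b := by
    intro e
    by_cases he : e ≤ μ₀.E.card
    · obtain ⟨μ, hμ, h⟩ := hmax {μ | μ.E.card = e} (μ₀.exists_card_E_eq he) (fun μ => μ.B.card)
        fun μ => μ.card_B_le.trans μ.card_E_le
      exact ⟨μ.B.card, fun _ => ⟨⟨μ, Prod.ext hμ rfl⟩, h⟩⟩
    · exact ⟨0, fun h => absurd h he⟩
  choose f hf using hf
  exact ⟨μ₀.E.card, f, fun e he => (hf e he).1,
    fun μ => ⟨h₀ μ trivial, (hf _ (h₀ μ trivial)).2 μ rfl⟩⟩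

namespace Instance.Profile

variable {I : Instance} {ν : ℕ} {f : ℕ → ℕ}

theorem f_le (h : I.Profile ν f) {e : ℕ} (he : e ≤ ν) : f e ≤ e := by
  obtain ⟨μ, hμ⟩ := h.attained e he
  have := μ.card_B_le
  simp only [Matching.point, Prod.mk.injEq] at hμ
  omega

theorem le_n (h : I.Profile ν f) : ν ≤ I.n := by
  obtain ⟨μ, hμ⟩ := h.attained ν le_rfl
  have := μ.card_E_le
  simp only [Matching.point, Prod.mk.injEq] at hμ
  omega

theorem concave (h : I.Profile ν f) {e : ℕ} (he : e + 2 ≤ ν) : f e + f (e + 2) ≤ 2 * f (e + 1) := by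
  obtain ⟨μ, hμ⟩ := h.attained e (by omega)
  obtain ⟨μ', hμ'⟩ := h.attained (e + 2) he
  simp only [Matching.point, Prod.mk.injEq] at hμ hμ'
  obtain ⟨ρ, hρ, hle⟩ := Matching.exists_between hμ.1 hμ'.1
  have := (h.card_le ρ).2
  rw [hρ] at this
  omega

/-- The loss of beneficiaries caused by one more match increases. -/
theorem loss_mono (h : I.Profile ν f) {e e' : ℕ} (hee' : e ≤ e') (he' : e' < ν) :
    f e + f (e' + 1) ≤ f (e + 1) + f e' := by
  induction e', hee' using Nat.le_induction with
  | base => omega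
  | succ e' _ ih =>
    have := h.concave (e := e') (by omega)
    have := ih (by omega)
    rw [show e' + 1 + 1 = e' + 2 from rfl]
    omega

end Instance.Profile

theorem Matching.weight_eq {I : Instance} (k : ℕ) (μ : Matching I) :
    μ.weight k = μ.E.card + (1 / k + 1 / (I.n : ℚ) ^ 2) * μ.B.card := by
  have := Finset.card_sdiff_add_card_eq_card μ.B_subset_E
  have : ((μ.E \ μ.B).card : ℚ) + μ.B.card = μ.E.card := by exact_mod_cast this
  rw [Matching.weight, Instance.wBene, ← this]
  ring

namespace Instance.Profile

variable {I : Instance} {ν : ℕ} {f : ℕ → ℕ}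

/-- The number of matches is optimal in iteration `k`: up to `e` matches, every match costs less
than `k` beneficiaries, and beyond `e` at least `k`. -/
structure IsKink (ν : ℕ) (f : ℕ → ℕ) (k e : ℕ) : Prop where
  le : e ≤ ν
  before : ∀ e', e' < e → f e' + 1 ≤ f (e' + 1) + k
  after : ∀ e', e ≤ e' → e' < ν → f (e' + 1) + k ≤ f e'

theorem point_eq (h : I.Profile ν f) {k : ℕ} (hk : 1 ≤ k) {μ : Matching I}
    (hμ : μ.IsMaxWeight k) : μ.point = (μ.E.card, f μ.E.card) := by
  obtain ⟨μ', hμ'⟩ := h.attained _ (h.card_le μ).1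
  simp only [Matching.point, Prod.mk.injEq, true_and] at hμ' ⊢
  have hw := hμ μ'
  rw [Matching.weight_eq, Matching.weight_eq, hμ'.1, hμ'.2] at hw
  have hl : (0 : ℚ) < 1 / k + 1 / (I.n : ℚ) ^ 2 := by positivity
  have : (f μ.E.card : ℚ) ≤ μ.B.card := le_of_mul_le_mul_left (by linarith) hl
  exact le_antisymm (h.card_le μ).2 (by exact_mod_cast this)

/-- The choice of the weights: a beneficiary is worth slightly more than `1 / k`, but less than
`1 / (k - 1)` of a match. -/
theorem isKink (h : I.Profile ν f) {k : ℕ} (hk : 1 ≤ k) (hkn : k ≤ I.n) {μ : Matching I}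
    (hμ : μ.IsMaxWeight k) : IsKink ν f k μ.E.card := by
  have hk0 : (0 : ℚ) < k := by exact_mod_cast hk
  have hkn' : (k : ℚ) ≤ I.n := by exact_mod_cast hkn
  have hn0 : (0 : ℚ) < I.n := hk0.trans_le hkn'
  have hl : (0 : ℚ) < 1 / k + 1 / (I.n : ℚ) ^ 2 := by positivity
  have hb : μ.B.card = f μ.E.card := congrArg Prod.snd (h.point_eq hk hμ)
  have hw : ∀ e, e ≤ ν → (e : ℚ) + (1 / k + 1 / (I.n : ℚ) ^ 2) * f e ≤
      μ.E.card + (1 / k + 1 / (I.n : ℚ) ^ 2) * f μ.E.card := by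
    intro e he
    obtain ⟨μ', hμ'⟩ := h.attained e he
    have := hμ μ'
    simp only [Matching.point, Prod.mk.injEq] at hμ'
    rwa [Matching.weight_eq, Matching.weight_eq, hμ'.1, hμ'.2, hb] at this
  have hν := (h.card_le μ).1
  generalize μ.E.card = e at hw hν
  have hlk : 1 < (1 / k + 1 / (I.n : ℚ) ^ 2) * k := by
    have : (1 / k + 1 / (I.n : ℚ) ^ 2) * k = 1 + k / (I.n : ℚ) ^ 2 := by field_simp
    rw [this]
    have : 0 < k / (I.n : ℚ) ^ 2 := by positivity
    linarith
  have hlk' : (1 / k + 1 / (I.n : ℚ) ^ 2) * (k - 1) < 1 := by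
    have : (1 / k + 1 / (I.n : ℚ) ^ 2) * (k - 1) =
        1 - (I.n ^ 2 - k * (k - 1)) / (k * I.n ^ 2) := by field_simp; ring
    rw [this]
    have : 0 < (I.n ^ 2 - k * (k - 1)) / (k * (I.n : ℚ) ^ 2) := by
      refine div_pos ?_ (by positivity)
      nlinarith
    linarith
  refine ⟨hν, fun e' he' => ?_, fun e' he' hν' => ?_⟩
  · have h1 : f (e - 1) + 1 ≤ f e + k := by
      by_contra! hc
      have h2 := hw (e - 1) (by omega)
      have h3 : (f e : ℚ) + k ≤ f (e - 1) := by exact_mod_cast Nat.lt_succ_iff.1 hc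
      have h4 := mul_le_mul_of_nonneg_left h3 hl.le
      rw [Nat.cast_sub (by omega), Nat.cast_one] at h2
      linarith
    have h2 := h.loss_mono (e := e') (e' := e - 1) (by omega) (by omega)
    rw [Nat.sub_add_cancel (by omega)] at h2
    omega
  · have h1 : f (e + 1) + k ≤ f e := by
      by_contra! hc
      have h2 := hw (e + 1) (by omega)
      have h3 : (f e : ℚ) + 1 ≤ f (e + 1) + k := by exact_mod_cast hc
      have h4 := mul_le_mul_of_nonneg_left h3 hl.le
      push_cast at h2
      linarith
    have h2 := h.loss_mono (e := e) (e' := e') he' hν'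
    omega

theorem IsKink.mono {k e e' : ℕ} (h : IsKink ν f k e) (h' : IsKink ν f (k + 1) e') : e ≤ e' := by
  by_contra! hc
  have h1 := h.before e' hc
  have h2 := h'.after e' le_rfl (by have := h.le; omega)
  omega

/-- Between consecutive kinks every match costs exactly `k` beneficiaries. -/
theorem IsKink.linear {k e e' : ℕ} (h : IsKink ν f k e) (h' : IsKink ν f (k + 1) e') (j : ℕ)
    (hj : j ≤ e' - e) : f (e' - j) = f e' + j * k := by
  induction j with
  | zero => simp
  | succ j ih =>
    have h1 := h.after (e' - (j + 1)) (by omega) (by have := h'.le; omega)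
    have h2 := h'.before (e' - (j + 1)) (by omega)
    have h3 := ih (by omega)
    rw [show e' - (j + 1) + 1 = e' - j by omega] at h1 h2
    rw [Nat.succ_mul]
    omega

/-- The last kink lies at the greatest size `ν`: no match costs as many as `n` beneficiaries. -/
theorem IsKink.eq_max (h : I.Profile ν f) {e : ℕ} (he : IsKink ν f I.n e) : e = ν := by
  by_contra hne
  have h0 := he.le
  have h1 := he.after e le_rfl (by omega)
  have h2 := h.f_le h0
  have h3 := h.le_n
  omega

/-- The frontier begins at the first kink: before it, further matches cost no beneficiaries. -/
theorem frontier_eq (h : I.Profile ν f) {e₁ : ℕ} (h₁ : IsKink ν f 1 e₁) :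
    I.frontier = {x | ∃ e, e₁ ≤ e ∧ e ≤ ν ∧ x = (e, f e)} := by
  have hanti : ∀ e, e₁ ≤ e → ∀ e', e < e' → e' ≤ ν → f e' < f e := by
    intro e he e' hee'
    induction e', hee' using Nat.le_induction with
    | base => intro h'; have := h₁.after e he (by omega); rw [Nat.succ_eq_add_one]; omega
    | succ e' hlt ih =>
      intro h'
      have := ih (by omega)
      have := h₁.after e' (by omega) (by omega)
      omega
  have hmono : ∀ j, j ≤ e₁ → f (e₁ - j) ≤ f e₁ := by
    intro j
    induction j with
    | zero => simp
    | succ j ih =>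
      intro hj
      have h1 := ih (by omega)
      have h2 := h₁.before (e₁ - (j + 1)) (by omega)
      rw [show e₁ - (j + 1) + 1 = e₁ - j by omega] at h2
      omega
  ext x
  constructor
  · rintro ⟨μ, hμ, rfl⟩
    obtain ⟨h1, h2⟩ := h.card_le μ
    refine ⟨μ.E.card, ?_, h1, Prod.ext rfl ?_⟩
    · by_contra! hc
      obtain ⟨μ', hμ'⟩ := h.attained e₁ h₁.le
      simp only [Matching.point, Prod.mk.injEq] at hμ'
      have h3 := hmono (e₁ - μ.E.card) (by omega)
      rw [show e₁ - (e₁ - μ.E.card) = μ.E.card by omega] at h3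
      exact hμ μ' ⟨by omega, by omega, .inl (by omega)⟩
    · obtain ⟨μ', hμ'⟩ := h.attained _ h1
      simp only [Matching.point, Prod.mk.injEq] at hμ'
      show μ.B.card = _
      by_contra hne
      exact hμ μ' ⟨by omega, by omega, .inr (by omega)⟩
  · rintro ⟨e, he, heν, rfl⟩
    obtain ⟨μ, hp⟩ := h.attained e heν
    refine ⟨μ, ?_, hp⟩
    obtain ⟨hμ, hμ'⟩ := Prod.mk.inj hp
    rintro μ' ⟨h1, h2, h3⟩
    obtain ⟨h4, h5⟩ := h.card_le μ'
    rcases (hμ ▸ h1).eq_or_lt with h6 | h6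
    · rw [← h6] at h5
      omega
    · have := hanti e he _ h6 h4
      omega

end Instance.Profile

theorem zip_tail_concat {α : Type*} (K : List α) {a : α} (x : α) (h : K.getLast? = some a) :
    (K ++ [x]).zip (K ++ [x]).tail = K.zip K.tail ++ [(a, x)] := by
  induction K with
  | nil => simp at h
  | cons b K ih =>
    cases K with
    | nil => simp at h; simp [h]
    | cons c K =>
      have := ih (by simpa using h)
      simpa using this

/-- The output belonging to the list `K` of kinks. -/
def outputOf (K : List (ℕ × ℕ)) : List (ℚ × ℚ) :=
  K.map (fun x => ((x.1 : ℚ), (x.2 : ℚ))) ++ (K.zip K.tail).flatMap fun y => interpolate y.1 y.2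

/-- The definition of `interpolate` with the index `j` ranging over `ℕ`; there, the list of indices is
first mapped to `ℚ`. -/
theorem interpolate_eq (x x' : ℕ × ℕ) : interpolate x x' =
    (List.range' 1 (x'.1 - x.1 - 1)).map fun j : ℕ =>
      ((x'.1 : ℚ) - j, (x'.2 : ℚ) + j * ((x.2 : ℚ) - x'.2) / ((x'.1 : ℚ) - x.1)) := by
  have : (do let a ← List.range' 1 (x'.1 - x.1 - 1); pure (a : ℚ)) =
      (List.range' 1 (x'.1 - x.1 - 1)).map Nat.cast := List.flatMap_pure_eq_map _ _
  rw [interpolate, this, List.map_map]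
  rfl

theorem mem_interpolate {ν k e e' : ℕ} {f : ℕ → ℕ} (h : Instance.Profile.IsKink ν f k e)
    (h' : Instance.Profile.IsKink ν f (k + 1) e') (hlt : e < e') (x : ℚ × ℚ) :
    x ∈ interpolate (e, f e) (e', f e') ↔ ∃ a, e < a ∧ a < e' ∧ x = ((a : ℚ), (f a : ℚ)) := by
  have hf : (f e : ℚ) = f e' + (e' - e) * k := by
    have := h.linear h' (e' - e) le_rfl
    rw [show e' - (e' - e) = e by omega] at this
    rw [this]
    push_cast [Nat.cast_sub hlt.le]
    ring
  have hne : (e' : ℚ) - e ≠ 0 := sub_ne_zero.2 (by exact_mod_cast hlt.ne')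
  have hpt : ∀ j, j ≤ e' - e → ((e' : ℚ) - j, (f e' : ℚ) + j * ((f e : ℚ) - f e') / (e' - e)) =
      (((e' - j : ℕ) : ℚ), (f (e' - j) : ℚ)) := by
    intro j hj
    rw [h.linear h' j hj, Nat.cast_sub (by omega), hf]
    ext
    · rfl
    · push_cast
      field_simp
      ring
  simp only [interpolate_eq, List.mem_map, List.mem_range'_1]
  constructor
  · rintro ⟨j, hj, rfl⟩
    exact ⟨e' - j, by omega, by omega, hpt j (by omega)⟩
  · rintro ⟨a, h1, h2, rfl⟩
    refine ⟨e' - a, by omega, ?_⟩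
    rw [hpt (e' - a) (by omega), show e' - (e' - a) = a by omega]

/-- The points produced from the kinks of the first `m + 1` iterations are the points of the profile
between the first and the last of these kinks. -/
theorem kinks_spec {ν : ℕ} {f : ℕ → ℕ} {e : ℕ → ℕ} (m : ℕ)
    (h : ∀ k, 1 ≤ k → k ≤ m + 1 → Instance.Profile.IsKink ν f k (e k)) :
    (kinks ((List.range' 1 (m + 1)).map fun k => (e k, f (e k)))).getLast? =
        some (e (m + 1), f (e (m + 1))) ∧
    ∀ x, x ∈ outputOf (kinks ((List.range' 1 (m + 1)).map fun k => (e k, f (e k)))) ↔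
      ∃ a, e 1 ≤ a ∧ a ≤ e (m + 1) ∧ x = ((a : ℚ), (f a : ℚ)) := by
  induction m with
  | zero =>
    refine ⟨by simp [kinks, addKink], fun x => ?_⟩
    have : outputOf (kinks ((List.range' 1 (0 + 1)).map fun k => (e k, f (e k)))) =
        [((e 1 : ℚ), (f (e 1) : ℚ))] := rfl
    rw [this, List.mem_singleton]
    constructor
    · rintro rfl
      exact ⟨e 1, le_rfl, le_rfl, rfl⟩
    · rintro ⟨a, h1, h2, rfl⟩
      rw [le_antisymm h1 h2]
  | succ m ih =>
    obtain ⟨h1, h2⟩ := ih fun k hk hkm => h k hk (by omega)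
    have hk := h (m + 1) (by omega) (by omega)
    have hk' := h (m + 2) (by omega) (by omega)
    have hmono : ∀ k, k ≤ m + 1 → 1 ≤ k → e 1 ≤ e k := by
      intro k hkm hk1
      induction k, hk1 using Nat.le_induction with
      | base => exact le_rfl
      | succ k hk1 ih =>
        exact (ih (by omega)).trans ((h k hk1 (by omega)).mono (h (k + 1) (by omega) (by omega)))
    have hle := hk.mono hk'
    have he1 := hmono (m + 1) le_rfl (by omega)
    rw [List.range'_1_concat, List.map_append, kinks, List.foldl_append, ← kinks,
      show 1 + (m + 1) = m + 2 by omega]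
    generalize kinks ((List.range' 1 (m + 1)).map fun k => (e k, f (e k))) = K at h1 h2
    simp only [List.map_cons, List.map_nil, List.foldl_cons, List.foldl_nil, addKink, h1]
    rcases hle.eq_or_lt with heq | hlt
    · rw [if_pos (by rw [heq]), ← heq]
      exact ⟨h1, h2⟩
    · rw [if_neg (by simp; omega)]
      refine ⟨by simp, fun x => ?_⟩
      have h3 : x ∈ outputOf (K ++ [(e (m + 2), f (e (m + 2)))]) ↔ x ∈ outputOf K ∨
          x = ((e (m + 2) : ℚ), (f (e (m + 2)) : ℚ)) ∨
          x ∈ interpolate (e (m + 1), f (e (m + 1))) (e (m + 2), f (e (m + 2))) := by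
        rw [outputOf, zip_tail_concat K _ h1, List.map_append, List.flatMap_append, outputOf]
        simp only [List.mem_append, List.map_cons, List.map_nil, List.flatMap_cons,
          List.flatMap_nil, List.append_nil, List.mem_singleton]
        tauto
      rw [h3, h2, mem_interpolate hk hk' hlt, show m + 1 + 1 = m + 2 from rfl]
      constructor
      · rintro (⟨a, h4, h5, rfl⟩ | rfl | ⟨a, h4, h5, rfl⟩)
        · exact ⟨a, h4, by omega, rfl⟩
        · exact ⟨e (m + 2), by omega, le_rfl, rfl⟩
        · exact ⟨a, by omega, by omega, rfl⟩
      · rintro ⟨a, h4, h5, rfl⟩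
        rcases Nat.lt_or_ge (e (m + 1)) a with h6 | h6
        · rcases h5.eq_or_lt with rfl | h7
          · exact .inr (.inl rfl)
          · exact .inr (.inr ⟨a, h6, h7, rfl⟩)
        · exact .inl ⟨a, h4, h6, rfl⟩

theorem output_eq_frontier (I : Instance) (hn : 0 < I.n) (μ : ℕ → Matching I)
    (hμ : ∀ k ∈ Finset.Icc 1 I.n, (μ k).IsMaxWeight k) : {x | x ∈ I.output μ} = I.frontierQ := by
  obtain ⟨ν, f, h⟩ := I.exists_profile
  have hK : ∀ k, 1 ≤ k → k ≤ I.n → Instance.Profile.IsKink ν f k (μ k).E.card := fun k h1 h2 =>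
    h.isKink h1 h2 (hμ k (Finset.mem_Icc.2 ⟨h1, h2⟩))
  have hpts : (List.range' 1 I.n).map (fun k => (μ k).point) =
      (List.range' 1 I.n).map fun k => ((μ k).E.card, f (μ k).E.card) := by
    refine List.map_congr_left fun k hk => ?_
    rw [List.mem_range'_1] at hk
    exact h.point_eq hk.1 (hμ k (Finset.mem_Icc.2 ⟨hk.1, by omega⟩))
  have hout : I.output μ = outputOf (kinks ((List.range' 1 I.n).map fun k =>
      ((μ k).E.card, f (μ k).E.card))) := by
    rw [← hpts]; rfl
  obtain ⟨m, hm⟩ : ∃ m, I.n = m + 1 := ⟨I.n - 1, by omega⟩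
  have hν := (hK I.n hn le_rfl).eq_max h
  ext x
  rw [hout, Instance.frontierQ, h.frontier_eq (hK 1 le_rfl hn), hm]
  refine ((kinks_spec (e := fun k => (μ k).E.card) m fun k h1 h2 => hK k h1 (by omega)).2 x).trans ?_
  rw [← hm, hν]
  constructor
  · rintro ⟨a, h1, h2, rfl⟩
    exact ⟨(a, f a), ⟨a, h1, h2, rfl⟩, rfl⟩
  · rintro ⟨_, ⟨a, h1, h2, rfl⟩, rfl⟩
    exact ⟨a, h1, h2, rfl⟩

/-! ### Seats, weights and counting on the machine -/

/-- The state holds the tables of the instance, and a list of the seats of all categories. -/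
structure Loaded (I : Instance) (σ : State) : Prop where
  numP : σ.nv .numP = I.numP
  numS : σ.nv .numS = I.seats
  n : σ.nv .n = I.n
  elig : σ.na .elig = I.init.na .elig
  bene : σ.na .bene = I.init.na .bene
  seat_lt : ∀ j, j < I.seats → σ.na .seat (j + 1) 0 < I.numC
  card_seat : ∀ c : Fin I.numC,
    ((Finset.range I.seats).filter fun j => σ.na .seat (j + 1) 0 = c).card = I.quota c

theorem Loaded.keeps {I : Instance} {s : Stmt} {σ σ' : State} (h : Loaded I σ)
    (hK : Keeps s σ σ') (h1 : s.writes (.nv .numP) = false) (h2 : s.writes (.nv .numS) = false)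
    (h3 : s.writes (.nv .n) = false) (h4 : s.writes (.na .elig) = false)
    (h5 : s.writes (.na .bene) = false) (h6 : s.writes (.na .seat) = false) : Loaded I σ' := by
  refine ⟨(hK.nv _ h1).trans h.numP, (hK.nv _ h2).trans h.numS, (hK.nv _ h3).trans h.n,
    (hK.na _ h4).trans h.elig, (hK.na _ h5).trans h.bene, ?_, ?_⟩
  · rw [hK.na _ h6]; exact h.seat_lt
  · rw [hK.na _ h6]; exact h.card_seat

/-- The seats of all categories before `c`, and `t` seats of `c`, are listed. -/
def SeatsListed (I : Instance) (c t : ℕ) (σ : State) : Prop :=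
  σ.nv .numS = (∑ c' ∈ Finset.univ.filter fun c' : Fin I.numC => (c' : ℕ) < c, I.quota c') + t ∧
  (∀ j, j < σ.nv .numS → σ.na .seat (j + 1) 0 < I.numC) ∧
  ∀ c' : Fin I.numC, ((Finset.range (σ.nv .numS)).filter fun j => σ.na .seat (j + 1) 0 = c').card =
    if (c' : ℕ) < c then I.quota c' else if (c' : ℕ) = c then t else 0

theorem SeatsListed.succ {I : Instance} {c t : ℕ} {σ σ' : State} (h : SeatsListed I c t σ)
    (hc : c < I.numC) (hS : σ'.nv .numS = σ.nv .numS + 1)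
    (hs : ∀ j, σ'.na .seat j 0 = if j = σ.nv .numS + 1 then c else σ.na .seat j 0) :
    SeatsListed I c (t + 1) σ' := by
  obtain ⟨h1, h2, h3⟩ := h
  refine ⟨by omega, fun j hj => ?_, fun c' => ?_⟩
  · rw [hs]
    split_ifs
    · exact hc
    · exact h2 j (by omega)
  · rw [hS, Finset.range_add_one, Finset.filter_insert, hs, if_pos rfl]
    have hcongr : ((Finset.range (σ.nv .numS)).filter fun j => σ'.na .seat (j + 1) 0 = c') =
        (Finset.range (σ.nv .numS)).filter fun j => σ.na .seat (j + 1) 0 = c' := by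
      refine Finset.filter_congr fun j hj => ?_
      rw [Finset.mem_range] at hj
      rw [hs, if_neg (by omega)]
    rw [hcongr]
    split_ifs with h4 h5 h6
    · omega
    · rw [Finset.card_insert_of_notMem (by simp), h3, if_neg h5, if_pos h6]
    · omega
    · rw [h3, if_pos (by omega)]
    · omega
    · rw [h3, if_neg (by omega), if_neg (by omega)]

theorem SeatsListed.next {I : Instance} {c : ℕ} {σ : State} (hc : c < I.numC)
    (h : SeatsListed I c (I.quota ⟨c, hc⟩) σ) : SeatsListed I (c + 1) 0 σ := by
  obtain ⟨h1, h2, h3⟩ := h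
  refine ⟨?_, h2, fun c' => ?_⟩
  · have : (Finset.univ.filter fun c' : Fin I.numC => (c' : ℕ) < c + 1) =
        insert ⟨c, hc⟩ (Finset.univ.filter fun c' : Fin I.numC => (c' : ℕ) < c) := by
      ext c'
      simp only [Finset.mem_filter, Finset.mem_univ, true_and, Finset.mem_insert, Fin.ext_iff]
      omega
    rw [this, Finset.sum_insert (by simp), h1]
    omega
  · rw [h3]
    by_cases hcc : (c' : ℕ) = c
    · have : c' = ⟨c, hc⟩ := Fin.ext hcc
      subst this
      simp
    · split_ifs <;> first | rfl | omega

theorem card_categories_le (I : Instance) :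
    I.numC ≤ I.seats + (Finset.univ.filter fun c => I.quota c = 0).card := by
  have h1 := Finset.card_filter_add_card_filter_not (s := (Finset.univ : Finset (Fin I.numC)))
    fun c => I.quota c = 0
  rw [Finset.card_univ, Fintype.card_fin] at h1
  have h2 : (Finset.univ.filter fun c => ¬ I.quota c = 0).card ≤ I.seats := by
    rw [Finset.card_filter]
    exact Finset.sum_le_sum fun c _ => by split_ifs <;> omega
  omega

/-- Listing the seats of one category. -/
def listSeatsBody : Stmt :=
  forTo .s (num 1) (getN .quota NVar.c) (
    NVar.numS ≔ₙ NVar.numS +ₙ num 1 ;;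
    putN1 .seat NVar.numS NVar.c) ;;
  NVar.c ≔ₙ NVar.c +ₙ num 1

theorem listSeats_spec {I : Instance} {σ : State} {c : ℕ} (hc : c < I.numC)
    (hq : σ.na .quota = I.init.na .quota) (hσ : σ.nv .c = c) (h : SeatsListed I c 0 σ) :
    Runs listSeatsBody σ (20 * I.quota ⟨c, hc⟩ + 20) (fun σ' =>
      σ'.nv .c = c + 1 ∧ SeatsListed I (c + 1) 0 σ') := by
  refine Runs.seq (T₂ := 4) (T₁ := 20 * I.quota ⟨c, hc⟩ + 10)
    (R := SeatsListed I c (I.quota ⟨c, hc⟩)) ?_ ?_ (by omega)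
  · refine Runs.forTo (T := 8) (L := 1) (H := I.quota ⟨c, hc⟩) (fun t σ' =>
      SeatsListed I c (t - 1) σ') rfl (by omega) rfl (fun σ' hK => ?_) (fun _ _ _ h => h) h ?_ ?_
      (fun _ _ h => h)
    · simp [NExp.eval, hK.nv .c rfl, hK.na .quota rfl, hσ, hq, Instance.init, hc]
    · intro t σ' ht htq hx hK hI
      obtain ⟨t, rfl⟩ : ∃ t', t = t' + 1 := ⟨t - 1, by omega⟩
      have hc' : σ'.nv .c = c := (hK.nv .c rfl).trans hσ
      refine Runs.of_loopFree rfl (by decide) (SeatsListed.succ hI hc ?_ ?_)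
      · simp [Stmt.run, NExp.eval]
      · intro j
        simp [Stmt.run, NExp.eval, updateArr, hc']
    · simp only [NExp.cost]; omega
  · intro σ₁ hK hI
    refine Runs.of_loopFree rfl (by decide) ⟨?_, hI.next hc⟩
    simp [Stmt.run, NExp.eval, hK.nv .c rfl, hσ]

/-- The seats are listed in time linear in the number of seats and the number of categories; the
categories without seats account for the number of quotas `0` in the bound. -/
theorem setup_spec (I : Instance) : Runs setupProg I.init
    (100 * (I.n + (Finset.univ.filter fun c => I.quota c = 0).card) + 100) (Loaded I) := by
  unfold setupProg
  have hseats : I.seats ≤ I.n := le_max_right _ _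
  have hcats := card_categories_le I
  refine Runs.step (T₂ := 25 * I.seats + 25 * I.numC + 60) rfl
    (Runs.step (T₂ := 25 * I.seats + 25 * I.numC + 50) rfl ?_ ?_) ?_
  rotate_left
  · have : (NVar.c ≔ₙ num 0).bound = 2 := rfl
    omega
  · have : (NVar.numS ≔ₙ num 0).bound = 2 := rfl
    omega
  refine Runs.seq (T₁ := 25 * I.seats + 25 * I.numC + 10) (R := fun σ => SeatsListed I I.numC 0 σ)
    (T₂ := 30) ?_ ?_ (by omega)
  -- the time for a category depends on its quota, so the potential is a sum over those remaining
  · let Φ (σ : State) : ℕ :=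
      ∑ c' ∈ Finset.univ.filter fun c' : Fin I.numC => σ.nv .c ≤ (c' : ℕ), (20 * I.quota c' + 25)
    refine (Runs.loop_potential (fun σ => σ.nv .c ≤ I.numC ∧ σ.nv .numC = I.numC ∧
      σ.na .quota = I.init.na .quota ∧ SeatsListed I (σ.nv .c) 0 σ) Φ ?_ _ _ ?_ le_rfl).mono ?_ ?_
    · rintro σ ⟨-, hC, hq, hI⟩ hc
      have hc : σ.nv .c < I.numC := by
        rw [← hC]
        exact of_decide_eq_true hc
      refine ⟨20 * I.quota ⟨_, hc⟩ + 20, (listSeats_spec hc hq rfl hI).mono le_rfl ?_⟩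
      rintro σ' hK ⟨hc', hI'⟩
      refine ⟨⟨by omega, (hK.nv .numC rfl).trans hC, (hK.na .quota rfl).trans hq,
        by rw [hc']; exact hI'⟩, ?_⟩
      have : (Finset.univ.filter fun c' : Fin I.numC => σ.nv .c ≤ (c' : ℕ)) =
          insert ⟨_, hc⟩ (Finset.univ.filter fun c' : Fin I.numC => σ'.nv .c ≤ (c' : ℕ)) := by
        ext c'
        simp only [Finset.mem_filter, Finset.mem_univ, true_and, Finset.mem_insert, Fin.ext_iff]
        omega
      simp only [Φ]
      rw [this, Finset.sum_insert (by simp [hc'])]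
      simp only [BExp.cost, NExp.cost]
      omega
    · refine ⟨by simp [Stmt.run, NExp.eval], rfl, rfl, ?_⟩
      refine ⟨?_, ?_, fun c' => ?_⟩ <;> simp [Stmt.run, NExp.eval]
    · have : Φ ((NVar.c ≔ₙ num 0).run ((NVar.numS ≔ₙ num 0).run I.init)) =
          20 * I.seats + 25 * I.numC := by
        simp [Φ, Stmt.run, NExp.eval, Finset.sum_add_distrib, ← Finset.mul_sum, Instance.seats,
          mul_comm]
      rw [this]
      simp only [BExp.cost, NExp.cost]
      omega
    · rintro σ - ⟨⟨h1, h2, -, h3⟩, hc⟩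
      have hc := of_decide_eq_false hc
      simp only [NExp.eval, h2] at hc
      rwa [show σ.nv .c = I.numC by omega] at h3
  · rintro σ hK ⟨h1, h2, h3⟩
    have hS : σ.nv .numS = I.seats := by
      rw [h1]
      simp [Instance.seats]
    have hP : σ.nv .numP = I.numP := hK.nv .numP rfl
    have he : σ.na .elig = I.init.na .elig := hK.na .elig rfl
    have hb : σ.na .bene = I.init.na .bene := hK.na .bene rfl
    rw [hS] at h2 h3
    have h3' : ∀ c : Fin I.numC,
        ((Finset.range I.seats).filter fun j => σ.na .seat (j + 1) 0 = c).card = I.quota c :=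
      fun c => by rw [h3, if_pos c.2]
    refine Runs.of_loopFree rfl (by decide) ?_
    have hn : I.n = if I.seats ≤ I.numP then I.numP else I.seats := by
      unfold Instance.n
      split_ifs <;> omega
    simp only [Stmt.run, BExp.nle_iff, NExp.eval, hS, hP]
    split_ifs with hle
    · exact ⟨by simp [hP], by simp [hS], by simp [hn, hle], he, hb, h2, h3'⟩
    · exact ⟨by simp [hP], by simp [hS], by simp [hn, hle], he, hb, h2, h3'⟩

/-- The weight of the pair of the row `i` and the column `j`, from the tables of the state `σ`. -/
def weightAt (σ : State) (i j : ℕ) : ℚ :=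
  if i ≤ σ.nv .numP ∧ j ≤ σ.nv .numS then
    if σ.na .bene (i - 1) (σ.na .seat j 0) = 1 then σ.qv .wBene
    else if σ.na .elig (i - 1) (σ.na .seat j 0) = 1 then σ.qv .wElig else 0
  else 0

/-- Setting one weight. -/
def weightBody : Stmt :=
  .putQ .w NVar.i NVar.j (rat 0) ;;
  ifThen (.and (NVar.i ≤ₙ NVar.numP) (NVar.j ≤ₙ NVar.numS)) (
    .ite (.get .bene (NVar.i -ₙ num 1) (getN .seat NVar.j) =ₙ num 1)
      (.putQ .w NVar.i NVar.j QVar.wBene)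
      (ifThen (.get .elig (NVar.i -ₙ num 1) (getN .seat NVar.j) =ₙ num 1)
        (.putQ .w NVar.i NVar.j QVar.wElig)))

theorem weightAt_keeps {s : Stmt} {σ σ' : State} (h : Keeps s σ σ')
    (h1 : s.writes (.nv .numP) = false) (h2 : s.writes (.nv .numS) = false)
    (h3 : s.writes (.na .elig) = false) (h4 : s.writes (.na .bene) = false)
    (h5 : s.writes (.na .seat) = false) (h6 : s.writes (.qv .wElig) = false)
    (h7 : s.writes (.qv .wBene) = false) : weightAt σ' = weightAt σ := by
  funext i j
  simp only [weightAt, h.nv _ h1, h.nv _ h2, h.na _ h3, h.na _ h4, h.na _ h5, h.qv _ h6, h.qv _ h7]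

theorem weightBody_run (σ : State) (i j : ℕ) : (weightBody.run σ).qa .w i j =
    if i = σ.nv .i ∧ j = σ.nv .j then weightAt σ i j else σ.qa .w i j := by
  by_cases hij : i = σ.nv .i ∧ j = σ.nv .j
  · rw [if_pos hij]
    obtain ⟨rfl, rfl⟩ := hij
    simp only [weightBody, Stmt.run, BExp.and_iff, BExp.nle_iff, BExp.neq_iff, NExp.eval,
      QExp.eval, weightAt]
    split_ifs <;> simp_all [updateArr]
  · rw [if_neg hij]
    simp only [weightBody, Stmt.run, BExp.and_iff, BExp.nle_iff, BExp.neq_iff, NExp.eval,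
      QExp.eval]
    split_ifs <;> simp [updateArr, hij]

theorem weights_spec {σ : State} {n : ℕ} (hn : σ.nv .n = n) :
    Runs weightsProg σ (120 * (n + 1) ^ 2) (fun σ' =>
      (∀ i j, 1 ≤ i → i ≤ n → 1 ≤ j → j ≤ n → σ'.qa .w i j = weightAt σ' i j) ∧
      σ'.qv .wElig = 1 ∧ σ'.qv .wBene = 1 + 1 / (σ.nv .k : ℚ) + 1 / ((n : ℚ) * n)) := by
  have hn2 : (n + 1) ^ 2 = n ^ 2 + 2 * n + 1 := by ring
  refine Runs.step (T₂ := 80 * (n + 1) ^ 2 + 20) rfl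
    (Runs.step (T₂ := 80 * (n + 1) ^ 2) rfl ?_ ?_) ?_
  rotate_left
  · have : (QVar.wBene ≔ᵣ rat 1 +ᵣ rat 1 /ᵣ toQ NVar.k +ᵣ
      rat 1 /ᵣ (toQ NVar.n *ᵣ toQ NVar.n)).bound = 18 := rfl
    nlinarith
  · have : (QVar.wElig ≔ᵣ rat 1).bound = 3 := rfl
    nlinarith
  refine Runs.forTo (T := 70 * n + 10) (L := 1) (H := n) (fun m σ' =>
    (∀ i j, 1 ≤ i → i < m → 1 ≤ j → j ≤ n → σ'.qa .w i j = weightAt σ' i j) ∧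
      σ'.qv .wElig = 1 ∧ σ'.qv .wBene = 1 + 1 / (σ.nv .k : ℚ) + 1 / ((n : ℚ) * n))
    rfl (by omega) rfl (fun σ' hK => (hK.nv .n rfl).trans hn) (fun _ _ _ h => h) ⟨by omega, ?_, ?_⟩
    ?_ ?_ (fun σ' _ ⟨h1, h2⟩ => ⟨fun i j hi hin => h1 i j hi (by omega), h2⟩)
  · simp [Stmt.run, QExp.eval, NExp.eval]
  · simp [Stmt.run, QExp.eval, NExp.eval, hn]
  · intro m σ' hm hmn hx hK ⟨h1, h2, h3⟩
    refine Runs.forTo (T := 60) (L := 1) (H := n) (fun m' σ'' =>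
      (∀ i j, 1 ≤ i → i < m → 1 ≤ j → j ≤ n → σ''.qa .w i j = weightAt σ'' i j) ∧
      (∀ j, 1 ≤ j → j < m' → σ''.qa .w m j = weightAt σ'' m j)) (s := weightBody)
      rfl (by omega) rfl (fun σ'' hK' => (hK'.nv .n rfl).trans ((hK.nv .n rfl).trans hn))
      (fun _ _ _ h => h) ⟨h1, by omega⟩
      ?_ ?_ ?_
    · intro j σ'' hj hjn hx' hK' ⟨h4, h5⟩
      have hi : σ''.nv .i = m := (hK'.nv .i rfl).trans hx
      obtain ⟨_, -, e⟩ := weightBody.exec_run rfl σ''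
      refine Runs.of_loopFree rfl (by decide) ?_
      rw [weightAt_keeps e.keeps rfl rfl rfl rfl rfl rfl rfl]
      refine ⟨fun i j' hi1 him hj1 hjn' => ?_, fun j' hj1 hjj => ?_⟩
      · rw [weightBody_run, if_neg (by omega)]
        exact h4 i j' hi1 him hj1 hjn'
      · rw [weightBody_run]
        split_ifs with hc
        · rfl
        · exact h5 j' hj1 (by omega)
    · simp only [NExp.cost]; omega
    · intro σ'' hK' ⟨h4, h5⟩
      refine ⟨fun i j hi hin hj hjn => ?_, (hK'.qv .wElig rfl).trans h2,
        (hK'.qv .wBene rfl).trans h3⟩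
      rcases Nat.lt_or_ge i m with h | h
      · exact h4 i j hi h hj hjn
      · obtain rfl : i = m := by omega
        exact h5 j hj (by omega)
  · simp only [NExp.cost]
    rw [hn2, Nat.add_sub_cancel]
    nlinarith

/-- The match of the seat `j` (counted from `0`) appears in the table `t`. -/
def Counted (σ : State) (t : NArr) (j : ℕ) : Prop :=
  σ.na .mate (j + 1) 0 ≤ σ.nv .numP ∧
    σ.na t (σ.na .mate (j + 1) 0 - 1) (σ.na .seat (j + 1) 0) = 1

instance (σ : State) (t : NArr) : DecidablePred (Counted σ t) := fun _ => by
  unfold Counted; infer_instance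

/-- Counting one match. -/
def countBody : Stmt :=
  NVar.i ≔ₙ getN .mate NVar.j ;;
  ifThen (NVar.i ≤ₙ NVar.numP) (
    ifThen (.get .elig (NVar.i -ₙ num 1) (getN .seat NVar.j) =ₙ num 1)
      (NVar.e ≔ₙ NVar.e +ₙ num 1) ;;
    ifThen (.get .bene (NVar.i -ₙ num 1) (getN .seat NVar.j) =ₙ num 1)
      (NVar.b ≔ₙ NVar.b +ₙ num 1))

theorem count_spec (σ : State) : Runs countProg σ (60 * σ.nv .numS + 20) (fun σ' =>
    σ'.nv .e = ((Finset.range (σ.nv .numS)).filter (Counted σ .elig)).card ∧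
    σ'.nv .b = ((Finset.range (σ.nv .numS)).filter (Counted σ .bene)).card) := by
  refine Runs.step (T₂ := 60 * σ.nv .numS + 15) rfl
    (Runs.step (T₂ := 60 * σ.nv .numS + 10) rfl ?_ ?_) ?_
  rotate_left
  · have : (NVar.b ≔ₙ num 0).bound = 2 := rfl
    omega
  · have : (NVar.e ≔ₙ num 0).bound = 2 := rfl
    omega
  refine Runs.forTo (T := 50) (L := 1) (H := σ.nv .numS) (fun j σ' =>
    σ'.nv .e = ((Finset.range (j - 1)).filter (Counted σ .elig)).card ∧
    σ'.nv .b = ((Finset.range (j - 1)).filter (Counted σ .bene)).card) (s := countBody)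
    rfl (by omega) rfl (fun σ' hK => hK.nv .numS rfl) (fun _ _ _ h => h) ?_ ?_ ?_ (fun _ _ h => h)
  · constructor <;> simp [Stmt.run, NExp.eval]
  · intro j σ' hj hjn hx hK ⟨h1, h2⟩
    obtain ⟨j, rfl⟩ : ∃ j', j = j' + 1 := ⟨j - 1, by omega⟩
    have hP : σ'.nv .numP = σ.nv .numP := hK.nv .numP rfl
    have hm : σ'.na .mate = σ.na .mate := hK.na .mate rfl
    have he : σ'.na .elig = σ.na .elig := hK.na .elig rfl
    have hb : σ'.na .bene = σ.na .bene := hK.na .bene rfl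
    have hs : σ'.na .seat = σ.na .seat := hK.na .seat rfl
    rw [Nat.add_sub_cancel] at h1 h2
    refine Runs.of_loopFree rfl (by decide) ?_
    have key : ∀ t, ((Finset.range (j + 1)).filter (Counted σ t)).card =
        ((Finset.range j).filter (Counted σ t)).card + if σ.na .mate (j + 1) 0 ≤ σ.nv .numP ∧
          σ.na t (σ.na .mate (j + 1) 0 - 1) (σ.na .seat (j + 1) 0) = 1 then 1 else 0 := by
      intro t
      rw [Finset.range_add_one, Finset.filter_insert]
      by_cases h : Counted σ t j
      · rw [if_pos (show _ ∧ _ from h)]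
        simp [h]
      · rw [if_neg (show ¬ (_ ∧ _) from h)]
        simp [h]
    rw [Nat.add_sub_cancel, key, key, ← h1, ← h2]
    simp only [countBody, Stmt.run, BExp.nle_iff, BExp.neq_iff, NExp.eval]
    constructor <;> split_ifs <;> simp_all
  · simp only [NExp.cost]; omega

/-! ### The matching found has maximum weight -/

theorem PartialMate.ne_zero {n : ℕ} {mate : ℕ → ℕ} (h : PartialMate n n mate) {j : ℕ} (hj : 1 ≤ j)
    (hjn : j ≤ n) : mate j ≠ 0 := by
  intro h0
  have : (Finset.Icc 1 n).card ≤ ((Finset.Icc 1 n).erase j).card := by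
    refine Finset.card_le_card_of_surjOn mate fun i hi => ?_
    rw [Finset.coe_Icc, Set.mem_Icc] at hi
    obtain ⟨j', h1, h2, rfl⟩ := h.surj i hi.1 hi.2
    refine ⟨j', ?_, rfl⟩
    simp only [Finset.coe_erase, Finset.coe_Icc, Set.mem_sdiff, Set.mem_Icc, Set.mem_singleton_iff]
    refine ⟨⟨h1, h2⟩, ?_⟩
    rintro rfl
    omega
  rw [Finset.card_erase_of_mem (Finset.mem_Icc.2 ⟨hj, hjn⟩), Nat.card_Icc] at this
  omega

theorem PartialMate.sum_comp {n : ℕ} {mate : ℕ → ℕ} (h : PartialMate n n mate) (u : ℕ → ℚ) :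
    ∑ j : Fin n, u (mate (j + 1)) = ∑ i : Fin n, u (i + 1) := by
  have hlt : ∀ j : Fin n, mate (j + 1) - 1 < n := fun j => by
    have := h.le (j + 1) (by omega) (by omega)
    have := j.2
    omega
  have hz : ∀ j : Fin n, mate (j + 1) ≠ 0 := fun j => h.ne_zero (by omega) (by omega)
  let g : Fin n → Fin n := fun j => ⟨mate (j + 1) - 1, hlt j⟩
  have hg : Function.Injective g := fun j j' he => by
    have he : mate (j + 1) - 1 = mate (j' + 1) - 1 := congrArg Fin.val he
    have h1 := hz j
    have h2 := hz j'
    have := h.inj (j + 1) (j' + 1) (by omega) (by omega) (by omega) (by omega) (hz j) (by omega)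
    exact Fin.ext (by omega)
  rw [← (Finite.injective_iff_bijective.1 hg).sum_comp fun i : Fin n => u (i + 1)]
  refine Finset.sum_congr rfl fun j _ => ?_
  congr 1
  have := hz j
  simp only [g]
  omega

/-- Weak duality: a perfect matching which is tight for feasible dual variables has at least the
weight of every permutation. -/
theorem Dual.sum_le {n : ℕ} {w : ℕ → ℕ → ℚ} {u v : ℕ → ℚ} {mate : ℕ → ℕ}
    (hd : Dual n n w u v mate) (h : PartialMate n n mate) (π : Equiv.Perm (Fin n)) :
    ∑ i : Fin n, w (i + 1) (π i + 1) ≤ ∑ j : Fin n, w (mate (j + 1)) (j + 1) := by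
  calc ∑ i : Fin n, w (i + 1) (π i + 1) ≤ ∑ i : Fin n, (u (i + 1) + v (π i + 1)) :=
        Finset.sum_le_sum fun i _ => hd.feas _ _ (by omega) (by omega) (by omega) (by omega)
    _ = ∑ j : Fin n, (u (mate (j + 1)) + v (j + 1)) := by
        rw [Finset.sum_add_distrib, Finset.sum_add_distrib, h.sum_comp,
          Equiv.sum_comp π fun j : Fin n => v (j + 1)]
    _ = _ := Finset.sum_congr rfl fun j _ =>
        hd.tight _ (by omega) (by omega) (h.ne_zero (by omega) (by omega))

/-- A partial injection extends to a permutation. -/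
theorem exists_perm_extending {a b n : ℕ} (ha : a ≤ n) (hb : b ≤ n) (f : Fin a → Option (Fin b))
    (hf : ∀ p p' s, f p = some s → f p' = some s → p = p') :
    ∃ π : Equiv.Perm (Fin n), ∀ p s, f p = some s → π (p.castLE ha) = s.castLE hb := by
  rcases Nat.eq_zero_or_pos n with rfl | hn
  · exact ⟨Equiv.refl _, fun p => (p.castLE ha).elim0⟩
  let F : Fin n → Fin n := fun i =>
    if h : (i : ℕ) < a then (f ⟨i, h⟩).elim ⟨0, hn⟩ (Fin.castLE hb) else ⟨0, hn⟩
  let s : Finset (Fin n) := Finset.univ.filter fun i => ∃ h : (i : ℕ) < a, (f ⟨i, h⟩).isSome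
  obtain ⟨g, hg⟩ := Finset.exists_equiv_extend_of_card_eq (t := Finset.univ) (s := s) (f := F)
    (by simp) (Finset.subset_univ _) (by
      intro i hi i' hi' he
      simp only [s, Finset.coe_filter, Finset.mem_univ, true_and, Set.mem_ofPred_eq] at hi hi'
      obtain ⟨h1, h2⟩ := hi
      obtain ⟨h1', h2'⟩ := hi'
      obtain ⟨x, hx⟩ := Option.isSome_iff_exists.1 h2
      obtain ⟨x', hx'⟩ := Option.isSome_iff_exists.1 h2'
      simp only [F, h1, h1', dif_pos, hx, hx', Option.elim_some] at he
      obtain rfl : x = x' := Fin.castLE_injective hb he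
      have := hf _ _ _ hx hx'
      exact Fin.ext (Fin.mk.inj_iff.1 this))
  refine ⟨g.trans (Equiv.subtypeUnivEquiv fun _ => Finset.mem_univ _), fun p x hx => ?_⟩
  have := hg (p.castLE ha) (by simp [s, hx])
  refine Eq.trans this ?_
  simp [F, hx]

/-- The matching read off from a dual optimum has maximum weight, and its point is counted
correctly. -/
theorem exists_isMaxWeight {I : Instance} {σ : State} {k : ℕ} (hL : Loaded I σ)
    (hw : ∀ i j, 1 ≤ i → i ≤ I.n → 1 ≤ j → j ≤ I.n → σ.qa .w i j = weightAt σ i j)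
    (hwE : σ.qv .wElig = 1) (hwB : σ.qv .wBene = I.wBene k) (h : MatchedAt I.n I.n σ) :
    ∃ μ : Matching I, μ.IsMaxWeight k ∧
      μ.E.card = ((Finset.range I.seats).filter (Counted σ .elig)).card ∧
      μ.B.card = ((Finset.range I.seats).filter (Counted σ .bene)).card := by
  obtain ⟨hp, hd⟩ := h
  have hPn : I.numP ≤ I.n := le_max_left _ _
  have hSn : I.seats ≤ I.n := le_max_right _ _
  have hwB0 : 0 ≤ I.wBene k := by unfold Instance.wBene; positivity
  let cat : Fin I.seats → Fin I.numC := fun s => ⟨σ.na .seat (s + 1) 0, hL.seat_lt s s.2⟩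
  have hcat : ∀ c, (Finset.univ.filter fun s => cat s = c).card = I.quota c := by
    intro c
    rw [← hL.card_seat c, Finset.card_filter, Finset.card_filter,
      ← Fin.sum_univ_eq_sum_range (fun j => if σ.na .seat (j + 1) 0 = c then 1 else 0)]
    simp [cat, Fin.ext_iff]
  have helig : ∀ (p : Fin I.numP) (s : Fin I.seats),
      σ.na .elig p (σ.na .seat (s + 1) 0) = 1 ↔ p ∈ I.elig (cat s) := by
    intro p s
    have := hL.seat_lt s s.2
    simp [hL.elig, Instance.init, cat, this]
  have hbene : ∀ (p : Fin I.numP) (s : Fin I.seats),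
      σ.na .bene p (σ.na .seat (s + 1) 0) = 1 ↔ p ∈ I.bene (cat s) := by
    intro p s
    have := hL.seat_lt s s.2
    simp [hL.bene, Instance.init, cat, this]
  have hf : ∀ p : Fin I.numP, ∃ o : Option (Fin I.seats), ∀ s : Fin I.seats,
      o = some s ↔ σ.na .mate (s + 1) 0 = p + 1 ∧ p ∈ I.elig (cat s) := by
    intro p
    by_cases hs : ∃ s : Fin I.seats, σ.na .mate (s + 1) 0 = p + 1 ∧ p ∈ I.elig (cat s)
    · obtain ⟨s, hs, hs'⟩ := hs
      refine ⟨some s, fun s' => ⟨?_, fun ⟨h1, _⟩ => ?_⟩⟩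
      · rintro ⟨⟩
        exact ⟨hs, hs'⟩
      · have := hp.inj (s + 1) (s' + 1) (by omega) (by omega) (by omega) (by omega)
          (by omega) (by omega)
        exact congrArg some (Fin.ext (by omega))
    · push Not at hs
      exact ⟨none, fun s => ⟨fun h => by simp at h, fun ⟨h1, h2⟩ => absurd h2 (hs s h1)⟩⟩
  choose f hf using hf
  let μ : Matching I := Matching.ofSeats hcat f
    (fun p p' s h h' => by
      have h1 := ((hf p s).1 h).1
      have h2 := ((hf p' s).1 h').1
      exact Fin.ext (by omega))
    (fun p s h => ((hf p s).1 h).2)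
  have hassign : ∀ p, (f p).map cat = μ.assign p := fun _ => rfl
  -- matched patients and counted seats correspond to each other
  have hcount : ∀ (t : NArr) (Q : Fin I.numC → Finset (Fin I.numP)), (∀ c, Q c ⊆ I.elig c) →
      (∀ (p : Fin I.numP) (s : Fin I.seats),
        σ.na t p (σ.na .seat (s + 1) 0) = 1 ↔ p ∈ Q (cat s)) →
      (Finset.univ.filter fun p => ∃ c, μ.assign p = some c ∧ p ∈ Q c).card =
        ((Finset.range I.seats).filter (Counted σ t)).card := by
    intro t Q hQ ht
    have hC : ∀ j, j ∈ (Finset.range I.seats).filter (Counted σ t) →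
        ∃ (s : Fin I.seats) (p : Fin I.numP), (s : ℕ) = j ∧ σ.na .mate (j + 1) 0 = p + 1 ∧
          p ∈ Q (cat s) := by
      intro j hj
      obtain ⟨hj, hj1, hj2⟩ := Finset.mem_filter.1 hj
      rw [Finset.mem_range] at hj
      have hz : σ.na .mate (j + 1) 0 ≠ 0 := hp.ne_zero (by omega) (by omega)
      rw [hL.numP] at hj1
      exact ⟨⟨j, hj⟩, ⟨σ.na .mate (j + 1) 0 - 1, by omega⟩, rfl, by simp only; omega,
        (ht ⟨_, by omega⟩ ⟨j, hj⟩).1 hj2⟩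
    symm
    refine Finset.card_bij (fun j hj => (hC j hj).choose_spec.choose) ?_ ?_ ?_
    · intro j hj
      obtain ⟨h1, h2, h3⟩ := (hC j hj).choose_spec.choose_spec
      refine Finset.mem_filter.2 ⟨Finset.mem_univ _, cat (hC j hj).choose, ?_, h3⟩
      rw [← hassign, (hf _ (hC j hj).choose).2
        ⟨(congrArg (fun x => σ.na .mate (x + 1) 0) h1).trans h2, hQ _ h3⟩]
      rfl
    · intro j hj j' hj' he
      obtain ⟨h1, h2, -⟩ := (hC j hj).choose_spec.choose_spec
      obtain ⟨h1', h2', -⟩ := (hC j' hj').choose_spec.choose_spec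
      rw [Finset.mem_filter, Finset.mem_range] at hj hj'
      rw [he, ← h2'] at h2
      have := hp.inj (j + 1) (j' + 1) (by omega) (by omega) (by omega) (by omega)
        (hp.ne_zero (by omega) (by omega)) h2
      omega
    · intro p hpm
      obtain ⟨-, c, hc, hpc⟩ := Finset.mem_filter.1 hpm
      rw [← hassign] at hc
      obtain ⟨s, hs, rfl⟩ := Option.map_eq_some_iff.1 hc
      obtain ⟨h1, -⟩ := (hf p s).1 hs
      have hj : (s : ℕ) ∈ (Finset.range I.seats).filter (Counted σ t) := by
        refine Finset.mem_filter.2 ⟨Finset.mem_range.2 s.2, ?_, ?_⟩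
        · rw [h1, hL.numP]
          omega
        · rw [h1, Nat.add_sub_cancel]
          exact (ht p s).2 hpc
      refine ⟨s, hj, ?_⟩
      obtain ⟨-, h2, -⟩ := (hC s hj).choose_spec.choose_spec
      exact Fin.ext (by omega)
  have hE : μ.E.card = ((Finset.range I.seats).filter (Counted σ .elig)).card := by
    rw [← hcount .elig I.elig (fun _ => subset_rfl) helig, μ.card_E]
    congr 1
    refine Finset.filter_congr fun p _ => ?_
    rw [Option.isSome_iff_exists]
    exact exists_congr fun c => ⟨fun h => ⟨h, μ.eligible p c h⟩, fun h => h.1⟩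
  have hB : μ.B.card = ((Finset.range I.seats).filter (Counted σ .bene)).card := by
    rw [← hcount .bene I.bene I.bene_subset hbene, μ.card_B]
  refine ⟨μ, fun μ' => ?_, hE, hB⟩
  have hw0 : ∀ i j : Fin I.n, 0 ≤ σ.qa .w (i + 1) (j + 1) := by
    intro i j
    rw [hw _ _ (by omega) (by omega) (by omega) (by omega), weightAt, hwE, hwB]
    split_ifs <;> simp [hwB0]
  -- the weight of the perfect matching is the weight of `μ`
  have hμ : ∑ j : Fin I.n, σ.qa .w (σ.na .mate (j + 1) 0) (j + 1) = μ.weight k := by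
    have hterm : ∀ j : Fin I.n, σ.qa .w (σ.na .mate (j + 1) 0) (j + 1) =
        (if (j : ℕ) ∈ (Finset.range I.seats).filter (Counted σ .elig) then 1 else 0) +
          (I.wBene k - 1) *
            (if (j : ℕ) ∈ (Finset.range I.seats).filter (Counted σ .bene) then 1 else 0) := by
      intro j
      have hz : σ.na .mate (j + 1) 0 ≠ 0 := hp.ne_zero (by omega) (by omega)
      rw [hw _ _ (by omega) (hp.le _ (by omega) (by omega)) (by omega) (by omega), weightAt, hwE,
        hwB, hL.numP, hL.numS]
      simp only [Finset.mem_filter, Finset.mem_range, Counted, hL.numP]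
      by_cases h1 : σ.na .mate (j + 1) 0 ≤ I.numP
      · by_cases h2 : (j : ℕ) < I.seats
        · have he := helig ⟨σ.na .mate (j + 1) 0 - 1, by omega⟩ ⟨j, h2⟩
          have hb := hbene ⟨σ.na .mate (j + 1) 0 - 1, by omega⟩ ⟨j, h2⟩
          have hbe := fun h => he.2 (I.bene_subset _ (hb.1 h))
          simp only at hbe
          rw [if_pos ⟨h1, by omega⟩]
          by_cases h3 : σ.na .bene (σ.na .mate (j + 1) 0 - 1) (σ.na .seat (j + 1) 0) = 1
          · simp [h1, h2, h3, hbe h3]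
          · simp [h1, h2, h3]
        · simp [h2]
      · simp [h1]
    rw [μ.weight_eq, hE, hB, Finset.sum_congr rfl fun j _ => hterm j, Finset.sum_add_distrib,
      ← Finset.mul_sum]
    have hsum : ∀ t : NArr, ∑ j : Fin I.n,
        (if (j : ℕ) ∈ (Finset.range I.seats).filter (Counted σ t) then (1 : ℚ) else 0) =
          ((Finset.range I.seats).filter (Counted σ t)).card := by
      intro t
      rw [Fin.sum_univ_eq_sum_range
        (fun j => if j ∈ (Finset.range I.seats).filter (Counted σ t) then (1 : ℚ) else 0),
        Finset.sum_ite_mem, Finset.inter_eq_right.2 ((Finset.filter_subset _ _).trans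
          (Finset.range_subset_range.2 hSn))]
      simp
    rw [hsum, hsum, Instance.wBene]
    ring
  -- every matching can be completed to a permutation of at least the same weight
  obtain ⟨g, hg, hgi⟩ := μ'.exists_seats hcat
  obtain ⟨π, hπ⟩ := exists_perm_extending hPn hSn g hgi
  rw [← hμ]
  refine le_trans ?_ (hd.sum_le hp π)
  have hμ' : μ'.weight k = ∑ p, (g p).elim 0 fun s =>
      if p ∈ I.bene (cat s) then I.wBene k else 1 := by
    rw [μ'.weight_eq, ← μ'.sum_matched hg, ← μ'.sum_bene hg, Finset.mul_sum,
      ← Finset.sum_add_distrib]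
    refine Finset.sum_congr rfl fun p _ => ?_
    cases g p with
    | none => simp
    | some s =>
      simp only [Option.elim_some, Instance.wBene]
      split_ifs <;> ring
  calc μ'.weight k = ∑ p, (g p).elim 0 fun s =>
        if p ∈ I.bene (cat s) then I.wBene k else 1 := hμ'
    _ ≤ ∑ p : Fin I.numP, σ.qa .w (p.castLE hPn + 1) (π (p.castLE hPn) + 1) := by
        refine Finset.sum_le_sum fun p _ => ?_
        cases hgp : g p with
        | none => exact hw0 _ _
        | some s =>
          have hel : p ∈ I.elig (cat s) := μ'.eligible p _ (by rw [← hg, hgp]; rfl)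
          rw [hπ p s hgp, hw _ _ (by omega) (by omega) (by omega) (by omega), weightAt, hwE, hwB,
            hL.numP, hL.numS]
          simp only [Fin.val_castLE, Nat.add_sub_cancel, helig, hbene, hel, if_true,
            Option.elim_some]
          rw [if_pos (show (p : ℕ) + 1 ≤ I.numP ∧ (s : ℕ) + 1 ≤ I.seats by omega)]
    _ = ∑ i ∈ Finset.univ.map (Fin.castLEEmb hPn), σ.qa .w (i + 1) (π i + 1) := by
        rw [Finset.sum_map]
        rfl
    _ ≤ _ := Finset.sum_le_sum_of_subset_of_nonneg (Finset.subset_univ _) fun i _ _ => hw0 _ _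

/-! ### The two loops -/

/-- Hence there are at most as many kinks as iterations, and every kink is the point of a matching. -/
theorem sublist_kinks (pts : List (ℕ × ℕ)) : (kinks pts).Sublist pts := by
  have : ∀ A : List (ℕ × ℕ), (pts.foldl addKink A).Sublist (A ++ pts) := by
    induction pts with
    | nil => simp
    | cons x pts ih =>
      intro A
      refine (ih _).trans ?_
      rw [addKink]
      split_ifs
      · exact (List.sublist_cons_self x pts).append_left A
      · simp
  exact this []

/-- The variable `m`, the arrays `kinkE`, `kinkB` and the output tape represent the list `K`. -/
structure KinksHeld (K : List (ℕ × ℕ)) (σ : State) : Prop where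
  m : σ.nv .m = K.length
  kinkE : ∀ i x, K[i]? = some x → σ.na .kinkE (i + 1) 0 = x.1
  kinkB : ∀ i x, K[i]? = some x → σ.na .kinkB (i + 1) 0 = x.2
  out : σ.out = K.map fun x => ((x.1 : ℚ), (x.2 : ℚ))

theorem KinksHeld.keeps {K : List (ℕ × ℕ)} {s : Stmt} {σ σ' : State} (h : KinksHeld K σ)
    (hK : Keeps s σ σ') (h1 : s.writes (.nv .m) = false) (h2 : s.writes (.na .kinkE) = false)
    (h3 : s.writes (.na .kinkB) = false) (h4 : s.writes .out = false) : KinksHeld K σ' :=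
  ⟨(hK.nv _ h1).trans h.m, fun i x hx => by rw [hK.na _ h2]; exact h.kinkE i x hx,
    fun i x hx => by rw [hK.na _ h3]; exact h.kinkB i x hx, (hK.out h4).trans h.out⟩

theorem kink_spec {K : List (ℕ × ℕ)} {σ : State} (h : KinksHeld K σ) :
    Runs kinkProg σ 40 (KinksHeld (addKink K (σ.nv .e, σ.nv .b))) := by
  refine Runs.of_loopFree rfl (by decide) ?_
  have hc : (BExp.or (NVar.m =ₙ num 0)
      (.not (.and (NVar.e =ₙ getN .kinkE NVar.m) (NVar.b =ₙ getN .kinkB NVar.m)))).eval σ = true ↔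
      K.getLast? ≠ some (σ.nv .e, σ.nv .b) := by
    simp only [BExp.or_iff, BExp.not_iff, BExp.and_iff, BExp.neq_iff, NExp.eval, h.m]
    rcases List.eq_nil_or_concat K with rfl | ⟨K, x, rfl⟩
    · simp
    · have h1 := h.kinkE K.length x (by simp)
      have h2 := h.kinkB K.length x (by simp)
      simp [h1, h2, Prod.ext_iff, eq_comm]
  rw [kinkProg, Stmt.run, addKink]
  by_cases hl : K.getLast? = some (σ.nv .e, σ.nv .b)
  · rw [if_neg (fun h => hc.1 h hl), if_pos hl]
    exact h
  · rw [if_pos (hc.2 hl), if_neg hl]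
    have hget : ∀ i x, (K ++ [(σ.nv .e, σ.nv .b)])[i]? = some x →
        i = K.length ∧ (σ.nv .e, σ.nv .b) = x ∨ i ≠ K.length ∧ K[i]? = some x := by
      intro i x hx
      rcases lt_trichotomy i K.length with hi | rfl | hi
      · exact .inr ⟨hi.ne, by rwa [List.getElem?_append_left hi] at hx⟩
      · exact .inl ⟨rfl, by simpa using hx⟩
      · rw [List.getElem?_eq_none (by simp; omega)] at hx
        simp at hx
    refine ⟨by simp [Stmt.run, NExp.eval, h.m], fun i x hx => ?_, fun i x hx => ?_, ?_⟩
    · rcases hget i x hx with ⟨rfl, rfl⟩ | ⟨hi, hx⟩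
      · simp [Stmt.run, NExp.eval, updateArr, h.m]
      · simp [Stmt.run, NExp.eval, updateArr, h.m, hi, h.kinkE i x hx]
    · rcases hget i x hx with ⟨rfl, rfl⟩ | ⟨hi, hx⟩
      · simp [Stmt.run, NExp.eval, updateArr, h.m]
      · simp [Stmt.run, NExp.eval, updateArr, h.m, hi, h.kinkB i x hx]
    · simp [Stmt.run, NExp.eval, QExp.eval, h.out]

/-- One iteration of the first loop. -/
theorem iteration_spec {I : Instance} {σ : State} {K : List (ℕ × ℕ)} (hL : Loaded I σ)
    (hK : KinksHeld K σ) :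
    Runs (weightsProg ;; hungarianProg ;; countProg ;; kinkProg) σ (1100 * (I.n + 1) ^ 3)
      (fun σ' => Loaded I σ' ∧ ∃ μ : Matching I, μ.IsMaxWeight (σ.nv .k) ∧
        KinksHeld (addKink K μ.point) σ') := by
  have hp : 1 ≤ I.n + 1 := by omega
  have h2 : (I.n + 1) ^ 2 ≤ (I.n + 1) ^ 3 := Nat.pow_le_pow_right hp (by omega)
  have h1 : I.n + 1 ≤ (I.n + 1) ^ 3 := Nat.le_self_pow (by omega) _
  have hS : I.seats ≤ I.n := le_max_right _ _
  refine Runs.seq (weights_spec hL.n) (T₂ := 960 * (I.n + 1) ^ 3) ?_ (by omega)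
  rintro σ₁ hK₁ ⟨hw, hwE, hwB⟩
  have hL₁ := hL.keeps hK₁ rfl rfl rfl rfl rfl rfl
  have hH₁ := hK.keeps hK₁ rfl rfl rfl rfl
  refine Runs.seq (hungarian_spec hL₁.n) (T₂ := 120 * (I.n + 1) ^ 3) ?_ (by omega)
  intro σ₂ hK₂ hM
  have hL₂ := hL₁.keeps hK₂ rfl rfl rfl rfl rfl rfl
  have hH₂ := hH₁.keeps hK₂ rfl rfl rfl rfl
  obtain ⟨μ, hμ, hE, hB⟩ := exists_isMaxWeight (k := σ.nv .k) hL₂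
    (fun i j hi hi' hj hj' => by
      rw [hK₂.qa .w rfl, hw i j hi hi' hj hj', weightAt_keeps hK₂ rfl rfl rfl rfl rfl rfl rfl])
    ((hK₂.qv .wElig rfl).trans hwE)
    ((hK₂.qv .wBene rfl).trans (hwB.trans (by rw [Instance.wBene, pow_two]))) hM
  refine Runs.seq (count_spec σ₂) (T₂ := 40) ?_ (by rw [hL₂.numS]; omega)
  rintro σ₃ hK₃ ⟨he, hb⟩
  rw [hL₂.numS] at he hb
  have hL₃ := hL₂.keeps hK₃ rfl rfl rfl rfl rfl rfl
  refine (kink_spec (hH₂.keeps hK₃ rfl rfl rfl rfl)).mono le_rfl fun σ₄ hK₄ hH₄ =>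
    ⟨hL₃.keeps hK₄ rfl rfl rfl rfl rfl rfl, μ, hμ, ?_⟩
  rwa [he, hb, ← hE, ← hB] at hH₄

theorem firstLoop_spec {I : Instance} {σ : State} (hL : Loaded I σ) (hout : σ.out = []) :
    Runs firstLoopProg σ (I.n * (1110 * (I.n + 1) ^ 3) + 20) (fun σ' =>
      ∃ μ : ℕ → Matching I, (∀ k ∈ Finset.Icc 1 I.n, (μ k).IsMaxWeight k) ∧
        KinksHeld (kinks ((List.range' 1 I.n).map fun k => (μ k).point)) σ') := by
  have hp : 1 ≤ (I.n + 1) ^ 3 := Nat.one_le_pow _ _ (by omega)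
  refine Runs.step (T₂ := I.n * (1110 * (I.n + 1) ^ 3) + 10) rfl ?_ (by
    have : (NVar.m ≔ₙ num 0).bound = 2 := rfl
    omega)
  refine Runs.forTo (T := 1100 * (I.n + 1) ^ 3) (L := 1) (H := I.n)
    (fun k σ => Loaded I σ ∧ ∃ μ : ℕ → Matching I, (∀ k' ∈ Finset.Ico 1 k, (μ k').IsMaxWeight k') ∧
      KinksHeld (kinks ((List.range' 1 (k - 1)).map fun k => (μ k).point)) σ)
    rfl (by omega) rfl ?_ ?_ ?_ ?_ ?_ ?_
  · intro σ' hK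
    exact (hK.nv .n rfl).trans hL.n
  · rintro k σ' v ⟨h1, μ, h2, h3⟩
    exact ⟨⟨h1.numP, h1.numS, h1.n, h1.elig, h1.bene, h1.seat_lt, h1.card_seat⟩, μ, h2,
      ⟨h3.m, h3.kinkE, h3.kinkB, h3.out⟩⟩
  · refine ⟨⟨hL.numP, hL.numS, hL.n, hL.elig, hL.bene, hL.seat_lt, hL.card_seat⟩,
      fun _ => Matching.empty I, by simp, ⟨rfl, ?_, ?_, hout⟩⟩ <;> simp [kinks]
  · rintro k σ' hk hk' hx hK ⟨hL', μ, hμ, hH⟩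
    refine (iteration_spec hL' hH).mono le_rfl ?_
    rintro σ'' - ⟨hL'', μ', hμ', hH'⟩
    refine ⟨hL'', Function.update μ k μ', fun k' hk'' => ?_, ?_⟩
    · rw [Finset.mem_Ico] at hk''
      by_cases h : k' = k
      · subst h
        rw [Function.update_self, ← hx]
        exact hμ'
      · rw [Function.update_of_ne h]
        exact hμ k' (Finset.mem_Ico.2 (by omega))
    · obtain ⟨k, rfl⟩ : ∃ d, k = d + 1 := ⟨k - 1, by omega⟩
      have : (List.range' 1 k).map (fun k' => (Function.update μ (k + 1) μ' k').point) =
          (List.range' 1 k).map fun k' => (μ k').point := by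
        refine List.map_congr_left fun k' hk' => ?_
        rw [List.mem_range'_1] at hk'
        rw [Function.update_of_ne (by omega)]
      rw [Nat.add_sub_cancel, List.range'_1_concat, List.map_append, this, kinks,
        List.foldl_append, add_comm 1 k]
      simpa [kinks] using hH'
  · have : I.n * (1100 * (I.n + 1) ^ 3 + 1 + 7) ≤ I.n * (1110 * (I.n + 1) ^ 3) :=
      Nat.mul_le_mul_left _ (by omega)
    simp only [NExp.cost, Nat.add_sub_cancel]
    omega
  · rintro σ' hK ⟨hL', μ, hμ, hH⟩
    exact ⟨μ, fun k hk => hμ k (by rw [Finset.mem_Icc] at hk; rw [Finset.mem_Ico]; omega), hH⟩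

/-- The inner loop of the second loop. -/
def segmentBody : Stmt :=
  forTo .j (num 1) (getN .kinkE (NVar.k +ₙ num 1) -ₙ getN .kinkE NVar.k -ₙ num 1) (
    .emit (toQ (getN .kinkE (NVar.k +ₙ num 1)) -ᵣ toQ NVar.j)
      (toQ (getN .kinkB (NVar.k +ₙ num 1)) +ᵣ
        toQ NVar.j *ᵣ (toQ (getN .kinkB NVar.k) -ᵣ toQ (getN .kinkB (NVar.k +ₙ num 1))) /ᵣ
          (toQ (getN .kinkE (NVar.k +ₙ num 1)) -ᵣ toQ (getN .kinkE NVar.k))))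

/-- The points between two consecutive kinks are appended to the output. -/
theorem segment_spec {σ : State} {n k : ℕ} {x x' : ℕ × ℕ}
    (hE : σ.na .kinkE k 0 = x.1) (hB : σ.na .kinkB k 0 = x.2)
    (hE' : σ.na .kinkE (k + 1) 0 = x'.1) (hB' : σ.na .kinkB (k + 1) 0 = x'.2)
    (hk : σ.nv .k = k) (hn : x'.1 ≤ n) :
    Runs segmentBody σ (90 * n + 60) (fun σ' => σ'.out = σ.out ++ interpolate x x') := by
  unfold segmentBody
  refine Runs.forTo (T := 50) (L := 1) (H := x'.1 - x.1 - 1)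
    (fun j σ' => σ'.out = σ.out ++ (interpolate x x').take (j - 1))
    rfl (by omega) rfl ?_ (fun _ _ _ h => h) (by simp) ?_ ?_ ?_
  · intro σ' hK
    simp only [NExp.eval, hK.na .kinkE rfl, hK.nv .k rfl, hk, hE, hE']
  · intro j σ' hj hj' hx hK hI
    obtain ⟨j, rfl⟩ : ∃ d, j = d + 1 := ⟨j - 1, by omega⟩
    refine Runs.of_loopFree rfl (by decide) ?_
    have hlen : (interpolate x x').length = x'.1 - x.1 - 1 := by rw [interpolate_eq]; simp
    rw [Nat.add_sub_cancel] at hI ⊢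
    rw [List.take_succ_eq_append_getElem (by omega), ← List.append_assoc, ← hI]
    simp only [Stmt.run, NExp.eval, QExp.eval, hK.na .kinkE rfl, hK.na .kinkB rfl, hK.nv .k rfl, hk,
      hE, hE', hB, hB', hx, interpolate_eq, List.getElem_map, List.getElem_range', one_mul,
      add_comm 1 j]
  · simp only [NExp.cost, Nat.add_sub_cancel]
    omega
  · intro σ' hK hI
    rw [hI, Nat.add_sub_cancel, List.take_of_length_le]
    rw [interpolate_eq]
    simp

theorem secondLoop_spec {n : ℕ} {K : List (ℕ × ℕ)} {σ : State} (h : KinksHeld K σ)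
    (hm : K.length ≤ n) (hn : ∀ x ∈ K, x.1 ≤ n) :
    Runs secondLoopProg σ (100 * (n + 1) ^ 2) (fun σ' => σ'.out = outputOf K) := by
  have hlen : (K.zip K.tail).length = K.length - 1 := by simp
  refine Runs.forTo (s := segmentBody) (T := 90 * n + 60) (L := 1) (H := K.length - 1)
    (fun k σ' => σ'.out = σ.out ++ ((K.zip K.tail).take (k - 1)).flatMap fun y =>
      interpolate y.1 y.2)
    rfl (by omega) rfl ?_ (fun _ _ _ h => h) (by simp) ?_ ?_ ?_
  · intro σ' hK
    simp only [NExp.eval, hK.nv .m rfl, h.m]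
  · intro k σ' hk hk' hx hK hI
    obtain ⟨k, rfl⟩ : ∃ d, k = d + 1 := ⟨k - 1, by omega⟩
    have hlt : k + 1 < K.length := by omega
    rw [Nat.add_sub_cancel] at hI ⊢
    have h1 : K[k]? = some K[k] := List.getElem?_eq_getElem (by omega)
    have h2 : K[k + 1]? = some K[k + 1] := List.getElem?_eq_getElem hlt
    refine (segment_spec (x := K[k]) (x' := K[k + 1]) (n := n)
      (by rw [hK.na .kinkE rfl]; exact h.kinkE _ _ h1)
      (by rw [hK.na .kinkB rfl]; exact h.kinkB _ _ h1)
      (by rw [hK.na .kinkE rfl]; exact h.kinkE _ _ h2)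
      (by rw [hK.na .kinkB rfl]; exact h.kinkB _ _ h2) hx
      (hn _ (List.getElem_mem hlt))).mono le_rfl fun σ'' _ ho => ?_
    rw [ho, hI, List.take_succ_eq_append_getElem (by omega), List.flatMap_append,
      ← List.append_assoc]
    simp
  · have h1 : (K.length - 1) * (90 * n + 60 + (1 + 1 + 1) + 7) ≤
        n * (90 * n + 60 + (1 + 1 + 1) + 7) :=
      Nat.mul_le_mul_right _ (by omega)
    have h2 : 100 * (n + 1) ^ 2 = n * (90 * n + 60 + (1 + 1 + 1) + 7) + 10 * n ^ 2 +
        130 * n + 100 := by ring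
    simp only [NExp.cost, Nat.add_sub_cancel]
    omega
  · intro σ' hK hI
    rw [hI, Nat.add_sub_cancel, List.take_of_length_le (by omega), h.out]
    rfl

end RHA

theorem theorem3 :
    -- whichever maximum-weight matchings are selected, the output is the entire frontier
    (∀ I : RHA.Instance, 0 < I.n → ∀ μ : ℕ → RHA.Matching I,
      (∀ k ∈ Finset.Icc 1 I.n, (μ k).IsMaxWeight k) →
        {x | x ∈ I.output μ} = I.frontierQ) ∧
    -- the program carries out this algorithm, outputs the entire frontier, in `O(n⁴)` steps
    ∃ K : ℕ, ∀ I : RHA.Instance, 0 < I.n →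
      ∃ (t : ℕ) (σ : RHA.State), RHA.Exec RHA.rhaProg I.init t σ ∧
        (∃ μ : ℕ → RHA.Matching I, (∀ k ∈ Finset.Icc 1 I.n, (μ k).IsMaxWeight k) ∧
          σ.out = I.output μ) ∧
        {x | x ∈ σ.out} = I.frontierQ ∧
        t ≤ K * (I.n ^ 4 + (Finset.univ.filter fun c => I.quota c = 0).card) := by
  refine ⟨RHA.output_eq_frontier, 10000, fun I hn => ?_⟩
  set z := (Finset.univ.filter fun c => I.quota c = 0).card with hz
  have h3 : (I.n + 1) ^ 3 ≤ 8 * I.n ^ 3 :=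
    (Nat.pow_le_pow_left (by omega : I.n + 1 ≤ 2 * I.n) 3).trans (by rw [mul_pow]; omega)
  have h2 : (I.n + 1) ^ 2 ≤ 4 * I.n ^ 4 :=
    (Nat.pow_le_pow_left (by omega : I.n + 1 ≤ 2 * I.n) 2).trans
      (by rw [mul_pow]; exact Nat.mul_le_mul_left _ (Nat.pow_le_pow_right hn (by omega)))
  have h4 : I.n * (1110 * (I.n + 1) ^ 3) ≤ 8880 * I.n ^ 4 := by
    calc I.n * (1110 * (I.n + 1) ^ 3) ≤ I.n * (1110 * (8 * I.n ^ 3)) := by gcongr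
      _ = 8880 * I.n ^ 4 := by ring
  have h1 : I.n ≤ I.n ^ 4 := Nat.le_self_pow (by omega) _
  have key : RHA.Runs RHA.rhaProg I.init (10000 * (I.n ^ 4 + z)) (fun σ =>
      ∃ μ : ℕ → RHA.Matching I, (∀ k ∈ Finset.Icc 1 I.n, (μ k).IsMaxWeight k) ∧
        σ.out = I.output μ) := by
    refine RHA.Runs.seq (RHA.setup_spec I) (T₂ := 9500 * I.n ^ 4) (fun σ₁ hK₁ hL => ?_) (by omega)
    refine RHA.Runs.seq (RHA.firstLoop_spec hL (hK₁.out rfl)) (T₂ := 400 * I.n ^ 4) ?_ (by omega)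
    rintro σ₂ - ⟨μ, hμ, hH⟩
    have hsub := RHA.sublist_kinks ((List.range' 1 I.n).map fun k => (μ k).point)
    refine (RHA.secondLoop_spec (n := I.n) hH (hsub.length_le.trans (by simp)) fun x hx => ?_).mono
      (by omega) fun σ₃ _ hout => ⟨μ, hμ, hout⟩
    obtain ⟨k, -, rfl⟩ := List.mem_map.1 (hsub.subset hx)
    exact (μ k).card_E_le
  obtain ⟨t, σ, hex, ht, μ, hμ, hout⟩ := key
  exact ⟨t, σ, hex, ⟨μ, hμ, hout⟩, hout ▸ RHA.output_eq_frontier I hn μ hμ, ht⟩
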